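/- Let $s\in(0,1)$ and let $N\in\mathbb N$ satisfy $N>2s$. Let $V,W:\mathbb R^N\to(0,\infty)$ be continuous, let $\Lambda\subset\mathbb R^N$ be open and bounded, and let $x_0\in\mathbb R^N$, $\rho_0>0$ be such that $V,W\ge\rho_0$ on $\partial\Lambda$, $V(x_0),W(x_0)<\rho_0$, and $V\ge V(x_0)>0$, $W\ge W(x_0)>0$ on $\mathbb R^N$. Let $Q\in C^2([0,\infty)^2,\mathbb R)$ and $p\in\bigl(2,\tfrac{2N}{N-2s}\bigr)$ satisfy: - $Q(tu,tv)=t^pQ(u,v)$ for all $t>0$ and $u,v\ge0$; - there is a constant $K>0$ with $|Q_u(u,v)|+|Q_v(u,v)|\le K(u^{p-1}+v^{p-1})$ for all $u,v\ge0$; - $Q_u(0,1)=Q_v(1,0)=0$ and $Q_u(1,0)=Q_v(0,1)=0$; - $Q(u,v)>0$ for all $u,v>0$; - $Q_u,Q_v\ge0$ on $[0,\infty)^2$. Extend $Q$ to $\mathbb R^2$ by $Q(u,v)=0$ if $u\le0$ or $v\le0$, and write $|(u,v)|=\sqrt{u^2+v^2}$. Given $C>0$ and $a>0$, an admissible cut-off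 is a non-increasing $\eta\in C^2(\mathbb R,\mathbb R)$ with $\eta=1$ on $(-\infty,a]$, $\eta=0$ on $[5a,\infty)$, $|\eta'|\le C/a$ and $|\eta''|\le C/a^2$. For such $a,\eta$ put $$A=\max\Bigl\{\tfrac{Q(u,v)}{u^2+v^2}: a\le|(u,v)|\le5a\Bigr\},\qquad \hat Q(u,v)=\eta(|(u,v)|)\,Q(u,v)+\bigl(1-\eta(|(u,v)|)\bigr)A(u^2+v^2),$$ and let $H(x,u,v)=Q(u,v)$ for $x\in\Lambda$, $H(x,u,v)=\hat Q(u,v)$ for $x\notin\Lambda$. For $\varepsilon>0$ let $X_\varepsilon$ be the space of all $(u,v)\in H^s(\mathbb R^N)\times H^s(\mathbb R^N)$ with $\int_{\mathbb R^N}(V(\varepsilon x)u^2+W(\varepsilon x)v^2)\,dx<\infty$, with the norm $$\|(u,v)\|_\varepsilon^2=\frac{C_{N,s}}2\iint_{\mathbb R^{2N}}\frac{|u(x)-u(y)|^2+|v(x)-v(y)|^2}{|x-y|^{N+2s}}\,dx\,dy+\int_{\mathbb R^N}\bigl(V(\varepsilon x)u^2+W(\varepsilon x)v^2\bigr)dx,$$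 where $C_{N,s}=\dfrac{4^s\,s\,\Gamma(N/2+s)}{\pi^{N/2}\,\Gamma(1-s)}$ is the normalizing constant of $(-\Delta)^s$. On $X_\varepsilon$ define $$J_\varepsilon(u,v)=\tfrac12\|(u,v)\|_\varepsilon^2-\int_{\mathbb R^N}H(\varepsilon x,u,v)\,dx,\qquad \phi_\varepsilon(u,v)=\|(u,v)\|_\varepsilon^2-\int_{\mathbb R^N}\bigl(uH_u(\varepsilon x,u,v)+vH_v(\varepsilon x,u,v)\bigr)dx,$$ and let $\mathcal N_\varepsilon=\{z\in X_\varepsilon\setminus\{0\}:\langle J_\varepsilon'(z),z\rangle=0\}$ be the Nehari manifold, with tangent space $\ker\phi_\varepsilon'(z)$ at $z\in\mathcal N_\varepsilon$. For $z\in\mathcal N_\varepsilon$ let $\|J_\varepsilon'(z)\|_*$ be the norm of the restriction of the functional $J_\varepsilon'(z)$ to $\ker\phi_\varepsilon'(z)$. Then for every $C>0$ there is $a_0>0$ such that for all $a\in(0,a_0)$, all admissible cut-offs $\eta$ (for this $C$ and $a$), all $\varepsilon>0$ and all $c\in\mathbb R$, the functional $J_\varepsilon$ restricted to $\mathcal N_\varepsilon$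 satisfies $(PS)_c$: every sequence $(z_n)\subset\mathcal N_\varepsilon$ with $J_\varepsilon(z_n)\to c$ and $\|J_\varepsilon'(z_n)\|_*\to0$ has a subsequence that converges in $X_\varepsilon$ to a point of $\mathcal N_\varepsilon$. -/

import Mathlib

open MeasureTheory Filter Topology Set

noncomputable section

namespace FracSchrodinger

/-- The space `ℝ^N` with the Euclidean norm and Lebesgue measure. -/
abbrev E (N : ℕ) : Type := EuclideanSpace ℝ (Fin N)

/-- A positive continuous potential on `ℝ^N`. -/
structure Potential (N : ℕ) where
  toFun : E N → ℝ
  continuous_toFun : Continuous toFun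
  pos : ∀ x, 0 < toFun x

instance (N : ℕ) : CoeFun (Potential N) (fun _ => E N → ℝ) := ⟨Potential.toFun⟩

/-- The rescaled potential `x ↦ V (ε x)`. -/
def Potential.scale {N : ℕ} (V : Potential N) (ε : ℝ) : Potential N where
  toFun := fun x => V (ε • x)
  continuous_toFun := V.continuous_toFun.comp (continuous_const_smul ε)
  pos := fun x => V.pos (ε • x)

/-- The normalizing constant `C_{N,s}` of the fractional Laplacian `(-Δ)^s` on `ℝ^N`,
`C_{N,s} = 4^s s Γ(N/2 + s) / (π^(N/2) Γ(1 - s))`. -/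
def fracConst (N : ℕ) (s : ℝ) : ℝ :=
  4 ^ s * s * Real.Gamma (N / 2 + s) / (Real.pi ^ ((N : ℝ) / 2) * Real.Gamma (1 - s))

/-- The difference quotient `(u(x) - u(y)) / |x - y|^((N + 2s)/2)`. Its square is the integrand
of the Gagliardo seminorm. -/
def gagliardo {N : ℕ} (s : ℝ) (u : E N → ℝ) (q : E N × E N) : ℝ :=
  (u q.1 - u q.2) / ‖q.1 - q.2‖ ^ (((N : ℝ) + 2 * s) / 2)

lemma gagliardo_congr {N : ℕ} (s : ℝ) {u w : E N → ℝ} (h : u =ᵐ[volume] w) :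
    gagliardo s u =ᵐ[volume] gagliardo s w := by
  have h1 := Measure.quasiMeasurePreserving_fst (μ := (volume : Measure (E N)))
    (ν := (volume : Measure (E N))) |>.ae_eq_comp h
  have h2 := Measure.quasiMeasurePreserving_snd (μ := (volume : Measure (E N)))
    (ν := (volume : Measure (E N))) |>.ae_eq_comp h
  filter_upwards [h1, h2] with q h1 h2
  simp only [Function.comp] at h1 h2
  simp only [gagliardo, h1, h2]

lemma gagliardo_add {N : ℕ} (s : ℝ) (u w : E N → ℝ) :
    gagliardo s (u + w) = gagliardo s u + gagliardo s w := by
  funext q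
  simp only [gagliardo, Pi.add_apply]
  ring

lemma gagliardo_smul {N : ℕ} (s c : ℝ) (u : E N → ℝ) :
    gagliardo s (c • u) = c • gagliardo s u := by
  funext q
  simp only [gagliardo, Pi.smul_apply, smul_eq_mul]
  ring

lemma integrable_potential_mul {N : ℕ} (U : Potential N) (u w : Lp ℝ 2 (volume : Measure (E N)))
    (hu : Integrable (fun x => U x * u x ^ 2)) (hw : Integrable (fun x => U x * w x ^ 2)) :
    Integrable (fun x => U x * (u x * w x)) := by
  refine (hu.add hw).mono' ?_ ?_
  · exact U.continuous_toFun.aestronglyMeasurable.mul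
      ((Lp.aestronglyMeasurable u).mul (Lp.aestronglyMeasurable w))
  · refine Eventually.of_forall fun x => ?_
    have hU := U.pos x
    simp only [Pi.add_apply, Real.norm_eq_abs, abs_mul, abs_of_pos hU]
    have : |u x| * |w x| ≤ u x ^ 2 + w x ^ 2 := by
      nlinarith [sq_nonneg (|u x| - |w x|), sq_abs (u x), sq_abs (w x),
        sq_nonneg (u x), sq_nonneg (w x)]
    nlinarith

/-- The functions `u ∈ H^s(ℝ^N)` (that is `u ∈ L²` with finite Gagliardo seminorm) such that
`∫ U u² < ∞`, as a linear subspace of `L²(ℝ^N)`. -/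
def fracSubmodule {N : ℕ} (s : Ioo (0 : ℝ) 1) (U : Potential N) :
    Submodule ℝ (Lp ℝ 2 (volume : Measure (E N))) where
  carrier := {u | MemLp (gagliardo (s : ℝ) u) 2 volume ∧ Integrable (fun x => U x * u x ^ 2)}
  add_mem' := by
    rintro u w ⟨hu, hu'⟩ ⟨hw, hw'⟩
    refine ⟨(memLp_congr_ae ((gagliardo_congr (s : ℝ) (Lp.coeFn_add u w)).trans
      (gagliardo_add (s : ℝ) u w).eventuallyEq)).2 (hu.add hw), ?_⟩
    refine ((hu'.add hw').add ((integrable_potential_mul U u w hu' hw').const_mul 2)).congr ?_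
    filter_upwards [Lp.coeFn_add u w] with x hx
    simp only [hx, Pi.add_apply]
    ring
  zero_mem' := by
    have h0 : ((0 : Lp ℝ 2 (volume : Measure (E N))) : E N → ℝ) =ᵐ[volume] 0 :=
      Lp.coeFn_zero ℝ 2 volume
    refine ⟨(memLp_congr_ae (gagliardo_congr (s : ℝ) h0)).2 ?_, ?_⟩
    · have : gagliardo (s : ℝ) (0 : E N → ℝ) = 0 := by funext q; simp [gagliardo]
      rw [this]
      exact MemLp.zero
    · refine (integrable_zero (E N) ℝ volume).congr ?_
      exact Eventually.of_forall fun x => by simp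
  smul_mem' := by
    rintro c u ⟨hu, hu'⟩
    refine ⟨(memLp_congr_ae ((gagliardo_congr (s : ℝ) (Lp.coeFn_smul c u)).trans
      (gagliardo_smul (s : ℝ) c u).eventuallyEq)).2 (hu.const_smul c), ?_⟩
    refine (hu'.const_mul (c ^ 2)).congr ?_
    filter_upwards [Lp.coeFn_smul c u] with x hx
    simp only [hx, Pi.smul_apply, smul_eq_mul]
    ring

/-- The space `{u ∈ H^s(ℝ^N) : ∫ U u² < ∞}`. It is a type of its own because it does not carry
the `L²` norm, but the norm given by
`‖u‖² = (C_{N,s}/2) ∬ |u(x) - u(y)|² / |x - y|^(N + 2s) dx dy + ∫ U u² dx`. -/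
def FracSpace {N : ℕ} (s : Ioo (0 : ℝ) 1) (U : Potential N) : Type := ↥(fracSubmodule s U)

instance {N : ℕ} (s : Ioo (0 : ℝ) 1) (U : Potential N) : AddCommGroup (FracSpace s U) :=
  inferInstanceAs (AddCommGroup ↥(fracSubmodule s U))

instance {N : ℕ} (s : Ioo (0 : ℝ) 1) (U : Potential N) : Module ℝ (FracSpace s U) :=
  inferInstanceAs (Module ℝ ↥(fracSubmodule s U))

/-- The underlying element of `L²(ℝ^N)`. -/
def FracSpace.toL2 {N : ℕ} {s : Ioo (0 : ℝ) 1} {U : Potential N} (u : FracSpace s U) :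
    Lp ℝ 2 (volume : Measure (E N)) :=
  Subtype.val (p := fun w => w ∈ fracSubmodule s U) u

instance {N : ℕ} (s : Ioo (0 : ℝ) 1) (U : Potential N) : CoeFun (FracSpace s U) (fun _ => E N → ℝ) :=
  ⟨fun u => u.toL2⟩

lemma fracConst_nonneg (N : ℕ) (s : Ioo (0 : ℝ) 1) : 0 ≤ fracConst N s := by
  obtain ⟨s, h0, h1⟩ := s
  have := Real.Gamma_pos_of_pos (s := (N : ℝ) / 2 + s) (by positivity)
  have := Real.Gamma_pos_of_pos (s := 1 - s) (by linarith)
  unfold fracConst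
  positivity

/-- The inner product
`(C_{N,s}/2) ∬ (u(x) - u(y)) (w(x) - w(y)) / |x - y|^(N + 2s) dx dy + ∫ U u w dx`. -/
def fracInner {N : ℕ} {s : Ioo (0 : ℝ) 1} {U : Potential N} (u w : FracSpace s U) : ℝ :=
  fracConst N s / 2 * (∫ q : E N × E N, gagliardo (s : ℝ) u q * gagliardo (s : ℝ) w q)
    + ∫ x, U x * (u x * w x)

@[reducible]
def fracCore {N : ℕ} (s : Ioo (0 : ℝ) 1) (U : Potential N) :
    InnerProductSpace.Core ℝ (FracSpace s U) where
  inner := fracInner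
  conj_inner_symm := by
    intro u w
    simp only [fracInner, conj_trivial, mul_comm]
  re_inner_nonneg := by
    intro u
    have h1 : 0 ≤ ∫ q : E N × E N, gagliardo (s : ℝ) u q * gagliardo (s : ℝ) u q :=
      integral_nonneg fun q => mul_self_nonneg _
    have h2 : 0 ≤ ∫ x, U x * (u x * u x) :=
      integral_nonneg fun x => mul_nonneg (U.pos x).le (mul_self_nonneg _)
    have h3 := fracConst_nonneg N s
    simp only [fracInner, RCLike.re_to_real]
    positivity
  add_left := by
    rintro u v w
    obtain ⟨hu, hu'⟩ : u.toL2 ∈ fracSubmodule s U := Subtype.property u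
    obtain ⟨hv, hv'⟩ : v.toL2 ∈ fracSubmodule s U := Subtype.property v
    obtain ⟨hw, hw'⟩ : w.toL2 ∈ fracSubmodule s U := Subtype.property w
    have e : ((u + v).toL2 : E N → ℝ) =ᵐ[volume] u.toL2 + v.toL2 := Lp.coeFn_add u.toL2 v.toL2
    have e1 : (∫ q : E N × E N, gagliardo (s : ℝ) (u + v).toL2 q * gagliardo (s : ℝ) w q)
        = (∫ q : E N × E N, gagliardo (s : ℝ) u q * gagliardo (s : ℝ) w q)
          + ∫ q : E N × E N, gagliardo (s : ℝ) v q * gagliardo (s : ℝ) w q := by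
      have i1 : Integrable (fun q => gagliardo (s : ℝ) u q * gagliardo (s : ℝ) w q) volume :=
        hu.integrable_mul hw
      have i2 : Integrable (fun q => gagliardo (s : ℝ) v q * gagliardo (s : ℝ) w q) volume :=
        hv.integrable_mul hw
      rw [← integral_add i1 i2]
      refine integral_congr_ae ?_
      filter_upwards [gagliardo_congr (s : ℝ) e] with q hq
      rw [hq, gagliardo_add, Pi.add_apply]
      ring
    have e2 : (∫ x, U x * ((u + v).toL2 x * w x))
        = (∫ x, U x * (u x * w x)) + ∫ x, U x * (v x * w x) := by
      rw [← integral_add (integrable_potential_mul U u.toL2 w.toL2 hu' hw')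
        (integrable_potential_mul U v.toL2 w.toL2 hv' hw')]
      refine integral_congr_ae ?_
      filter_upwards [e] with x hx
      rw [hx, Pi.add_apply]
      ring
    simp only [fracInner]
    rw [e1, e2]
    ring
  smul_left := by
    intro u w c
    have e : ((c • u).toL2 : E N → ℝ) =ᵐ[volume] c • u.toL2 := Lp.coeFn_smul c u.toL2
    have e1 : (∫ q : E N × E N, gagliardo (s : ℝ) (c • u).toL2 q * gagliardo (s : ℝ) w q)
        = c * ∫ q : E N × E N, gagliardo (s : ℝ) u q * gagliardo (s : ℝ) w q := by
      rw [← integral_const_mul]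
      refine integral_congr_ae ?_
      filter_upwards [gagliardo_congr (s : ℝ) e] with q hq
      rw [hq, gagliardo_smul, Pi.smul_apply, smul_eq_mul]
      ring
    have e2 : (∫ x, U x * ((c • u).toL2 x * w x)) = c * ∫ x, U x * (u x * w x) := by
      rw [← integral_const_mul]
      refine integral_congr_ae ?_
      filter_upwards [e] with x hx
      rw [hx, Pi.smul_apply, smul_eq_mul]
      ring
    simp only [fracInner, conj_trivial]
    rw [e1, e2]
    ring
  definite := by
    intro u hu
    obtain ⟨-, hu'⟩ : u.toL2 ∈ fracSubmodule s U := Subtype.property u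
    have h1 : 0 ≤ ∫ q : E N × E N, gagliardo (s : ℝ) u q * gagliardo (s : ℝ) u q :=
      integral_nonneg fun q => mul_self_nonneg _
    have h2 : 0 ≤ fun x => U x * (u x * u x) :=
      fun x => mul_nonneg (U.pos x).le (mul_self_nonneg _)
    have h3 := mul_nonneg (div_nonneg (fracConst_nonneg N s) zero_le_two) h1
    have h4 : (∫ x, U x * (u x * u x)) = 0 := by
      have := integral_nonneg (μ := volume) h2
      simp only [fracInner] at hu
      linarith
    have h5 := (integral_eq_zero_iff_of_nonneg h2
      (integrable_potential_mul U u.toL2 u.toL2 hu' hu')).1 h4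
    have h6 : u.toL2 = 0 := by
      refine (Lp.eq_zero_iff_ae_eq_zero).2 ?_
      filter_upwards [h5] with x hx
      simpa [(U.pos x).ne'] using hx
    exact Subtype.ext h6

instance {N : ℕ} (s : Ioo (0 : ℝ) 1) (U : Potential N) : NormedAddCommGroup (FracSpace s U) :=
  (fracCore s U).toNormedAddCommGroup

instance {N : ℕ} (s : Ioo (0 : ℝ) 1) (U : Potential N) : InnerProductSpace ℝ (FracSpace s U) :=
  InnerProductSpace.ofCore (fracCore s U).toCore

/-- The space `X_ε = {(u, v) ∈ H^s × H^s : ∫ (V(εx) u² + W(εx) v²) dx < ∞}` with the norm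
`‖(u, v)‖_ε² = ‖u‖² + ‖v‖²`, where `‖u‖²` is formed with the potential `V(ε ·)` and `‖v‖²` with
`W(ε ·)`. -/
abbrev XSpace {N : ℕ} (s : Ioo (0 : ℝ) 1) (V W : Potential N) (ε : ℝ) : Type :=
  WithLp 2 (FracSpace s (V.scale ε) × FracSpace s (W.scale ε))

lemma xSpace_norm_sq {N : ℕ} (s : Ioo (0 : ℝ) 1) (V W : Potential N) (ε : ℝ)
    (z : XSpace s V W ε) :
    ‖z‖ ^ 2 =
      (fracConst N s / 2 * ∫ q : E N × E N, gagliardo (s : ℝ) z.fst q ^ 2)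
      + (fracConst N s / 2 * ∫ q : E N × E N, gagliardo (s : ℝ) z.snd q ^ 2)
      + (∫ x, V (ε • x) * z.fst x ^ 2) + ∫ x, W (ε • x) * z.snd x ^ 2 := by
  have h : ∀ {U : Potential N} (u : FracSpace s U), ‖u‖ ^ 2 =
      fracConst N s / 2 * (∫ q : E N × E N, gagliardo (s : ℝ) u q ^ 2) + ∫ x, U x * u x ^ 2 := by
    intro U u
    rw [← real_inner_self_eq_norm_sq]
    simp only [pow_two]
    rfl
  rw [WithLp.prod_norm_sq_eq_of_L2, h, h]
  simp only [Potential.scale]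
  ring

/-- Conditions on the potentials, on the open bounded set `Λ`, the point `x₀` and `ρ₀`. -/
structure PotentialHyp {N : ℕ} (V W : Potential N) (Λ : Set (E N)) (x₀ : E N) (ρ₀ : ℝ) :
    Prop where
  isOpen : IsOpen Λ
  isBounded : Bornology.IsBounded Λ
  rho_pos : 0 < ρ₀
  h1 : ∀ x ∈ frontier Λ, ρ₀ ≤ V x ∧ ρ₀ ≤ W x
  h2 : V x₀ < ρ₀ ∧ W x₀ < ρ₀
  h3 : ∀ x, V x₀ ≤ V x ∧ W x₀ ≤ W x

/-- The closed quadrant `[0, ∞) × [0, ∞)`. -/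
def quadrant : Set (ℝ × ℝ) := Ici 0 ×ˢ Ici 0

/-- The partial derivatives of a function on the closed quadrant (one-sided on the axes). -/
def quadDerivU (Q : ℝ × ℝ → ℝ) (u v : ℝ) : ℝ := derivWithin (fun t => Q (t, v)) (Ici 0) u

def quadDerivV (Q : ℝ × ℝ → ℝ) (u v : ℝ) : ℝ := derivWithin (fun t => Q (u, t)) (Ici 0) v

/-- Conditions on the nonlinearity `Q`; only its values on the closed quadrant matter. -/
structure NonlinearityHyp (N : ℕ) (s p : ℝ) (Q : ℝ × ℝ → ℝ) : Prop where
  contDiffOn : ContDiffOn ℝ 2 Q quadrant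
  two_lt : 2 < p
  subcritical : p < 2 * N / (N - 2 * s)
  q1 : ∀ t u v : ℝ, 0 < t → 0 ≤ u → 0 ≤ v → Q (t * u, t * v) = t ^ p * Q (u, v)
  q2 : ∃ C > 0, ∀ u v : ℝ, 0 ≤ u → 0 ≤ v →
    |quadDerivU Q u v| + |quadDerivV Q u v| ≤ C * (u ^ (p - 1) + v ^ (p - 1))
  q3 : quadDerivU Q 0 1 = 0 ∧ quadDerivV Q 1 0 = 0
  q4 : quadDerivU Q 1 0 = 0 ∧ quadDerivV Q 0 1 = 0
  q5 : ∀ u v : ℝ, 0 < u → 0 < v → 0 < Q (u, v)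
  q6 : ∀ u v : ℝ, 0 ≤ u → 0 ≤ v → 0 ≤ quadDerivU Q u v ∧ 0 ≤ quadDerivV Q u v

/-- The extension of `Q` to the plane by `Q(u, v) = 0` if `u ≤ 0` or `v ≤ 0`. -/
def extQ (Q : ℝ × ℝ → ℝ) (u v : ℝ) : ℝ := if 0 < u ∧ 0 < v then Q (u, v) else 0

/-- `|(u, v)| = √(u² + v²)`. -/
def absPair (u v : ℝ) : ℝ := √(u ^ 2 + v ^ 2)

/-- Conditions on the cut-off function `η` with parameter `a`. -/
structure CutoffHyp (C a : ℝ) (η : ℝ → ℝ) : Prop where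
  contDiff : ContDiff ℝ 2 η
  antitone : Antitone η
  eq_one : ∀ t ≤ a, η t = 1
  eq_zero : ∀ t, 5 * a ≤ t → η t = 0
  deriv_le : ∀ t, |deriv η t| ≤ C / a
  deriv_two_le : ∀ t, |deriv (deriv η) t| ≤ C / a ^ 2

/-- `A = max {Q(u, v)/(u² + v²) : a ≤ |(u, v)| ≤ 5a}`. -/
def penaltyConst (Q : ℝ × ℝ → ℝ) (a : ℝ) : ℝ :=
  sSup ((fun z : ℝ × ℝ => extQ Q z.1 z.2 / (z.1 ^ 2 + z.2 ^ 2)) ''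
    {z | a ≤ absPair z.1 z.2 ∧ absPair z.1 z.2 ≤ 5 * a})

/-- `Q̂(u, v) = η(|(u, v)|) Q(u, v) + (1 - η(|(u, v)|)) A (u² + v²)`. -/
def hatQ (Q : ℝ × ℝ → ℝ) (a : ℝ) (η : ℝ → ℝ) (u v : ℝ) : ℝ :=
  η (absPair u v) * extQ Q u v
    + (1 - η (absPair u v)) * (penaltyConst Q a * (u ^ 2 + v ^ 2))

open Classical in
/-- The penalized nonlinearity `H(x, u, v) = χ_Λ(x) Q(u, v) + (1 - χ_Λ(x)) Q̂(u, v)`. -/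
def penH {N : ℕ} (Λ : Set (E N)) (Q : ℝ × ℝ → ℝ) (a : ℝ) (η : ℝ → ℝ) (x : E N) (u v : ℝ) : ℝ :=
  if x ∈ Λ then extQ Q u v else hatQ Q a η u v

/-- The partial derivative `H_u(x, u, v)`. -/
def penHu {N : ℕ} (Λ : Set (E N)) (Q : ℝ × ℝ → ℝ) (a : ℝ) (η : ℝ → ℝ) (x : E N) (u v : ℝ) : ℝ :=
  deriv (fun t => penH Λ Q a η x t v) u

/-- The partial derivative `H_v(x, u, v)`. -/
def penHv {N : ℕ} (Λ : Set (E N)) (Q : ℝ × ℝ → ℝ) (a : ℝ) (η : ℝ → ℝ) (x : E N) (u v : ℝ) : ℝ :=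
  deriv (fun t => penH Λ Q a η x u t) v

/-- The functional `J_ε(u, v) = ½ ‖(u, v)‖_ε² - ∫ H(εx, u, v) dx`. -/
def JFun {N : ℕ} (s : Ioo (0 : ℝ) 1) (V W : Potential N) (Λ : Set (E N)) (Q : ℝ × ℝ → ℝ)
    (a : ℝ) (η : ℝ → ℝ) (ε : ℝ) (z : XSpace s V W ε) : ℝ :=
  1 / 2 * ‖z‖ ^ 2 - ∫ x, penH Λ Q a η (ε • x) (z.fst x) (z.snd x)

/-- The constraint functional
`φ_ε(u, v) = ‖(u, v)‖_ε² - ∫ (u H_u(εx, u, v) + v H_v(εx, u, v)) dx`. -/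
def phiFun {N : ℕ} (s : Ioo (0 : ℝ) 1) (V W : Potential N) (Λ : Set (E N)) (Q : ℝ × ℝ → ℝ)
    (a : ℝ) (η : ℝ → ℝ) (ε : ℝ) (z : XSpace s V W ε) : ℝ :=
  ‖z‖ ^ 2 - ∫ x, (z.fst x * penHu Λ Q a η (ε • x) (z.fst x) (z.snd x)
    + z.snd x * penHv Λ Q a η (ε • x) (z.fst x) (z.snd x))

/-- The Nehari manifold of a functional `J`: all `z ≠ 0` with `⟨J'(z), z⟩ = 0`. -/
def nehari {X : Type*} [NormedAddCommGroup X] [NormedSpace ℝ X] (J : X → ℝ) : Set X :=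
  {z | z ≠ 0 ∧ fderiv ℝ J z z = 0}

/-- The norm `‖J'(z)‖_*` of the derivative at `z` of the restriction of `J` to a manifold cut out
by `φ = 0`, that is the norm of `J'(z)` as a functional on the tangent space `ker φ'(z)`. -/
def tangentDerivNorm {X : Type*} [NormedAddCommGroup X] [NormedSpace ℝ X] (J φ : X → ℝ)
    (z : X) : ℝ :=
  ‖(fderiv ℝ J z).comp (fderiv ℝ φ z).ker.subtypeL‖

/-- The Palais-Smale condition at level `c` for the restriction of `J` to the manifold `M`, where
`M` is cut out by `φ = 0`. -/
def PalaisSmaleOn {X : Type*} [NormedAddCommGroup X] [NormedSpace ℝ X] (J φ : X → ℝ) (M : Set X)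
    (c : ℝ) : Prop :=
  ∀ z : ℕ → X, (∀ n, z n ∈ M) → Tendsto (fun n => J (z n)) atTop (𝓝 c) →
    Tendsto (fun n => tangentDerivNorm J φ (z n)) atTop (𝓝 0) →
    ∃ w ∈ M, ∃ k : ℕ → ℕ, StrictMono k ∧ Tendsto (fun n => z (k n)) atTop (𝓝 w)

end FracSchrodinger

end

/-! Split `∫ H(εx, z) dx` into the integral of `Q(z)` over `ε⁻¹Λ` and the integral of `Q̂(z)` over
the complement. The first part is homogeneous of degree `p`, and its derivative is compact because
`ε⁻¹Λ` has finite measure and `p` is subcritical. The second part is a small perturbation: by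
homogeneity of `Q` the gradient of `Q̂` is globally Lipschitz with constant `O(a^(p-2))`
(`exists_gradLip_hatQ`). Since `V` and `W` are bounded below by `c₀ = min (V x₀) (W x₀)`, the
squared `L²` norm is at most `c₀⁻¹ ‖z‖²`. So everything the second part contributes is at most `κ
‖z‖²` with `κ = O(a^(p-2))`, uniformly in `ε` and `η`, and a small `a` gives `κ < min 1 ((p-2)/2)`.

The rest is an abstract argument (`PerturbedHomogeneous.palaisSmaleOn`) for `J = ½‖z‖² - Ψ` with `D
= Ψ'`. On the Nehari manifold `p Ψ - D z z ≤ κ ‖z‖²` makes bounded energy imply bounded norm, and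
superquadratic growth keeps `‖z‖` away from `0`. The constraint has radial derivative at most
`-(p-2-κ)‖z‖²` while `J'(z) z = 0`, so a small tangential derivative forces the full derivative to
be small. Finally `‖x - y‖² = (J'(x) - J'(y))(x - y) + (D x - D y)(x - y)`, where the first term
tends to zero and the second is at most `κ ‖x - y‖² + o(1)` along a subsequence. As `κ < 1`, the
subsequence is Cauchy, and no weak limit has to be identified.

The analytic input is proved from the Gagliardo energy directly. Subcritical Sobolev embedding: a
value of size `t` at `x` forces an energy density of order `t^(2+2sq/N)` at `x` once `u` is bounded
in `L^q` (`exists_rpow_le_gagDensity`). Integrating turns an `L^q` bound into an `L^(2+2sq/N)`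
bound, and iterating from `q = 2` approaches the critical exponent `2N/(N-2s)`. Local Rellich
theorem: `u` differs from its means over balls of radius `r` by `O(r^s)` in `L²`, and the means
converge pointwise along a weakly convergent subsequence. Completeness of the space follows from
Fatou's lemma. -/

open MeasureTheory Filter Topology Set

noncomputable section

namespace FracSchrodinger

/-! ### The abstract Palais-Smale argument on the Nehari manifold. -/

section Abstract

variable {X : Type*} [NormedAddCommGroup X] [InnerProductSpace ℝ X]

/-- Structural properties of a functional `Ψ` with derivative `D` which guarantee that
`½ ‖z‖² - Ψ z` satisfies the Palais-Smale condition on its Nehari manifold: up to an error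
controlled by `κ ‖z‖²`, `Ψ` is homogeneous of degree `p` and has compact derivative. -/
structure PerturbedHomogeneous (p κ : ℝ) (Ψ : X → ℝ) (D : X → X →L[ℝ] ℝ) : Prop where
  hasFDerivAt : ∀ z, HasFDerivAt Ψ (D z) z
  mul_sub_le : ∀ z, p * Ψ z - D z z ≤ κ * ‖z‖ ^ 2
  rpow_mul_sub_le : ∀ z, ∀ t ∈ Icc (1 : ℝ) 2,
    t ^ p * D z z - D (t • z) (t • z) ≤ κ * (t - 1) * ‖z‖ ^ 2
  growth : ∃ B, 0 < B ∧ ∀ z, D z z ≤ κ * ‖z‖ ^ 2 + B * ‖z‖ ^ p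
  lipschitz : ∀ R, ∃ K, 0 ≤ K ∧ ∀ z w, ‖z‖ ≤ R → ‖w‖ ≤ R → |D z z - D w w| ≤ K * ‖z - w‖
  compact : ∀ z : ℕ → X, ∀ R, (∀ n, ‖z n‖ ≤ R) → ∃ k : ℕ → ℕ, StrictMono k ∧ ∀ e > 0, ∃ n₀,
    ∀ n ≥ n₀, ∀ m ≥ n₀, (D (z (k n)) - D (z (k m))) (z (k n) - z (k m))
      ≤ κ * ‖z (k n) - z (k m)‖ ^ 2 + e

variable {p κ : ℝ} {Ψ J φ : X → ℝ} {D : X → X →L[ℝ] ℝ}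

lemma PerturbedHomogeneous.fderiv_functional (h : PerturbedHomogeneous p κ Ψ D)
    (hJ : ∀ z, J z = 1 / 2 * ‖z‖ ^ 2 - Ψ z) (z : X) :
    fderiv ℝ J z = innerSL ℝ z - D z := by
  have h1 : HasFDerivAt (fun z : X => ‖z‖ ^ 2) (2 • innerSL ℝ z) z :=
    (hasStrictFDerivAt_norm_sq z).hasFDerivAt
  have h2 : HasFDerivAt J ((1 / 2 : ℝ) • (2 • innerSL ℝ z) - D z) z := by
    have := (h1.const_mul (1 / 2)).sub (h.hasFDerivAt z)
    exact this.congr_of_eventuallyEq (Eventually.of_forall hJ)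
  rw [h2.fderiv]
  ext w
  simp

lemma PerturbedHomogeneous.mem_nehari_iff (h : PerturbedHomogeneous p κ Ψ D)
    (hJ : ∀ z, J z = 1 / 2 * ‖z‖ ^ 2 - Ψ z) (z : X) :
    z ∈ nehari J ↔ z ≠ 0 ∧ D z z = ‖z‖ ^ 2 := by
  simp only [nehari, mem_ofPred_eq, h.fderiv_functional hJ, sub_apply,
    innerSL_apply_apply, real_inner_self_eq_norm_sq, sub_eq_zero]
  exact and_congr_right fun _ => eq_comm

/-- The Nehari manifold stays away from the origin. -/
lemma PerturbedHomogeneous.exists_le_norm (h : PerturbedHomogeneous p κ Ψ D) (hp : 2 < p)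
    (hκ : κ < 1) : ∃ δ > 0, ∀ z, z ≠ 0 → D z z = ‖z‖ ^ 2 → δ ≤ ‖z‖ := by
  obtain ⟨B, hB, hgr⟩ := h.growth
  -- Divide `‖z‖² ≤ κ ‖z‖² + B ‖z‖^p` by `‖z‖²` and solve for `‖z‖`.
  refine ⟨((1 - κ) / B) ^ (1 / (p - 2)),
    Real.rpow_pos_of_pos (div_pos (by linarith) hB) _, fun z hz hDz => ?_⟩
  have hz' : 0 < ‖z‖ := norm_pos_iff.2 hz
  have h1 := hgr z
  rw [hDz] at h1
  have h2 : ‖z‖ ^ p = ‖z‖ ^ (p - 2) * ‖z‖ ^ 2 := by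
    rw [← Real.rpow_natCast ‖z‖ 2, ← Real.rpow_add hz']
    norm_num
  have h3 : (1 - κ) / B ≤ ‖z‖ ^ (p - 2) := by
    rw [div_le_iff₀ hB]
    rw [h2] at h1
    have h4 : 0 < ‖z‖ ^ 2 := by positivity
    have : (1 - κ) * ‖z‖ ^ 2 ≤ (‖z‖ ^ (p - 2) * B) * ‖z‖ ^ 2 := by nlinarith
    exact le_of_mul_le_mul_right this h4
  calc ((1 - κ) / B) ^ (1 / (p - 2)) ≤ (‖z‖ ^ (p - 2)) ^ (1 / (p - 2)) :=
        Real.rpow_le_rpow (div_nonneg (by linarith) hB.le) h3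
          (one_div_nonneg.2 (by linarith))
    _ = ‖z‖ := by
        rw [← Real.rpow_mul hz'.le, mul_one_div_cancel (by linarith), Real.rpow_one]

/-- On the Nehari manifold, the constraint has negative derivative in the radial direction. -/
lemma PerturbedHomogeneous.fderiv_constraint_le (h : PerturbedHomogeneous p κ Ψ D)
    (hφ : ∀ z, φ z = ‖z‖ ^ 2 - D z z) {z : X} (hz : D z z = ‖z‖ ^ 2)
    (hd : DifferentiableAt ℝ φ z) :
    fderiv ℝ φ z z ≤ -(p - 2 - κ) * ‖z‖ ^ 2 := by
  have h1 : HasDerivAt (fun t : ℝ => φ (t • z)) (fderiv ℝ φ z z) 1 := by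
    have e1 : HasDerivAt (fun t : ℝ => t • z) z 1 := by
      simpa using (hasDerivAt_id (1 : ℝ)).smul_const z
    have e2 : HasFDerivAt φ (fderiv ℝ φ z) ((1 : ℝ) • z) := by
      rw [one_smul]; exact hd.hasFDerivAt
    exact e2.comp_hasDerivAt 1 e1
  -- This function dominates `φ(tz)` on `[1, 2]` and both vanish at `t = 1`, so slopes from the
  -- right compare. No second derivative of `Ψ` is needed.
  have h2 : HasDerivAt (fun t : ℝ => (t ^ 2 - t ^ p + κ * (t - 1)) * ‖z‖ ^ 2)
      (-(p - 2 - κ) * ‖z‖ ^ 2) 1 := by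
    have e1 : HasDerivAt (fun t : ℝ => t ^ p) p 1 := by
      simpa using Real.hasDerivAt_rpow_const (x := 1) (p := p) (Or.inl one_ne_zero)
    have e2 : HasDerivAt (fun t : ℝ => t ^ 2) 2 1 := by simpa using hasDerivAt_pow 2 (1 : ℝ)
    have e3 : HasDerivAt (fun t : ℝ => κ * (t - 1)) κ 1 := by
      simpa using ((hasDerivAt_id (1 : ℝ)).sub_const 1).const_mul κ
    exact (((e2.sub e1).add e3).mul_const (‖z‖ ^ 2)).congr_deriv (by ring)
  have h3 := (h2.sub h1)
  by_contra! hlt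
  have h4 : -(p - 2 - κ) * ‖z‖ ^ 2 - fderiv ℝ φ z z < 0 := by linarith
  have h5 := (hasDerivAt_iff_tendsto_slope.1 h3).mono_left
    (nhdsWithin_mono 1 (fun t (ht : 1 < t) => ht.ne') : 𝓝[>] (1 : ℝ) ≤ 𝓝[≠] 1)
  have h6 : ∀ᶠ t in 𝓝[>] (1 : ℝ), t ∈ Ioo (1 : ℝ) 2 := Ioo_mem_nhdsGT (by norm_num)
  obtain ⟨t, ht1, ht2⟩ := ((h5.eventually (gt_mem_nhds h4)).and h6).exists
  have h7 := h.rpow_mul_sub_le z t ⟨ht2.1.le, ht2.2.le⟩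
  rw [slope_def_field] at ht1
  have h8 : 0 < t - 1 := by linarith [ht2.1]
  rw [div_lt_iff₀ h8] at ht1
  have h9 : φ (t • z) = t ^ 2 * ‖z‖ ^ 2 - D (t • z) (t • z) := by
    rw [hφ, norm_smul, mul_pow, Real.norm_eq_abs, sq_abs]
  have h10 : φ z = 0 := by rw [hφ, hz, sub_self]
  simp only [Pi.sub_apply, one_smul, h9, h10, Real.one_rpow] at ht1
  rw [hz] at h7
  nlinarith

/-- A bound of the full derivative by its restriction to the kernel of another functional. -/
lemma norm_le_of_comp_ker {f g : X →L[ℝ] ℝ} {z : X} (hf : f z = 0) {b K R : ℝ} (hb : 0 < b)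
    (hgz : g z ≤ -b) (hg : ‖g‖ ≤ K) (hz : ‖z‖ ≤ R) :
    ‖f‖ ≤ ‖f.comp g.ker.subtypeL‖ * (1 + K * R / b) := by
  have hK : 0 ≤ K := (norm_nonneg g).trans hg
  have hR : 0 ≤ R := (norm_nonneg z).trans hz
  refine ContinuousLinearMap.opNorm_le_bound _ (by positivity) fun w => ?_
  have hgz0 : g z ≠ 0 := by linarith
  -- Projection along `z` onto `ker g`. It does not change the value of `f`, since `f z = 0`.
  set t := g w / g z with ht
  have hmem : w - t • z ∈ g.ker := by
    rw [LinearMap.mem_ker]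
    simp [ht, hgz0]
  have h1 : f w = (f.comp g.ker.subtypeL) ⟨w - t • z, hmem⟩ := by simp [hf]
  have h2 : |t| ≤ K * ‖w‖ / b := by
    rw [ht, abs_div]
    have e1 : b ≤ |g z| := by rw [abs_of_neg (by linarith)]; linarith
    have e2 : |g w| ≤ K * ‖w‖ := by
      have := g.le_opNorm w
      rw [Real.norm_eq_abs] at this
      exact this.trans (by gcongr)
    gcongr
  have h3 : ‖w - t • z‖ ≤ (1 + K * R / b) * ‖w‖ := by
    calc ‖w - t • z‖ ≤ ‖w‖ + |t| * ‖z‖ := by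
          simpa [norm_smul] using norm_sub_le w (t • z)
      _ ≤ ‖w‖ + K * ‖w‖ / b * R := by gcongr
      _ = _ := by ring
  rw [h1]
  calc _ ≤ ‖f.comp g.ker.subtypeL‖ * ‖w - t • z‖ := ContinuousLinearMap.le_opNorm _ _
    _ ≤ ‖f.comp g.ker.subtypeL‖ * ((1 + K * R / b) * ‖w‖) := by gcongr
    _ = _ := by ring

/-- A quantitative form of the vanishing of the Lagrange multiplier: the radial direction is
transversal to the manifold, uniformly on bounded sets since `‖z‖ ≥ δ`, and `J'(z)` vanishes on it.
-/
lemma PerturbedHomogeneous.norm_fderiv_le (h : PerturbedHomogeneous p κ Ψ D)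
    (hJ : ∀ z, J z = 1 / 2 * ‖z‖ ^ 2 - Ψ z) (hφ : ∀ z, φ z = ‖z‖ ^ 2 - D z z)
    (hκ : κ < 1) (hp : 2 < p) (hκp : κ < p - 2) (R : ℝ) :
    ∃ T, 0 ≤ T ∧ ∀ z ∈ nehari J, ‖z‖ ≤ R → ‖fderiv ℝ J z‖ ≤ tangentDerivNorm J φ z * T := by
  obtain ⟨δ, hδ, hlow⟩ := h.exists_le_norm hp hκ
  obtain ⟨K, hK, hlip⟩ := h.lipschitz (R + 1)
  by_cases hR : 0 ≤ R
  swap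
  · exact ⟨0, le_rfl, fun z _ hz => absurd ((norm_nonneg z).trans hz) hR⟩
  have hb : 0 < (p - 2 - κ) * δ ^ 2 := mul_pos (by linarith) (by positivity)
  -- A Lipschitz constant of `φ` near any `z` in the ball of radius `R`. The larger radius `R + 1`
  -- leaves room for a neighbourhood of `z`.
  set K' := K + 2 * (R + 1)
  refine ⟨1 + K' * R / ((p - 2 - κ) * δ ^ 2), by positivity, fun z hz hzR => ?_⟩
  obtain ⟨hz0, hDz⟩ := (h.mem_nehari_iff hJ z).1 hz
  by_cases hd : DifferentiableAt ℝ φ z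
  · have hzz : fderiv ℝ φ z z ≤ -((p - 2 - κ) * δ ^ 2) := by
      have h1 := h.fderiv_constraint_le hφ hDz hd
      have h2 : δ ^ 2 ≤ ‖z‖ ^ 2 := by gcongr; exact hlow z hz0 hDz
      nlinarith
    have hnorm : ‖fderiv ℝ φ z‖ ≤ K' := by
      refine norm_fderiv_le_of_lip' ℝ (by positivity) ?_
      filter_upwards [Metric.ball_mem_nhds z one_pos] with w hw
      have hwz : ‖w - z‖ < 1 := by rwa [← dist_eq_norm]
      have hwR : ‖w‖ ≤ R + 1 := by
        have := norm_le_norm_add_norm_sub' w z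
        linarith
      have h1 := hlip w z hwR (by linarith)
      have h2 : |‖w‖ - ‖z‖| ≤ ‖w - z‖ := abs_norm_sub_norm_le w z
      have h3 : |‖w‖ ^ 2 - ‖z‖ ^ 2| ≤ 2 * (R + 1) * ‖w - z‖ := by
        have e : ‖w‖ ^ 2 - ‖z‖ ^ 2 = (‖w‖ + ‖z‖) * (‖w‖ - ‖z‖) := by ring
        rw [e, abs_mul, abs_of_nonneg (by positivity)]
        gcongr
        linarith
      rw [hφ, hφ, Real.norm_eq_abs]
      calc |‖w‖ ^ 2 - D w w - (‖z‖ ^ 2 - D z z)|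
          = |(‖w‖ ^ 2 - ‖z‖ ^ 2) - (D w w - D z z)| := by congr 1; ring
        _ ≤ 2 * (R + 1) * ‖w - z‖ + K * ‖w - z‖ := (abs_sub _ _).trans (add_le_add h3 h1)
        _ = K' * ‖w - z‖ := by ring
    exact norm_le_of_comp_ker hz.2 hb hzz hnorm hzR
  -- Without differentiability the derivative takes the default value `0`, its kernel is the whole
  -- space, and the tangential norm already is the full norm.
  · have h0 : fderiv ℝ φ z = 0 := fderiv_zero_of_not_differentiableAt hd
    have htn : 0 ≤ tangentDerivNorm J φ z := by
      unfold tangentDerivNorm; positivity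
    have h1 : ‖fderiv ℝ J z‖ ≤ tangentDerivNorm J φ z := by
      refine ContinuousLinearMap.opNorm_le_bound _ htn fun w => ?_
      have hmem : w ∈ (fderiv ℝ φ z).ker := by rw [h0]; simp
      exact ((fderiv ℝ J z).comp (fderiv ℝ φ z).ker.subtypeL).le_opNorm ⟨w, hmem⟩
    have h2 : 0 ≤ K' * R / ((p - 2 - κ) * δ ^ 2) := by positivity
    nlinarith

/-- `κ < (p-2)/2` gives boundedness of the sequence, and `κ < 1` absorbs the error term in the
Cauchy estimate. -/
theorem PerturbedHomogeneous.palaisSmaleOn [CompleteSpace X]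
    (h : PerturbedHomogeneous p κ Ψ D) (hJ : ∀ z, J z = 1 / 2 * ‖z‖ ^ 2 - Ψ z)
    (hφ : ∀ z, φ z = ‖z‖ ^ 2 - D z z) (hκ : κ < 1) (hp : 2 < p) (hκp : κ < (p - 2) / 2)
    (c : ℝ) : PalaisSmaleOn J φ (nehari J) c := by
  intro z hz hJc hτ
  have hzN := fun n => (h.mem_nehari_iff hJ (z n)).1 (hz n)
  obtain ⟨b, hb⟩ := hJc.bddAbove_range
  have hm : 0 < 1 / 2 - (1 + κ) / p := by
    rw [sub_pos, div_lt_div_iff₀ (by linarith) (by norm_num)]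
    linarith
  obtain ⟨R, hR0, hR⟩ : ∃ R, 0 < R ∧ ∀ n, ‖z n‖ ≤ R := by
    refine ⟨√(|b| / (1 / 2 - (1 + κ) / p)) + 1, by positivity, fun n => ?_⟩
    have h1 : J (z n) ≤ b := hb ⟨n, rfl⟩
    have h2 := h.mul_sub_le (z n)
    rw [(hzN n).2] at h2
    have h3 : Ψ (z n) ≤ (1 + κ) / p * ‖z n‖ ^ 2 := by
      rw [div_mul_eq_mul_div, le_div_iff₀ (by linarith)]
      linarith
    have h4 : ‖z n‖ ^ 2 ≤ |b| / (1 / 2 - (1 + κ) / p) := by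
      rw [le_div_iff₀ hm]
      rw [hJ] at h1
      nlinarith [le_abs_self b]
    have := Real.le_sqrt_of_sq_le h4
    linarith
  obtain ⟨T, hT0, hT⟩ := h.norm_fderiv_le hJ hφ hκ hp (by linarith) R
  have hJ' : Tendsto (fun n => ‖fderiv ℝ J (z n)‖) atTop (𝓝 0) := by
    refine squeeze_zero (fun n => norm_nonneg _) (fun n => hT (z n) (hz n) (hR n)) ?_
    simpa using hτ.mul_const T
  obtain ⟨k, hk, hcomp⟩ := h.compact z R hR
  have hcauchy : CauchySeq (fun n => z (k n)) := by
    refine Metric.cauchySeq_iff.2 fun e he => ?_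
    have hκ' : 0 < 1 - κ := by linarith
    set e' := (1 - κ) * e ^ 2 / 2 with he'
    have he'0 : 0 < e' := by positivity
    obtain ⟨n₁, hn₁⟩ := hcomp (e' / 2) (by positivity)
    have h1 : ∀ᶠ n in atTop, ‖fderiv ℝ J (z (k n))‖ < e' / (8 * R) :=
      (hJ'.comp hk.tendsto_atTop).eventually (gt_mem_nhds (by positivity))
    obtain ⟨n₂, hn₂⟩ := eventually_atTop.1 h1
    refine ⟨max n₁ n₂, fun m hm' n hn' => ?_⟩
    have a1 := hn₁ m (le_of_max_le_left hm') n (le_of_max_le_left hn')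
    have a2 := hn₂ m (le_of_max_le_right hm')
    have a3 := hn₂ n (le_of_max_le_right hn')
    set x := z (k m)
    set y := z (k n)
    have hxy : ‖x - y‖ ≤ 2 * R := by
      have := norm_sub_le x y
      linarith [hR (k m), hR (k n)]
    -- `J' = ⟨z, ·⟩ - D z`, tested with `x - y`.
    have b1 : ‖x - y‖ ^ 2 = (fderiv ℝ J x - fderiv ℝ J y) (x - y) + (D x - D y) (x - y) := by
      rw [h.fderiv_functional hJ, h.fderiv_functional hJ, ← real_inner_self_eq_norm_sq]
      simp only [sub_apply, innerSL_apply_apply, map_sub, inner_sub_left, inner_sub_right]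
      ring
    have b2 : (fderiv ℝ J x - fderiv ℝ J y) (x - y) ≤ e' / 2 := by
      calc _ ≤ ‖fderiv ℝ J x - fderiv ℝ J y‖ * ‖x - y‖ :=
            (Real.le_norm_self _).trans (ContinuousLinearMap.le_opNorm _ _)
        _ ≤ (e' / (8 * R) + e' / (8 * R)) * (2 * R) := by
            gcongr
            exact (norm_sub_le _ _).trans (by linarith)
        _ = e' / 2 := by field_simp; ring
    -- The two errors `e'/2` add up to `e'`, which is half of `(1 - κ) e²`; this gives the strict
    -- inequality.
    have b3 : (1 - κ) * ‖x - y‖ ^ 2 < (1 - κ) * e ^ 2 := by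
      have : (1 - κ) * e ^ 2 = 2 * e' := by rw [he']; ring
      nlinarith
    rw [dist_eq_norm]
    exact lt_of_pow_lt_pow_left₀ 2 he.le (lt_of_mul_lt_mul_left b3 hκ'.le)
  obtain ⟨w, hw⟩ := cauchySeq_tendsto_of_complete hcauchy
  refine ⟨w, (h.mem_nehari_iff hJ w).2 ?_, k, hk, hw⟩
  -- The bound `‖z‖ ≥ δ` and the identity `D z z = ‖z‖²` both pass to the limit, so `w` lies on the
  -- manifold.
  obtain ⟨δ, hδ, hlow⟩ := h.exists_le_norm hp hκ
  have hwδ : δ ≤ ‖w‖ :=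
    ge_of_tendsto' hw.norm fun n => hlow _ (hzN (k n)).1 (hzN (k n)).2
  have hwR : ‖w‖ ≤ R := le_of_tendsto' hw.norm fun n => hR (k n)
  refine ⟨norm_pos_iff.1 (hδ.trans_le hwδ), ?_⟩
  obtain ⟨K, hK, hlip⟩ := h.lipschitz R
  have h1 : Tendsto (fun n => D (z (k n)) (z (k n))) atTop (𝓝 (D w w)) := by
    rw [tendsto_iff_norm_sub_tendsto_zero]
    have h0 : Tendsto (fun n => K * ‖z (k n) - w‖) atTop (𝓝 0) := by
      simpa using (tendsto_iff_norm_sub_tendsto_zero.1 hw).const_mul K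
    exact squeeze_zero (fun n => norm_nonneg _) (fun n => hlip _ _ (hR _) hwR) h0
  have h2 : Tendsto (fun n => D (z (k n)) (z (k n))) atTop (𝓝 (‖w‖ ^ 2)) := by
    simp only [(hzN _).2]
    exact hw.norm.pow 2
  exact tendsto_nhds_unique h1 h2

end Abstract

/-! ### Elementary inequalities for real powers. -/

section RpowInequalities

/-- Both factors are bounded by powers of `max a c`. This crude form of Young's inequality replaces
Hölder's inequality below. -/
lemma mul_rpow_le_rpow_add_rpow {a c r θ : ℝ} (ha : 0 ≤ a) (hc : 0 ≤ c) (hθ : 0 ≤ θ)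
    (hr : θ ≤ r) : a ^ (r - θ) * c ^ θ ≤ a ^ r + c ^ r := by
  have key : ∀ m : ℝ, 0 ≤ m → a ≤ m → c ≤ m → a ^ (r - θ) * c ^ θ ≤ m ^ r := by
    intro m hm h1 h2
    calc a ^ (r - θ) * c ^ θ ≤ m ^ (r - θ) * m ^ θ := by
          gcongr
      _ = m ^ r := by rw [← Real.rpow_add_of_nonneg hm (by linarith) hθ, sub_add_cancel]
  rcases le_total a c with h | h
  · have := key c hc h le_rfl
    have := Real.rpow_nonneg ha r
    linarith
  · have := key a ha le_rfl h
    have := Real.rpow_nonneg hc r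
    linarith

lemma add_rpow_le_two_rpow_mul {a b r : ℝ} (ha : 0 ≤ a) (hb : 0 ≤ b) (hr : 0 ≤ r) :
    (a + b) ^ r ≤ 2 ^ r * (a ^ r + b ^ r) := by
  have key : ∀ m : ℝ, 0 ≤ m → a ≤ m → b ≤ m → (a + b) ^ r ≤ 2 ^ r * m ^ r := by
    intro m hm h1 h2
    rw [← Real.mul_rpow (by norm_num) hm]
    gcongr
    linarith
  have h2 : (0 : ℝ) ≤ 2 ^ r := by positivity
  rcases le_total a b with h | h
  · have := key b hb h le_rfl
    have := mul_nonneg h2 (Real.rpow_nonneg ha r)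
    linarith
  · have := key a ha le_rfl h
    have := mul_nonneg h2 (Real.rpow_nonneg hb r)
    linarith

/-- Young's inequality with a small parameter, in a crude form. -/
lemma exists_rpow_mul_sq_le {r δ : ℝ} (hr : 2 ≤ r) (hδ : 0 < δ) :
    ∃ C, 0 ≤ C ∧ ∀ a c : ℝ, 0 ≤ a → 0 ≤ c → a ^ (r - 2) * c ^ 2 ≤ δ * a ^ r + C * c ^ r := by
  refine ⟨(√δ)⁻¹ ^ (r - 2), by positivity, fun a c ha hc => ?_⟩
  have hs : 0 < √δ := Real.sqrt_pos.2 hδ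
  have e : ∀ m : ℝ, 0 ≤ m → m ^ (r - 2) * m ^ 2 = m ^ r := fun m hm => by
    rw [← Real.rpow_natCast m 2, ← Real.rpow_add_of_nonneg hm (by linarith) (by norm_num)]
    norm_num
  -- If `c ≤ √δ a`, then `c²` contributes the factor `δ`; otherwise `a` is at most a multiple of
  -- `c`.
  rcases le_total c (√δ * a) with h | h
  · have : a ^ (r - 2) * c ^ 2 ≤ δ * a ^ r := by
      calc a ^ (r - 2) * c ^ 2 ≤ a ^ (r - 2) * (√δ * a) ^ 2 := by gcongr
        _ = δ * a ^ r := by rw [mul_pow, Real.sq_sqrt hδ.le, ← e a ha]; ring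
    have : 0 ≤ (√δ)⁻¹ ^ (r - 2) * c ^ r := by positivity
    linarith
  · have : a ^ (r - 2) * c ^ 2 ≤ (√δ)⁻¹ ^ (r - 2) * c ^ r := by
      have h' : a ≤ (√δ)⁻¹ * c := by
        rw [inv_mul_eq_div, le_div_iff₀ hs]; linarith
      calc a ^ (r - 2) * c ^ 2 ≤ ((√δ)⁻¹ * c) ^ (r - 2) * c ^ 2 := by
            gcongr
        _ = (√δ)⁻¹ ^ (r - 2) * c ^ r := by
            rw [Real.mul_rpow (by positivity) hc, mul_assoc, e c hc]
    have : 0 ≤ δ * a ^ r := by positivity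
    linarith

/-- By convexity `t^p` lies below its chord over `[1, 2]`. -/
lemma rpow_sub_one_le_mul {t p : ℝ} (hp : 1 ≤ p) (ht : t ∈ Icc (1 : ℝ) 2) :
    t ^ p - 1 ≤ 2 ^ p * (t - 1) := by
  have h := (convexOn_rpow hp).2 (mem_Ici.2 zero_le_one) (mem_Ici.2 (zero_le_two (α := ℝ)))
    (sub_nonneg.2 ht.2) (sub_nonneg.2 ht.1) (by ring)
  simp only [smul_eq_mul, Real.one_rpow] at h
  rw [show (2 - t) * 1 + (t - 1) * 2 = t by ring] at h
  linarith [ht.1]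

end RpowInequalities

/-! ### Functions on the plane with a weighted Lipschitz gradient. -/

/-- `F` vanishes at the origin together with its gradient `g`, and `g` is Lipschitz with constant
`M max(|z|, |w|)^(r - 2)`. -/
structure GradLip (r M : ℝ) (F : ℝ × ℝ → ℝ) (g : ℝ × ℝ → ℝ × ℝ →L[ℝ] ℝ) : Prop where
  hasFDerivAt : ∀ z, HasFDerivAt F (g z) z
  map_zero : F 0 = 0
  grad_zero : g 0 = 0
  lip : ∀ z w, ‖g z - g w‖ ≤ M * max ‖z‖ ‖w‖ ^ (r - 2) * ‖z - w‖

namespace GradLip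

variable {r M : ℝ} {F : ℝ × ℝ → ℝ} {g : ℝ × ℝ → ℝ × ℝ →L[ℝ] ℝ}

lemma continuous (h : GradLip r M F g) : Continuous F :=
  continuous_iff_continuousAt.2 fun z => (h.hasFDerivAt z).continuousAt

lemma continuous_grad (h : GradLip r M F g) (hr : 2 ≤ r) : Continuous g := by
  refine continuous_iff_continuousAt.2 fun z => tendsto_iff_norm_sub_tendsto_zero.2 ?_
  have hc : Continuous fun w : ℝ × ℝ => M * max ‖w‖ ‖z‖ ^ (r - 2) * ‖w - z‖ := by
    refine (continuous_const.mul ?_).mul (by fun_prop)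
    exact (continuous_norm.max continuous_const).rpow_const fun _ => Or.inr (by linarith)
  have h0 : Tendsto (fun w : ℝ × ℝ => M * max ‖w‖ ‖z‖ ^ (r - 2) * ‖w - z‖) (𝓝 z) (𝓝 0) := by
    simpa using hc.tendsto z
  exact squeeze_zero (fun w => norm_nonneg _) (fun w => h.lip w z) h0

lemma norm_grad_le (h : GradLip r M F g) (hr : 2 ≤ r) (z : ℝ × ℝ) :
    ‖g z‖ ≤ M * ‖z‖ ^ (r - 1) := by
  have h1 := h.lip z 0
  rw [h.grad_zero, sub_zero, sub_zero, norm_zero, max_eq_left (norm_nonneg z), mul_assoc] at h1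
  refine h1.trans_eq ?_
  congr 1
  rw [show r - 1 = r - 2 + 1 by ring,
    Real.rpow_add_of_nonneg (norm_nonneg z) (by linarith) zero_le_one, Real.rpow_one]

/-- Mean value inequality for `F - g z` on the ball of radius `‖k‖` around `z`, where the norm is at
most `‖z‖ + ‖k‖`. -/
lemma taylor (h : GradLip r M F g) (hr : 2 ≤ r) (hM : 0 ≤ M) (z k : ℝ × ℝ) :
    |F (z + k) - F z - g z k| ≤ M * ((‖z‖ + ‖k‖) ^ (r - 2) * ‖k‖ ^ 2) := by
  have h1 := (convex_closedBall z ‖k‖).norm_image_sub_le_of_norm_hasFDerivWithin_le'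
    (f := F) (f' := g) (φ := g z) (C := M * (‖z‖ + ‖k‖) ^ (r - 2) * ‖k‖) (x := z) (y := z + k)
    (fun x _ => (h.hasFDerivAt x).hasFDerivWithinAt) (fun x hx => ?_)
    (Metric.mem_closedBall_self (norm_nonneg k)) (by simp)
  · simp only [add_sub_cancel_left, Real.norm_eq_abs] at h1
    refine h1.trans_eq (by ring)
  · rw [mem_closedBall_iff_norm] at hx
    refine (h.lip x z).trans ?_
    have hx' : ‖x‖ ≤ ‖z‖ + ‖k‖ := by
      have := norm_le_norm_add_norm_sub' x z
      linarith
    have : max ‖x‖ ‖z‖ ≤ ‖z‖ + ‖k‖ := max_le hx' (by linarith [norm_nonneg k])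
    gcongr

lemma abs_le (h : GradLip r M F g) (hr : 2 ≤ r) (hM : 0 ≤ M) (z : ℝ × ℝ) :
    |F z| ≤ M * ‖z‖ ^ r := by
  have h1 := h.taylor hr hM 0 z
  rw [h.map_zero, h.grad_zero] at h1
  simp only [zero_add, sub_zero, zero_apply, norm_zero] at h1
  refine h1.trans_eq ?_
  rw [← Real.rpow_natCast ‖z‖ 2,
    ← Real.rpow_add_of_nonneg (norm_nonneg z) (by linarith) (by norm_num)]
  norm_num

lemma abs_grad_apply_le (h : GradLip r M F g) (hr : 2 ≤ r) (z k : ℝ × ℝ) :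
    |g z k| ≤ M * (‖z‖ ^ (r - 1) * ‖k‖) := by
  calc |g z k| ≤ ‖g z‖ * ‖k‖ := (g z).le_opNorm k
    _ ≤ M * ‖z‖ ^ (r - 1) * ‖k‖ := by
        gcongr
        exact h.norm_grad_le hr z
    _ = _ := by ring

lemma abs_grad_self_le (h : GradLip r M F g) (hr : 2 ≤ r) (z : ℝ × ℝ) :
    |g z z| ≤ M * ‖z‖ ^ r := by
  refine (h.abs_grad_apply_le hr z z).trans_eq ?_
  congr 1
  rw [← Real.rpow_add_one' (norm_nonneg z) (by linarith), sub_add_cancel]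

/-- Split `g z z - g w w = (g z - g w) z + g w (z - w)`. This is the pointwise source of the
Lipschitz bound for the constraint. -/
lemma abs_grad_self_sub_le (h : GradLip r M F g) (hr : 2 ≤ r) (hM : 0 ≤ M) (z w : ℝ × ℝ) :
    |g z z - g w w| ≤ 2 * M * (max ‖z‖ ‖w‖ ^ (r - 1) * ‖z - w‖) := by
  set m := max ‖z‖ ‖w‖
  have hm : 0 ≤ m := le_max_of_le_left (norm_nonneg z)
  have e : m ^ (r - 1) = m ^ (r - 2) * m := by
    rw [show r - 1 = r - 2 + 1 by ring,
      Real.rpow_add_of_nonneg hm (by linarith) zero_le_one, Real.rpow_one]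
  have h1 : |(g z - g w) z| ≤ M * m ^ (r - 2) * ‖z - w‖ * m := by
    refine ((g z - g w).le_opNorm z).trans ?_
    gcongr
    · exact h.lip z w
    · exact le_max_left _ _
  have h2 : |g w (z - w)| ≤ M * (m ^ (r - 1) * ‖z - w‖) := by
    refine (h.abs_grad_apply_le hr w (z - w)).trans ?_
    gcongr
    · linarith
    · exact le_max_right _ _
  have h3 : g z z - g w w = (g z - g w) z + g w (z - w) := by
    simp only [sub_apply, map_sub]; ring
  rw [h3]
  refine (abs_add_le _ _).trans ((add_le_add h1 h2).trans_eq ?_)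
  rw [e]; ring

end GradLip

/-! ### Integral functionals on a space embedded in `L^r`. -/

/-- `ev` is linear up to null sets and bounded from `X` to `L^r(μ; ℝ²)`, with constant `S` for the
`r`-th powers of the norms. -/
structure EvalBound {X α : Type*} [NormedAddCommGroup X] [NormedSpace ℝ X] [MeasurableSpace α]
    (μ : Measure α) (r S : ℝ) (ev : X → α → ℝ × ℝ) : Prop where
  aestronglyMeasurable : ∀ z, AEStronglyMeasurable (ev z) μ
  add : ∀ z w, ev (z + w) =ᵐ[μ] ev z + ev w
  smul : ∀ (c : ℝ) z, ev (c • z) =ᵐ[μ] c • ev z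
  integrable : ∀ z, Integrable (fun x => ‖ev z x‖ ^ r) μ
  le : ∀ z, ∫ x, ‖ev z x‖ ^ r ∂μ ≤ S * ‖z‖ ^ r

namespace EvalBound

variable {X α : Type*} [NormedAddCommGroup X] [NormedSpace ℝ X] [MeasurableSpace α]
  {μ : Measure α} {r S M : ℝ} {ev : X → α → ℝ × ℝ} {F : ℝ × ℝ → ℝ}
  {g : ℝ × ℝ → ℝ × ℝ →L[ℝ] ℝ}

lemma sub (he : EvalBound μ r S ev) (z w : X) : ev (z - w) =ᵐ[μ] ev z - ev w := by
  have h1 := he.add z ((-1 : ℝ) • w)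
  have h2 := he.smul (-1) w
  filter_upwards [h1, h2] with x h1 h2
  rw [sub_eq_add_neg, ← neg_one_smul ℝ w, h1, Pi.add_apply, h2]
  simp [sub_eq_add_neg]

lemma zero (he : EvalBound μ r S ev) : ev 0 =ᵐ[μ] 0 := by
  have := he.smul 0 0
  rwa [zero_smul, zero_smul] at this

lemma integrable_add_rpow (he : EvalBound μ r S ev) (z w : X) :
    Integrable (fun x => 2 ^ r * (‖ev z x‖ ^ r + ‖ev w x‖ ^ r)) μ :=
  ((he.integrable z).add (he.integrable w)).const_mul (2 ^ r)

lemma integrable_mixed (he : EvalBound μ r S ev) {θ : ℝ} (hθ : 0 ≤ θ) (hr : θ ≤ r) (z w k : X) :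
    Integrable (fun x => (‖ev z x‖ + ‖ev w x‖) ^ (r - θ) * ‖ev k x‖ ^ θ) μ := by
  refine ((he.integrable_add_rpow z w).add (he.integrable k)).mono' ?_ (Eventually.of_forall fun x => ?_)
  · refine AEStronglyMeasurable.mul ?_ ?_
    · exact ((he.aestronglyMeasurable z).norm.add
        (he.aestronglyMeasurable w).norm).aemeasurable.pow_const _ |>.aestronglyMeasurable
    · exact (he.aestronglyMeasurable k).norm.aemeasurable.pow_const _ |>.aestronglyMeasurable
  · rw [Real.norm_of_nonneg (by positivity)]
    refine (mul_rpow_le_rpow_add_rpow (by positivity) (norm_nonneg _) hθ hr).trans ?_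
    exact add_le_add_left (add_rpow_le_two_rpow_mul (norm_nonneg _) (norm_nonneg _)
      (hθ.trans hr)) _

/-- A form of Hölder's inequality on bounded sets. -/
lemma exists_integral_mixed_le (he : EvalBound μ r S ev) (hS : 0 ≤ S) {θ : ℝ} (hθ : 0 < θ)
    (hr : θ ≤ r) (R : ℝ) :
    ∃ K, 0 ≤ K ∧ ∀ z w k : X, ‖z‖ ≤ R → ‖w‖ ≤ R →
      ∫ x, (‖ev z x‖ + ‖ev w x‖) ^ (r - θ) * ‖ev k x‖ ^ θ ∂μ ≤ K * ‖k‖ ^ θ := by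
  have hr0 : 0 ≤ r := hθ.le.trans hr
  by_cases hR : 0 ≤ R
  swap
  · exact ⟨0, le_rfl, fun z w k hz => absurd ((norm_nonneg z).trans hz) hR⟩
  refine ⟨2 ^ r * (S * R ^ r + S * R ^ r) + S, by positivity, fun z w k hz hw => ?_⟩
  -- Both sides are homogeneous of degree `θ` in `k`, so unit vectors suffice; for them the additive
  -- bound by `r`-th powers is enough.
  have key : ∀ e : X, ‖e‖ = 1 → ∫ x, (‖ev z x‖ + ‖ev w x‖) ^ (r - θ) * ‖ev e x‖ ^ θ ∂μ
      ≤ 2 ^ r * (S * R ^ r + S * R ^ r) + S := by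
    intro e hee
    have hb : ∀ y : X, ‖y‖ ≤ R → ∫ x, ‖ev y x‖ ^ r ∂μ ≤ S * R ^ r := fun y hy =>
      (he.le y).trans (by gcongr)
    have h1 : ∫ x, (‖ev z x‖ + ‖ev w x‖) ^ (r - θ) * ‖ev e x‖ ^ θ ∂μ
        ≤ ∫ x, (2 ^ r * (‖ev z x‖ ^ r + ‖ev w x‖ ^ r) + ‖ev e x‖ ^ r) ∂μ := by
      refine integral_mono (he.integrable_mixed hθ.le hr z w e)
        ((he.integrable_add_rpow z w).add (he.integrable e)) fun x => ?_
      refine (mul_rpow_le_rpow_add_rpow (by positivity) (norm_nonneg _) hθ.le hr).trans ?_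
      exact add_le_add_left (add_rpow_le_two_rpow_mul (norm_nonneg _) (norm_nonneg _) hr0) _
    refine h1.trans ?_
    rw [integral_add (he.integrable_add_rpow z w) (he.integrable e), integral_const_mul, integral_add (he.integrable z) (he.integrable w)]
    have h2 := he.le e
    rw [hee, Real.one_rpow, mul_one] at h2
    have := hb z hz
    have := hb w hw
    gcongr
  rcases eq_or_ne k 0 with rfl | hk
  · have : (fun x => (‖ev z x‖ + ‖ev w x‖) ^ (r - θ) * ‖ev 0 x‖ ^ θ) =ᵐ[μ] 0 := by
      filter_upwards [he.zero] with x hx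
      simp [hx, Real.zero_rpow hθ.ne']
    rw [integral_congr_ae this]
    simp [Real.zero_rpow hθ.ne']
  · have hk' : 0 < ‖k‖ := norm_pos_iff.2 hk
    have h1 := key (‖k‖⁻¹ • k) (by rw [norm_smul, norm_inv, norm_norm, inv_mul_cancel₀ hk'.ne'])
    have h2 : ∫ x, (‖ev z x‖ + ‖ev w x‖) ^ (r - θ) * ‖ev k x‖ ^ θ ∂μ
        = ‖k‖ ^ θ * ∫ x, (‖ev z x‖ + ‖ev w x‖) ^ (r - θ) * ‖ev (‖k‖⁻¹ • k) x‖ ^ θ ∂μ := by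
      rw [← integral_const_mul]
      refine integral_congr_ae ?_
      filter_upwards [he.smul ‖k‖⁻¹ k] with x hx
      rw [hx, Pi.smul_apply, norm_smul, Real.mul_rpow (norm_nonneg _) (norm_nonneg _),
        norm_inv, norm_norm, Real.inv_rpow hk'.le]
      have : ‖k‖ ^ θ ≠ 0 := (Real.rpow_pos_of_pos hk' θ).ne'
      field_simp
    rw [h2, mul_comm]
    gcongr

lemma integrable_comp (he : EvalBound μ r S ev) (hg : GradLip r M F g) (hr : 2 ≤ r) (hM : 0 ≤ M)
    (z : X) : Integrable (fun x => F (ev z x)) μ :=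
  ((he.integrable z).const_mul M).mono'
    (hg.continuous.comp_aestronglyMeasurable (he.aestronglyMeasurable z))
    (Eventually.of_forall fun _ => hg.abs_le hr hM _)

lemma integrable_grad (he : EvalBound μ r S ev) (hg : GradLip r M F g) (hr : 2 ≤ r) (z w : X) :
    Integrable (fun x => g (ev z x) (ev w x)) μ := by
  -- The second slot is filled with `0`, whose evaluation vanishes almost everywhere.
  have h1 := (he.integrable_mixed zero_le_one (by linarith) z 0 w).const_mul M
  refine (h1.congr (g := fun x => M * (‖ev z x‖ ^ (r - 1) * ‖ev w x‖)) ?_).mono' ?_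
    (Eventually.of_forall fun x => hg.abs_grad_apply_le hr _ _)
  · filter_upwards [he.zero] with x hx
    simp [hx]
  · have hc : Continuous fun y : (ℝ × ℝ) × (ℝ × ℝ) => g y.1 y.2 :=
      ((hg.continuous_grad hr).comp continuous_fst).clm_apply continuous_snd
    exact hc.comp_aestronglyMeasurable
      ((he.aestronglyMeasurable z).prodMk (he.aestronglyMeasurable w))

lemma exists_integral_grad_le (he : EvalBound μ r S ev) (hg : GradLip r M F g) (hr : 2 ≤ r)
    (hM : 0 ≤ M) (hS : 0 ≤ S) (z : X) :
    ∃ K, ∀ w, ‖∫ x, g (ev z x) (ev w x) ∂μ‖ ≤ K * ‖w‖ := by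
  obtain ⟨K, hK, h⟩ := he.exists_integral_mixed_le hS one_pos (by linarith : 1 ≤ r) ‖z‖
  refine ⟨M * K, fun w => ?_⟩
  have h1 := h z 0 w le_rfl (by simp)
  rw [Real.rpow_one] at h1
  calc ‖∫ x, g (ev z x) (ev w x) ∂μ‖
      ≤ ∫ x, M * ((‖ev z x‖ + ‖ev 0 x‖) ^ (r - 1) * ‖ev w x‖ ^ (1 : ℝ)) ∂μ := by
        refine norm_integral_le_of_norm_le
          ((he.integrable_mixed zero_le_one (by linarith) z 0 w).const_mul M) ?_
        filter_upwards [he.zero] with x hx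
        simpa [hx] using hg.abs_grad_apply_le hr (ev z x) (ev w x)
    _ ≤ M * K * ‖w‖ := by
        rw [integral_const_mul, mul_assoc]
        gcongr

/-- The derivative `w ↦ ∫ g(z)·w` of the functional `z ↦ ∫ F(z)`. -/
def gradFunctional (he : EvalBound μ r S ev) (hg : GradLip r M F g) (hr : 2 ≤ r)
    (hM : 0 ≤ M) (hS : 0 ≤ S) (z : X) : X →L[ℝ] ℝ :=
  LinearMap.mkContinuousOfExistsBound
    { toFun := fun w => ∫ x, g (ev z x) (ev w x) ∂μ
      map_add' := fun w k => by
        rw [← integral_add (he.integrable_grad hg hr z w) (he.integrable_grad hg hr z k)]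
        refine integral_congr_ae ?_
        filter_upwards [he.add w k] with x hx
        rw [hx, Pi.add_apply, map_add]
      map_smul' := fun c w => by
        rw [RingHom.id_apply, smul_eq_mul, ← integral_const_mul]
        refine integral_congr_ae ?_
        filter_upwards [he.smul c w] with x hx
        rw [hx, Pi.smul_apply, map_smul, smul_eq_mul] }
    (he.exists_integral_grad_le hg hr hM hS z)

variable (he : EvalBound μ r S ev) (hg : GradLip r M F g) (hr : 2 ≤ r) (hM : 0 ≤ M) (hS : 0 ≤ S)

lemma gradFunctional_apply (z w : X) :
    he.gradFunctional hg hr hM hS z w = ∫ x, g (ev z x) (ev w x) ∂μ := rfl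

/-- The integrated Taylor remainder is `O(‖k‖²)`, by the mixed estimate with `θ = 2`. -/
lemma hasFDerivAt_integral (z : X) :
    HasFDerivAt (fun z => ∫ x, F (ev z x) ∂μ) (he.gradFunctional hg hr hM hS z) z := by
  obtain ⟨K, hK, h⟩ := he.exists_integral_mixed_le hS two_pos hr (‖z‖ + 1)
  have hbound : ∀ᶠ k in 𝓝 (0 : X), ‖(∫ x, F (ev (z + k) x) ∂μ) - (∫ x, F (ev z x) ∂μ)
      - he.gradFunctional hg hr hM hS z k‖ ≤ M * K * ‖‖k‖ ^ 2‖ := by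
    filter_upwards [Metric.ball_mem_nhds (0 : X) one_pos] with k hk
    rw [mem_ball_zero_iff] at hk
    have h1 := h z k k (by linarith) (by linarith [norm_nonneg z])
    have i1 : Integrable (fun x => F (ev (z + k) x) - F (ev z x)) μ :=
      (he.integrable_comp hg hr hM _).sub (he.integrable_comp hg hr hM _)
    rw [gradFunctional_apply, ← integral_sub (he.integrable_comp hg hr hM _)
      (he.integrable_comp hg hr hM _), ← integral_sub i1 (he.integrable_grad hg hr z k)]
    calc _ ≤ ∫ x, M * ((‖ev z x‖ + ‖ev k x‖) ^ (r - 2) * ‖ev k x‖ ^ (2 : ℝ)) ∂μ := by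
          refine norm_integral_le_of_norm_le
            ((he.integrable_mixed zero_le_two hr z k k).const_mul M) ?_
          filter_upwards [he.add z k] with x hx
          rw [hx]
          simpa using hg.taylor hr hM (ev z x) (ev k x)
      _ ≤ M * K * ‖‖k‖ ^ 2‖ := by
          rw [integral_const_mul, mul_assoc, norm_pow, norm_norm]
          gcongr
          simpa using h1
  rw [hasFDerivAt_iff_isLittleO_nhds_zero]
  refine (Asymptotics.IsBigO.of_bound _ hbound).trans_isLittleO ?_
  exact Asymptotics.isLittleO_norm_pow_id one_lt_two

lemma abs_gradFunctional_self_le (z : X) :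
    |he.gradFunctional hg hr hM hS z z| ≤ M * (S * ‖z‖ ^ r) := by
  rw [gradFunctional_apply, ← Real.norm_eq_abs]
  calc _ ≤ ∫ x, M * ‖ev z x‖ ^ r ∂μ :=
        norm_integral_le_of_norm_le ((he.integrable z).const_mul M)
          (Eventually.of_forall fun x => hg.abs_grad_self_le hr _)
    _ ≤ _ := by
        rw [integral_const_mul]
        exact mul_le_mul_of_nonneg_left (he.le z) hM

lemma abs_integral_le (he : EvalBound μ r S ev) (hg : GradLip r M F g) (hr : 2 ≤ r) (hM : 0 ≤ M)
    (z : X) : |∫ x, F (ev z x) ∂μ| ≤ M * (S * ‖z‖ ^ r) := by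
  rw [← Real.norm_eq_abs]
  calc _ ≤ ∫ x, M * ‖ev z x‖ ^ r ∂μ :=
        norm_integral_le_of_norm_le ((he.integrable z).const_mul M)
          (Eventually.of_forall fun _ => hg.abs_le hr hM _)
    _ ≤ _ := by
        rw [integral_const_mul]
        exact mul_le_mul_of_nonneg_left (he.le z) hM

lemma exists_lipschitz_gradFunctional_self (R : ℝ) :
    ∃ K, 0 ≤ K ∧ ∀ z w, ‖z‖ ≤ R → ‖w‖ ≤ R →
      |he.gradFunctional hg hr hM hS z z - he.gradFunctional hg hr hM hS w w|
        ≤ K * ‖z - w‖ := by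
  obtain ⟨K, hK, h⟩ := he.exists_integral_mixed_le hS one_pos (by linarith : 1 ≤ r) R
  refine ⟨2 * M * K, by positivity, fun z w hz hw => ?_⟩
  have h1 := h z w (z - w) hz hw
  rw [Real.rpow_one] at h1
  rw [gradFunctional_apply, gradFunctional_apply, ← integral_sub (he.integrable_grad hg hr z z)
    (he.integrable_grad hg hr w w), ← Real.norm_eq_abs]
  calc _ ≤ ∫ x, 2 * M * ((‖ev z x‖ + ‖ev w x‖) ^ (r - 1) * ‖ev (z - w) x‖ ^ (1 : ℝ)) ∂μ := by
        refine norm_integral_le_of_norm_le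
          ((he.integrable_mixed zero_le_one (by linarith) z w (z - w)).const_mul (2 * M)) ?_
        filter_upwards [he.sub z w] with x hx
        rw [hx, Real.rpow_one]
        refine (hg.abs_grad_self_sub_le hr hM _ _).trans ?_
        have : max ‖ev z x‖ ‖ev w x‖ ≤ ‖ev z x‖ + ‖ev w x‖ :=
          max_le_add_of_nonneg (norm_nonneg _) (norm_nonneg _)
        simp only [Pi.sub_apply]
        gcongr
        linarith
    _ ≤ 2 * M * K * ‖z - w‖ := by
        rw [integral_const_mul, mul_assoc _ K]
        gcongr

/-- For `r = 2` the weight is `1` and this is the error absorbed by `κ`. For `r = p`, Young's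
inequality reduces it to convergence in `L^p`. -/
lemma gradFunctional_sub_apply_le (z w : X) :
    (he.gradFunctional hg hr hM hS z - he.gradFunctional hg hr hM hS w) (z - w)
      ≤ M * ∫ x, (‖ev z x‖ + ‖ev w x‖) ^ (r - 2) * ‖ev (z - w) x‖ ^ (2 : ℝ) ∂μ := by
  rw [sub_apply, gradFunctional_apply, gradFunctional_apply, ← integral_sub
    (he.integrable_grad hg hr z _) (he.integrable_grad hg hr w _), ← integral_const_mul]
  refine integral_mono_ae ((he.integrable_grad hg hr z _).sub (he.integrable_grad hg hr w _))
    ((he.integrable_mixed zero_le_two hr z w (z - w)).const_mul M) ?_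
  filter_upwards [he.sub z w] with x hx
  rw [hx, ← sub_apply]
  calc (g (ev z x) - g (ev w x)) ((ev z - ev w) x)
      ≤ ‖g (ev z x) - g (ev w x)‖ * ‖(ev z - ev w) x‖ :=
        (Real.le_norm_self _).trans (ContinuousLinearMap.le_opNorm _ _)
    _ ≤ M * max ‖ev z x‖ ‖ev w x‖ ^ (r - 2) * ‖(ev z - ev w) x‖ * ‖(ev z - ev w) x‖ := by
        gcongr
        exact hg.lip _ _
    _ ≤ M * (‖ev z x‖ + ‖ev w x‖) ^ (r - 2) * ‖(ev z - ev w) x‖ * ‖(ev z - ev w) x‖ := by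
        have : max ‖ev z x‖ ‖ev w x‖ ≤ ‖ev z x‖ + ‖ev w x‖ :=
          max_le_add_of_nonneg (norm_nonneg _) (norm_nonneg _)
        gcongr
    _ = _ := by
        rw [Real.rpow_two]; ring

end EvalBound

/-! ### Combining the homogeneous part and the small part. -/

section Assembly

variable {X α : Type*} [NormedAddCommGroup X] [InnerProductSpace ℝ X] [MeasurableSpace α]
  {μ ν : Measure α} {p S S' M M' : ℝ} {ev : X → α → ℝ × ℝ} {F F' : ℝ × ℝ → ℝ}
  {g g' : ℝ × ℝ → ℝ × ℝ →L[ℝ] ℝ}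

/-- The sum of a homogeneous functional with compactness and a quadratic-type functional is a
`PerturbedHomogeneous` functional. -/
theorem perturbedHomogeneous_add
    (he : EvalBound μ p S ev) (hg : GradLip p M F g) (hp : 2 < p) (hM : 0 ≤ M) (hS : 0 < S)
    (he' : EvalBound ν 2 S' ev) (hg' : GradLip 2 M' F' g') (hM' : 0 ≤ M') (hS' : 0 ≤ S')
    (euler : ∀ z, g z z = p * F z)
    (homog : ∀ t : ℝ, 0 < t → ∀ z, F (t • z) = t ^ p * F z)
    (compact : ∀ z : ℕ → X, ∀ R, (∀ n, ‖z n‖ ≤ R) → ∃ k : ℕ → ℕ, StrictMono k ∧ ∀ e > 0, ∃ n₀,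
      ∀ n ≥ n₀, ∀ m ≥ n₀, ∫ x, ‖ev (z (k n) - z (k m)) x‖ ^ p ∂μ ≤ e) :
    PerturbedHomogeneous p ((2 ^ p + p + 5) * (M' * S'))
      (fun z => (∫ x, F (ev z x) ∂μ) + ∫ x, F' (ev z x) ∂ν)
      (fun z => he.gradFunctional hg hp.le hM hS.le z
        + he'.gradFunctional hg' le_rfl hM' hS' z) := by
  -- The constant `2^p + p + 5` collects `p + 1` from `p Ψ - D` and `2^p + 4` from the radial
  -- comparison. Growth and compactness only need `1`.
  have hMS : 0 ≤ M' * S' := mul_nonneg hM' hS'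
  have h2p : (0 : ℝ) ≤ 2 ^ p := by positivity
  have hE : ∀ z, he.gradFunctional hg hp.le hM hS.le z z = p * ∫ x, F (ev z x) ∂μ := fun z => by
    rw [EvalBound.gradFunctional_apply, ← integral_const_mul]
    simp only [euler]
  have hb : ∀ z, |he'.gradFunctional hg' le_rfl hM' hS' z z| ≤ M' * S' * ‖z‖ ^ 2 := fun z => by
    simpa [mul_assoc] using he'.abs_gradFunctional_self_le hg' le_rfl hM' hS' z
  refine ⟨fun z => ?_, fun z => ?_, fun z t ht => ?_, ?_, fun R => ?_, fun z R hR => ?_⟩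
  · exact (he.hasFDerivAt_integral hg hp.le hM hS.le z).add
      (he'.hasFDerivAt_integral hg' le_rfl hM' hS' z)
  -- Euler's identity cancels the homogeneous part; only the quadratic-type part remains.
  · rw [add_apply, hE]
    have h1 := abs_le.1 (hb z)
    have h2 := (abs_le.1 (he'.abs_integral_le hg' le_rfl hM' z)).2
    simp only [Real.rpow_two] at h2
    have h3 : 0 ≤ M' * S' * ‖z‖ ^ 2 := by positivity
    have h4 := mul_le_mul_of_nonneg_left h2 (by linarith : (0 : ℝ) ≤ p)
    nlinarith [mul_nonneg h2p h3]
  · have ht0 : 0 < t := by linarith [ht.1]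
    rw [add_apply, add_apply, hE, hE]
    have e1 : ∫ x, F (ev (t • z) x) ∂μ = t ^ p * ∫ x, F (ev z x) ∂μ := by
      rw [← integral_const_mul]
      refine integral_congr_ae ?_
      filter_upwards [he.smul t z] with x hx
      rw [hx, Pi.smul_apply, homog t ht0]
    -- The Lipschitz bound for `z ↦ g' z z` along the ray: `2 M'` times the larger norm `2|z|` times
    -- the increment `(t - 1)|z|`.
    have e2 : |he'.gradFunctional hg' le_rfl hM' hS' z z
        - he'.gradFunctional hg' le_rfl hM' hS' (t • z) (t • z)|
          ≤ 4 * (t - 1) * (M' * S' * ‖z‖ ^ 2) := by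
      rw [EvalBound.gradFunctional_apply, EvalBound.gradFunctional_apply,
        ← integral_sub (he'.integrable_grad hg' le_rfl z z)
        (he'.integrable_grad hg' le_rfl _ _), ← Real.norm_eq_abs]
      calc _ ≤ ∫ x, 4 * (t - 1) * M' * ‖ev z x‖ ^ (2 : ℝ) ∂ν := by
            refine norm_integral_le_of_norm_le ((he'.integrable z).const_mul _) ?_
            filter_upwards [he'.smul t z] with x hx
            rw [hx, Pi.smul_apply]
            refine (hg'.abs_grad_self_sub_le le_rfl hM' _ _).trans ?_
            have f1 : max ‖ev z x‖ ‖t • ev z x‖ ≤ 2 * ‖ev z x‖ := by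
              refine max_le (by linarith [norm_nonneg (ev z x)]) ?_
              rw [norm_smul, Real.norm_of_nonneg ht0.le]
              gcongr
              exact ht.2
            have f2 : ‖ev z x - t • ev z x‖ = (t - 1) * ‖ev z x‖ := by
              rw [show ev z x - t • ev z x = (1 - t) • ev z x by rw [sub_smul, one_smul],
                norm_smul, Real.norm_eq_abs, abs_sub_comm, abs_of_nonneg (by linarith [ht.1])]
            rw [f2, show (2 : ℝ) - 1 = 1 by norm_num, Real.rpow_one, Real.rpow_two]
            have f3 : 0 ≤ t - 1 := by linarith [ht.1]
            calc 2 * M' * (max ‖ev z x‖ ‖t • ev z x‖ * ((t - 1) * ‖ev z x‖))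
                ≤ 2 * M' * (2 * ‖ev z x‖ * ((t - 1) * ‖ev z x‖)) := by gcongr
              _ = _ := by ring
        _ ≤ _ := by
            rw [integral_const_mul]
            have f3 : 0 ≤ t - 1 := by linarith [ht.1]
            have := he'.le z
            rw [Real.rpow_two] at this
            calc _ ≤ 4 * (t - 1) * M' * (S' * ‖z‖ ^ 2) := by gcongr
              _ = _ := by ring
    have e3 := rpow_sub_one_le_mul (by linarith : 1 ≤ p) ht
    have e4 : 0 ≤ t ^ p - 1 := by
      linarith [Real.one_le_rpow ht.1 (by linarith : (0 : ℝ) ≤ p)]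
    have e5 := mul_le_mul e3 (hb z) (abs_nonneg _) (e4.trans e3)
    have e6 := mul_le_mul_of_nonneg_left (le_abs_self
      (he'.gradFunctional hg' le_rfl hM' hS' z z)) e4
    have e7 := (abs_le.1 e2).2
    have e8 : 0 ≤ (p + 1) * ((t - 1) * (M' * S' * ‖z‖ ^ 2)) := by
      have : 0 ≤ t - 1 := by linarith [ht.1]
      positivity
    rw [e1]
    nlinarith
  · refine ⟨M * S + 1, by positivity, fun z => ?_⟩
    rw [add_apply]
    have h1 := (abs_le.1 (he.abs_gradFunctional_self_le hg hp.le hM hS.le z)).2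
    have h2 := (abs_le.1 (hb z)).2
    have h3 : 0 ≤ (2 ^ p + p + 4) * (M' * S' * ‖z‖ ^ 2) := by positivity
    have h4 : 0 ≤ ‖z‖ ^ p := by positivity
    nlinarith
  · obtain ⟨K, hK, h⟩ := he.exists_lipschitz_gradFunctional_self hg hp.le hM hS.le R
    obtain ⟨K', hK', h'⟩ := he'.exists_lipschitz_gradFunctional_self hg' le_rfl hM' hS' R
    refine ⟨K + K', by positivity, fun z w hz hw => ?_⟩
    rw [add_apply, add_apply, add_sub_add_comm, add_mul]
    exact (abs_add_le _ _).trans (add_le_add (h z w hz hw) (h' z w hz hw))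
  · obtain ⟨k, hk, hkc⟩ := compact z R hR
    refine ⟨k, hk, fun e hepos => ?_⟩
    have hR0 : 0 ≤ R := (norm_nonneg _).trans (hR 0)
    set B := 2 ^ p * (S * R ^ p + S * R ^ p) with hB
    have hB0 : 0 ≤ B := by positivity
    -- The parameter makes the bounded term at most `e/2` after multiplication by `M`. The summand
    -- `1` in the denominator covers `M B = 0`.
    obtain ⟨C, hC, hyoung⟩ := exists_rpow_mul_sq_le (r := p) (δ := e / (2 * (M * B + 1))) hp.le
      (by positivity)
    obtain ⟨n₀, hn₀⟩ := hkc (e / (2 * (M * C + 1))) (by positivity)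
    refine ⟨n₀, fun n hn m hm => ?_⟩
    have a1 := hn₀ n hn m hm
    set x := z (k n)
    set y := z (k m)
    have b1 := he.gradFunctional_sub_apply_le hg hp.le hM hS.le x y
    have b2 := he'.gradFunctional_sub_apply_le hg' le_rfl hM' hS' x y
    have b3 : ∫ q, (‖ev x q‖ + ‖ev y q‖) ^ ((2 : ℝ) - 2) * ‖ev (x - y) q‖ ^ (2 : ℝ) ∂ν
        ≤ S' * ‖x - y‖ ^ 2 := by
      simpa using he'.le (x - y)
    have b4 : ∫ q, (‖ev x q‖ + ‖ev y q‖) ^ (p - 2) * ‖ev (x - y) q‖ ^ (2 : ℝ) ∂μ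
        ≤ e / (2 * (M * B + 1)) * B + C * (e / (2 * (M * C + 1))) := by
      have i1 := he.integrable_add_rpow x y
      have i2 := he.integrable (x - y)
      calc _ ≤ ∫ q, (e / (2 * (M * B + 1)) * (2 ^ p * (‖ev x q‖ ^ p + ‖ev y q‖ ^ p))
            + C * ‖ev (x - y) q‖ ^ p) ∂μ := by
            refine integral_mono (he.integrable_mixed zero_le_two hp.le x y (x - y))
              ((i1.const_mul _).add (i2.const_mul C)) fun q => ?_
            simp only [Real.rpow_two]
            refine (hyoung _ _ (by positivity) (norm_nonneg _)).trans ?_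
            gcongr
            exact add_rpow_le_two_rpow_mul (norm_nonneg _) (norm_nonneg _) (by linarith)
        _ ≤ _ := by
            rw [integral_add (i1.const_mul _) (i2.const_mul C), integral_const_mul,
              integral_const_mul, integral_const_mul,
              integral_add (he.integrable x) (he.integrable y), hB]
            have hb : ∀ y : X, ‖y‖ ≤ R → ∫ q, ‖ev y q‖ ^ p ∂μ ≤ S * R ^ p := fun y hy =>
              (he.le y).trans (by gcongr)
            have := hb x (hR _)
            have := hb y (hR _)
            gcongr
    have b5 : M * (e / (2 * (M * B + 1)) * B + C * (e / (2 * (M * C + 1)))) ≤ e := by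
      have hMB : 0 ≤ M * B := by positivity
      have hMC : 0 ≤ M * C := by positivity
      have c1 : e / (2 * (M * B + 1)) * (M * B) ≤ e / 2 := by
        rw [div_mul_eq_mul_div, div_le_div_iff₀ (by positivity) two_pos]
        nlinarith
      have c2 : e / (2 * (M * C + 1)) * (M * C) ≤ e / 2 := by
        rw [div_mul_eq_mul_div, div_le_div_iff₀ (by positivity) two_pos]
        nlinarith
      nlinarith
    have b6 := mul_le_mul_of_nonneg_left b3 hM'
    have b7 := mul_le_mul_of_nonneg_left b4 hM
    have b8 : 0 ≤ (2 ^ p + p + 4) * (M' * S' * ‖x - y‖ ^ 2) := by positivity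
    rw [add_sub_add_comm, add_apply]
    nlinarith

end Assembly

/-! ### The homogeneous nonlinearity on the quadrant and its extension by zero. -/

section Quadrant

lemma mem_quadrant {z : ℝ × ℝ} : z ∈ quadrant ↔ 0 ≤ z.1 ∧ 0 ≤ z.2 := by
  rw [quadrant, mem_prod, mem_Ici, mem_Ici]

lemma uniqueDiffOn_quadrant : UniqueDiffOn ℝ quadrant :=
  (uniqueDiffOn_Ici 0).prod (uniqueDiffOn_Ici 0)

lemma convex_quadrant : Convex ℝ quadrant := (convex_Ici 0).prod (convex_Ici 0)

lemma smul_mem_quadrant {t : ℝ} (ht : 0 ≤ t) {z : ℝ × ℝ} (hz : z ∈ quadrant) :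
    t • z ∈ quadrant :=
  mem_quadrant.2 ⟨mul_nonneg ht (mem_quadrant.1 hz).1, mul_nonneg ht (mem_quadrant.1 hz).2⟩

lemma clm_prod_eq_zero {L : ℝ × ℝ →L[ℝ] ℝ} (h1 : L (1, 0) = 0) (h2 : L (0, 1) = 0) : L = 0 := by
  ext <;> simpa

/-- The gradient of a function on the closed quadrant. -/
def quadGrad (Q : ℝ × ℝ → ℝ) : ℝ × ℝ → ℝ × ℝ →L[ℝ] ℝ := fderivWithin ℝ Q quadrant

variable {N : ℕ} {s p : ℝ} {Q : ℝ × ℝ → ℝ}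

lemma NonlinearityHyp.hasFDerivWithinAt (hQ : NonlinearityHyp N s p Q) {z : ℝ × ℝ}
    (hz : z ∈ quadrant) : HasFDerivWithinAt Q (quadGrad Q z) quadrant z :=
  (hQ.contDiffOn.differentiableOn (by norm_num) z hz).hasFDerivWithinAt

lemma NonlinearityHyp.quadDerivU_eq (hQ : NonlinearityHyp N s p Q) {u v : ℝ} (hu : 0 ≤ u)
    (hv : 0 ≤ v) : quadDerivU Q u v = quadGrad Q (u, v) (1, 0) := by
  have h1 : HasDerivWithinAt (fun t : ℝ => (t, v)) ((1 : ℝ), (0 : ℝ)) (Ici 0) u :=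
    ((hasDerivAt_id u).prodMk (hasDerivAt_const u v)).hasDerivWithinAt
  have h2 : HasDerivWithinAt (Q ∘ fun t : ℝ => (t, v)) (quadGrad Q (u, v) (1, 0)) (Ici 0) u :=
    (hQ.hasFDerivWithinAt (z := (u, v)) (mem_quadrant.2 ⟨hu, hv⟩)).comp_hasDerivWithinAt u h1
      fun t ht => mem_quadrant.2 ⟨ht, hv⟩
  exact h2.derivWithin (uniqueDiffOn_Ici 0 u hu)

lemma NonlinearityHyp.quadDerivV_eq (hQ : NonlinearityHyp N s p Q) {u v : ℝ} (hu : 0 ≤ u)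
    (hv : 0 ≤ v) : quadDerivV Q u v = quadGrad Q (u, v) (0, 1) := by
  have h1 : HasDerivWithinAt (fun t : ℝ => (u, t)) ((0 : ℝ), (1 : ℝ)) (Ici 0) v :=
    ((hasDerivAt_const v u).prodMk (hasDerivAt_id v)).hasDerivWithinAt
  have h2 : HasDerivWithinAt (Q ∘ fun t : ℝ => (u, t)) (quadGrad Q (u, v) (0, 1)) (Ici 0) v :=
    (hQ.hasFDerivWithinAt (z := (u, v)) (mem_quadrant.2 ⟨hu, hv⟩)).comp_hasDerivWithinAt v h1
      fun t ht => mem_quadrant.2 ⟨hu, ht⟩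
  exact h2.derivWithin (uniqueDiffOn_Ici 0 v hv)

lemma NonlinearityHyp.map_smul (hQ : NonlinearityHyp N s p Q) {t : ℝ} (ht : 0 < t) {z : ℝ × ℝ}
    (hz : z ∈ quadrant) : Q (t • z) = t ^ p * Q z :=
  hQ.q1 t z.1 z.2 ht (mem_quadrant.1 hz).1 (mem_quadrant.1 hz).2

/-- Differentiate `Q(tz) = t^p Q(z)` in `z` and cancel a factor `t`. -/
lemma NonlinearityHyp.quadGrad_smul (hQ : NonlinearityHyp N s p Q) {t : ℝ} (ht : 0 < t)
    {z : ℝ × ℝ} (hz : z ∈ quadrant) : quadGrad Q (t • z) = t ^ (p - 1) • quadGrad Q z := by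
  have h1 : HasFDerivWithinAt (fun z : ℝ × ℝ => t • z) (t • ContinuousLinearMap.id ℝ (ℝ × ℝ))
      quadrant z := (hasFDerivWithinAt_id z quadrant).const_smul t
  have h2 := (hQ.hasFDerivWithinAt (smul_mem_quadrant ht.le hz)).comp z h1
    fun w hw => smul_mem_quadrant ht.le hw
  have h3 : HasFDerivWithinAt (Q ∘ fun z : ℝ × ℝ => t • z) (t ^ p • quadGrad Q z) quadrant z :=
    ((hQ.hasFDerivWithinAt hz).const_mul (t ^ p)).congr
      (fun w hw => hQ.map_smul ht hw) (hQ.map_smul ht hz)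
  have h4 := (uniqueDiffOn_quadrant z hz).eq h2 h3
  have h5 : t ^ p = t * t ^ (p - 1) := by
    rw [← Real.rpow_one_add' ht.le (by linarith [hQ.two_lt])]
    congr 1; ring
  have h6 : t • quadGrad Q (t • z) = t • (t ^ (p - 1) • quadGrad Q z) := by
    rw [smul_smul, ← h5, ← h4, ContinuousLinearMap.comp_smul, ContinuousLinearMap.comp_id]
  exact smul_right_injective _ ht.ne' h6

/-- Euler's identity. -/
lemma NonlinearityHyp.quadGrad_self (hQ : NonlinearityHyp N s p Q) {z : ℝ × ℝ}
    (hz : z ∈ quadrant) : quadGrad Q z z = p * Q z := by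
  have h1 : HasDerivWithinAt (fun t : ℝ => t • z) z (Ioi 0) 1 := by
    simpa using ((hasDerivAt_id (1 : ℝ)).smul_const z).hasDerivWithinAt
  have h0 : HasFDerivWithinAt Q (quadGrad Q z) quadrant ((1 : ℝ) • z) := by
    rw [one_smul]; exact hQ.hasFDerivWithinAt hz
  have h2 : HasDerivWithinAt (Q ∘ fun t : ℝ => t • z) (quadGrad Q z z) (Ioi 0) 1 :=
    h0.comp_hasDerivWithinAt 1 h1 fun t ht => smul_mem_quadrant (le_of_lt ht) hz
  have h3 : HasDerivWithinAt (Q ∘ fun t : ℝ => t • z) (p * Q z) (Ioi 0) 1 := by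
    have : HasDerivAt (fun t : ℝ => t ^ p * Q z) (p * Q z) 1 := by
      simpa using (Real.hasDerivAt_rpow_const (x := 1) (p := p)
        (Or.inl one_ne_zero)).mul_const (Q z)
    exact this.hasDerivWithinAt.congr (fun t ht => hQ.map_smul ht hz)
      (hQ.map_smul one_pos hz)
  have hu : UniqueDiffWithinAt ℝ (Ioi (0 : ℝ)) 1 := isOpen_Ioi.uniqueDiffWithinAt (mem_Ioi.2 one_pos)
  rw [← h2.derivWithin hu, h3.derivWithin hu]

lemma NonlinearityHyp.quadGrad_zero (hQ : NonlinearityHyp N s p Q) : quadGrad Q 0 = 0 := by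
  obtain ⟨C, hC, h⟩ := hQ.q2
  have h1 := h 0 0 le_rfl le_rfl
  rw [Real.zero_rpow (by linarith [hQ.two_lt]), add_zero, mul_zero] at h1
  have h2 := abs_nonneg (quadDerivU Q 0 0)
  have h3 := abs_nonneg (quadDerivV Q 0 0)
  refine clm_prod_eq_zero ?_ ?_
  · rw [← Prod.mk_zero_zero, ← hQ.quadDerivU_eq le_rfl le_rfl]
    exact abs_eq_zero.1 (by linarith)
  · rw [← Prod.mk_zero_zero, ← hQ.quadDerivV_eq le_rfl le_rfl]
    exact abs_eq_zero.1 (by linarith)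

/-- The gradient vanishes at `(1, 0)` and `(0, 1)` by assumption, and homogeneity carries this along
the axes. This is what makes the extension by zero differentiable. -/
lemma NonlinearityHyp.quadGrad_axis (hQ : NonlinearityHyp N s p Q) {z : ℝ × ℝ}
    (hz : z ∈ quadrant) (h : z.1 = 0 ∨ z.2 = 0) : quadGrad Q z = 0 := by
  obtain ⟨u, v⟩ := z
  obtain ⟨hu, hv⟩ : 0 ≤ u ∧ 0 ≤ v := mem_quadrant.1 hz
  rcases h with h | h
  · obtain rfl : u = 0 := h
    rcases hv.eq_or_lt with rfl | hv
    · exact hQ.quadGrad_zero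
    · have e : ((0 : ℝ), v) = v • ((0 : ℝ), (1 : ℝ)) := by simp
      rw [e, hQ.quadGrad_smul hv (mem_quadrant.2 ⟨le_rfl, zero_le_one⟩),
        clm_prod_eq_zero (L := quadGrad Q (0, 1)), smul_zero]
      · rw [← hQ.quadDerivU_eq le_rfl zero_le_one]; exact hQ.q3.1
      · rw [← hQ.quadDerivV_eq le_rfl zero_le_one]; exact hQ.q4.2
  · obtain rfl : v = 0 := h
    rcases hu.eq_or_lt with rfl | hu
    · exact hQ.quadGrad_zero
    · have e : (u, (0 : ℝ)) = u • ((1 : ℝ), (0 : ℝ)) := by simp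
      rw [e, hQ.quadGrad_smul hu (mem_quadrant.2 ⟨zero_le_one, le_rfl⟩),
        clm_prod_eq_zero (L := quadGrad Q (1, 0)), smul_zero]
      · rw [← hQ.quadDerivU_eq zero_le_one le_rfl]; exact hQ.q4.1
      · rw [← hQ.quadDerivV_eq zero_le_one le_rfl]; exact hQ.q3.2

lemma NonlinearityHyp.map_axis (hQ : NonlinearityHyp N s p Q) {z : ℝ × ℝ}
    (hz : z ∈ quadrant) (h : z.1 = 0 ∨ z.2 = 0) : Q z = 0 := by
  have h1 := hQ.quadGrad_self hz
  rw [hQ.quadGrad_axis hz h, zero_apply, eq_comm, mul_eq_zero] at h1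
  exact h1.resolve_left (by linarith [hQ.two_lt])

/-- `quadGrad Q` is `C¹` up to the boundary, so its derivative is bounded on the compact convex part
of the quadrant in the unit ball. -/
lemma NonlinearityHyp.exists_lipschitz_unit (hQ : NonlinearityHyp N s p Q) :
    ∃ M, 0 ≤ M ∧ ∀ z ∈ quadrant, ∀ w ∈ quadrant, ‖z‖ ≤ 1 → ‖w‖ ≤ 1 →
      ‖quadGrad Q z - quadGrad Q w‖ ≤ M * ‖z - w‖ := by
  have h1 : ContDiffOn ℝ 1 (quadGrad Q) quadrant :=
    hQ.contDiffOn.fderivWithin uniqueDiffOn_quadrant (by norm_num)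
  have hclosed : IsClosed quadrant := isClosed_Ici.prod isClosed_Ici
  set K := quadrant ∩ Metric.closedBall (0 : ℝ × ℝ) 1
  have hK : IsCompact K := (isCompact_closedBall _ _).inter_left hclosed
  have hKc : Convex ℝ K := convex_quadrant.inter (convex_closedBall _ _)
  have h2 := (h1.continuousOn_fderivWithin uniqueDiffOn_quadrant (by norm_num)).mono
    (inter_subset_left : K ⊆ quadrant)
  obtain ⟨M, hM⟩ := hK.exists_bound_of_continuousOn h2
  refine ⟨max M 0, le_max_right _ _, fun z hz w hw hz1 hw1 => ?_⟩
  refine hKc.norm_image_sub_le_of_norm_hasFDerivWithin_le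
    (f' := fderivWithin ℝ (quadGrad Q) quadrant)
    (fun x hx => ?_) (fun x hx => (hM x hx).trans (le_max_left _ _))
    ⟨hw, by simpa using hw1⟩ ⟨hz, by simpa using hz1⟩
  exact (h1.differentiableOn (by norm_num) x hx.1).hasFDerivWithinAt.mono inter_subset_left

/-- Rescale by `m = max ‖z‖ ‖w‖` to the unit ball; the gradient has degree `p - 1` and the
difference `z - w` takes up one more power of `m`. -/
lemma NonlinearityHyp.exists_lipschitz (hQ : NonlinearityHyp N s p Q) :
    ∃ M, 0 ≤ M ∧ ∀ z ∈ quadrant, ∀ w ∈ quadrant,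
      ‖quadGrad Q z - quadGrad Q w‖ ≤ M * max ‖z‖ ‖w‖ ^ (p - 2) * ‖z - w‖ := by
  obtain ⟨M, hM, h⟩ := hQ.exists_lipschitz_unit
  refine ⟨M, hM, fun z hz w hw => ?_⟩
  set m := max ‖z‖ ‖w‖ with hm
  have hm0 : 0 ≤ m := le_max_of_le_left (norm_nonneg z)
  clear_value m
  rcases hm0.eq_or_lt with h0 | h0
  · have hz0 : z = 0 := norm_le_zero_iff.1 (h0 ▸ hm ▸ le_max_left _ _)
    have hw0 : w = 0 := norm_le_zero_iff.1 (h0 ▸ hm ▸ le_max_right _ _)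
    simp [hz0, hw0]
  · have hi : 0 ≤ m⁻¹ := by positivity
    have hle : ∀ y : ℝ × ℝ, ‖y‖ ≤ m → ‖m⁻¹ • y‖ ≤ 1 := fun y hy => by
      rw [norm_smul, Real.norm_of_nonneg hi, inv_mul_le_iff₀ h0, mul_one]
      exact hy
    have hsc : ∀ y ∈ quadrant, quadGrad Q y = m ^ (p - 1) • quadGrad Q (m⁻¹ • y) := fun y hy => by
      rw [← hQ.quadGrad_smul h0 (smul_mem_quadrant hi hy), smul_inv_smul₀ h0.ne']
    have h1 := h _ (smul_mem_quadrant hi hz) _ (smul_mem_quadrant hi hw)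
      (hle z (hm ▸ le_max_left _ _)) (hle w (hm ▸ le_max_right _ _))
    rw [← smul_sub, norm_smul, Real.norm_of_nonneg hi] at h1
    have h2 : quadGrad Q z - quadGrad Q w
        = m ^ (p - 1) • (quadGrad Q (m⁻¹ • z) - quadGrad Q (m⁻¹ • w)) := by
      rw [smul_sub, ← hsc z hz, ← hsc w hw]
    rw [h2, norm_smul, Real.norm_of_nonneg (by positivity)]
    calc _ ≤ m ^ (p - 1) * (M * (m⁻¹ * ‖z - w‖)) := by gcongr
      _ = M * m ^ (p - 2) * ‖z - w‖ := by
          rw [show p - 1 = p - 2 + 1 by ring, Real.rpow_add_one h0.ne']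
          field_simp

/-- The nearest-point projection of the plane onto the closed quadrant. -/
def clip (z : ℝ × ℝ) : ℝ × ℝ := (max z.1 0, max z.2 0)

lemma clip_mem (z : ℝ × ℝ) : clip z ∈ quadrant :=
  mem_quadrant.2 ⟨le_max_right _ _, le_max_right _ _⟩

lemma norm_clip_sub_le (z w : ℝ × ℝ) : ‖clip z - clip w‖ ≤ ‖z - w‖ := by
  rw [Prod.norm_def, Prod.norm_def]
  exact max_le_max (abs_max_sub_max_le_abs _ _ _) (abs_max_sub_max_le_abs _ _ _)

lemma clip_zero : clip 0 = 0 := by simp [clip]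

lemma norm_clip_le (z : ℝ × ℝ) : ‖clip z‖ ≤ ‖z‖ := by
  simpa [clip_zero] using norm_clip_sub_le z 0

lemma clip_of_pos {z : ℝ × ℝ} (h1 : 0 < z.1) (h2 : 0 < z.2) : clip z = z :=
  Prod.ext (max_eq_left h1.le) (max_eq_left h2.le)

lemma clip_axis {z : ℝ × ℝ} (h : ¬ (0 < z.1 ∧ 0 < z.2)) : (clip z).1 = 0 ∨ (clip z).2 = 0 := by
  rw [not_and_or, not_lt, not_lt] at h
  exact h.imp max_eq_right max_eq_right

/-- `Q` vanishes on the axes, so extending by zero is composing with the projection, which is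
`1`-Lipschitz. Estimates on the quadrant thus transfer to the plane. -/
lemma NonlinearityHyp.extQ_eq (hQ : NonlinearityHyp N s p Q) (z : ℝ × ℝ) :
    extQ Q z.1 z.2 = Q (clip z) := by
  unfold extQ
  split_ifs with h
  · rw [clip_of_pos h.1 h.2]
  · rw [hQ.map_axis (clip_mem z) (clip_axis h)]

lemma NonlinearityHyp.extQ_smul (hQ : NonlinearityHyp N s p Q) {t : ℝ} (ht : 0 < t) (z : ℝ × ℝ) :
    extQ Q (t • z).1 (t • z).2 = t ^ p * extQ Q z.1 z.2 := by
  rw [hQ.extQ_eq, hQ.extQ_eq, ← hQ.map_smul ht (clip_mem z)]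
  congr 1
  simp only [clip, Prod.smul_fst, Prod.smul_snd, smul_eq_mul, Prod.smul_mk,
    mul_max_of_nonneg _ _ ht.le, mul_zero]

/-- Euler's identity survives the projection: where `clip z` may differ from `z`, it lies on an axis
and the gradient is zero. -/
lemma NonlinearityHyp.quadGrad_clip_self (hQ : NonlinearityHyp N s p Q) (z : ℝ × ℝ) :
    quadGrad Q (clip z) z = p * extQ Q z.1 z.2 := by
  rw [hQ.extQ_eq]
  by_cases h : 0 < z.1 ∧ 0 < z.2
  · rw [clip_of_pos h.1 h.2, hQ.quadGrad_self]
    exact mem_quadrant.2 ⟨h.1.le, h.2.le⟩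
  · rw [hQ.quadGrad_axis (clip_mem z) (clip_axis h), hQ.map_axis (clip_mem z) (clip_axis h)]
    simp

/-- The extension of `Q` by zero has a gradient which is locally Lipschitz, with the constant
dictated by homogeneity. -/
theorem NonlinearityHyp.exists_gradLip (hQ : NonlinearityHyp N s p Q) :
    ∃ M, 0 ≤ M ∧ GradLip p M (fun z => extQ Q z.1 z.2) (fun z => quadGrad Q (clip z)) := by
  have hp := hQ.two_lt
  obtain ⟨M, hM, h⟩ := hQ.exists_lipschitz
  refine ⟨M, hM, ⟨fun z => ?_, by simp [extQ], by simp only [clip_zero, hQ.quadGrad_zero],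
    fun z w => ?_⟩⟩
  · by_cases hz : 0 < z.1 ∧ 0 < z.2
    · have hnhds : {y : ℝ × ℝ | 0 < y.1 ∧ 0 < y.2} ∈ 𝓝 z :=
        ((isOpen_lt continuous_const continuous_fst).inter
          (isOpen_lt continuous_const continuous_snd)).mem_nhds hz
      have hq : quadrant ∈ 𝓝 z := mem_of_superset hnhds fun y hy => mem_quadrant.2 ⟨hy.1.le, hy.2.le⟩
      rw [clip_of_pos hz.1 hz.2]
      refine ((hQ.hasFDerivWithinAt (mem_quadrant.2 ⟨hz.1.le, hz.2.le⟩)).hasFDerivAt hq).congr_of_eventuallyEq ?_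
      filter_upwards [hnhds] with y hy
      rw [hQ.extQ_eq, clip_of_pos hy.1 hy.2]
    -- Off the open quadrant both `Q` and its gradient vanish at `clip z`, so the gradient is
    -- `O(‖k‖)` on the quadrant within distance `‖k‖` of `clip z`, and `Q (clip (z + k))` is
    -- `O(‖k‖²)`.
    · have hax := clip_axis hz
      have hg0 := hQ.quadGrad_axis (clip_mem z) hax
      have hQ0 := hQ.map_axis (clip_mem z) hax
      simp only [hg0]
      rw [hasFDerivAt_iff_isLittleO_nhds_zero]
      have hb : ∀ᶠ k in 𝓝 (0 : ℝ × ℝ), ‖extQ Q (z + k).1 (z + k).2 - extQ Q z.1 z.2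
          - (0 : ℝ × ℝ →L[ℝ] ℝ) k‖ ≤ M * (‖z‖ + 1) ^ (p - 2) * ‖‖k‖ ^ 2‖ := by
        filter_upwards [Metric.ball_mem_nhds (0 : ℝ × ℝ) one_pos] with k hk
        rw [mem_ball_zero_iff] at hk
        have hd : ‖clip (z + k) - clip z‖ ≤ ‖k‖ := by
          simpa using norm_clip_sub_le (z + k) z
        have h1 := (convex_quadrant.inter
          (convex_closedBall (clip z) ‖k‖)).norm_image_sub_le_of_norm_hasFDerivWithin_le
            (f := Q) (f' := quadGrad Q) (C := M * (‖z‖ + 1) ^ (p - 2) * ‖k‖)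
            (x := clip z) (y := clip (z + k))
            (fun x hx => (hQ.hasFDerivWithinAt hx.1).mono inter_subset_left) (fun x hx => ?_)
            ⟨clip_mem _, Metric.mem_closedBall_self (norm_nonneg k)⟩
            ⟨clip_mem _, by rwa [mem_closedBall_iff_norm]⟩
        · rw [hQ.extQ_eq, hQ.extQ_eq, zero_apply, sub_zero, norm_pow, norm_norm]
          refine h1.trans ?_
          calc _ ≤ M * (‖z‖ + 1) ^ (p - 2) * ‖k‖ * ‖k‖ := by gcongr
            _ = _ := by ring
        · have hxk : ‖x - clip z‖ ≤ ‖k‖ := by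
            rw [← mem_closedBall_iff_norm]; exact hx.2
          have h2 := h x hx.1 (clip z) (clip_mem z)
          rw [hg0, sub_zero] at h2
          have h3 : max ‖x‖ ‖clip z‖ ≤ ‖z‖ + 1 := by
            have := norm_le_norm_add_norm_sub' x (clip z)
            have := norm_clip_le z
            exact max_le (by linarith) (by linarith)
          refine h2.trans ?_
          gcongr
      exact (Asymptotics.IsBigO.of_bound _ hb).trans_isLittleO
        (Asymptotics.isLittleO_norm_pow_id one_lt_two)
  · refine (h _ (clip_mem z) _ (clip_mem w)).trans ?_
    have := norm_clip_le z
    have := norm_clip_le w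
    have := norm_clip_sub_le z w
    gcongr

end Quadrant

/-! ### Counting powers of the cut-off parameter. -/

section ScaledLip

/-- On the square `|z| ≤ 5a`, `f` is bounded by `c a^β` and Lipschitz with constant
`c a^(β - 1)`. -/
structure ScaledLip {Y : Type*} [NormedAddCommGroup Y] (a β c : ℝ) (f : ℝ × ℝ → Y) : Prop where
  bound : ∀ z, ‖z‖ ≤ 5 * a → ‖f z‖ ≤ c * a ^ β
  lip : ∀ z w, ‖z‖ ≤ 5 * a → ‖w‖ ≤ 5 * a → ‖f z - f w‖ ≤ c * a ^ (β - 1) * ‖z - w‖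

namespace ScaledLip

variable {Y : Type*} [NormedAddCommGroup Y] {a β γ b c : ℝ}

lemma add {f g : ℝ × ℝ → Y} (hf : ScaledLip a β b f) (hg : ScaledLip a β c g) :
    ScaledLip a β (b + c) (fun z => f z + g z) := by
  refine ⟨fun z hz => ?_, fun z w hz hw => ?_⟩
  · rw [add_mul]
    exact (norm_add_le _ _).trans (add_le_add (hf.bound z hz) (hg.bound z hz))
  · rw [add_sub_add_comm, add_mul, add_mul]
    exact (norm_add_le _ _).trans (add_le_add (hf.lip z w hz hw) (hg.lip z w hz hw))

lemma sub {f g : ℝ × ℝ → Y} (hf : ScaledLip a β b f) (hg : ScaledLip a β c g) :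
    ScaledLip a β (b + c) (fun z => f z - g z) := by
  refine ⟨fun z hz => ?_, fun z w hz hw => ?_⟩
  · rw [add_mul]
    exact (norm_sub_le _ _).trans (add_le_add (hf.bound z hz) (hg.bound z hz))
  · rw [sub_sub_sub_comm, add_mul, add_mul]
    exact (norm_sub_le _ _).trans (add_le_add (hf.lip z w hz hw) (hg.lip z w hz hw))

/-- Scaling degrees add under products; the Leibniz rule costs the factor `2`. -/
lemma smul [NormedSpace ℝ Y] {f : ℝ × ℝ → ℝ} {g : ℝ × ℝ → Y} (ha : 0 < a) (hb : 0 ≤ b)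
    (hc : 0 ≤ c) (hf : ScaledLip a β b f) (hg : ScaledLip a γ c g) :
    ScaledLip a (β + γ) (2 * b * c) (fun z => f z • g z) := by
  have h1 : ∀ x y : ℝ, a ^ (x + y) = a ^ x * a ^ y := Real.rpow_add ha
  refine ⟨fun z hz => ?_, fun z w hz hw => ?_⟩
  · rw [norm_smul, h1]
    calc ‖f z‖ * ‖g z‖ ≤ b * a ^ β * (c * a ^ γ) := by
          gcongr
          exacts [hf.bound z hz, hg.bound z hz]
      _ = b * c * (a ^ β * a ^ γ) := by ring
      _ ≤ 2 * b * c * (a ^ β * a ^ γ) := by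
          have : 0 ≤ b * c * (a ^ β * a ^ γ) := by positivity
          linarith
  · have e : f z • g z - f w • g w = f z • (g z - g w) + (f z - f w) • g w := by
      rw [smul_sub, sub_smul]; abel
    rw [e]
    have e1 : a ^ (β + γ - 1) = a ^ β * a ^ (γ - 1) := by rw [← h1]; congr 1; ring
    have e2 : a ^ (β - 1) * a ^ γ = a ^ (β + γ - 1) := by rw [← h1]; congr 1; ring
    calc _ ≤ ‖f z‖ * ‖g z - g w‖ + ‖f z - f w‖ * ‖g w‖ := by
          refine (norm_add_le _ _).trans_eq ?_
          rw [norm_smul, norm_smul]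
      _ ≤ b * a ^ β * (c * a ^ (γ - 1) * ‖z - w‖)
          + b * a ^ (β - 1) * ‖z - w‖ * (c * a ^ γ) := by
          gcongr
          exacts [hf.bound z hz, hg.lip z w hz hw, hf.lip z w hz hw, hg.bound w hw]
      _ = b * c * (a ^ β * a ^ (γ - 1)) * ‖z - w‖
          + b * c * (a ^ (β - 1) * a ^ γ) * ‖z - w‖ := by ring
      _ = _ := by rw [e2, e1]; ring

lemma const {y : Y} (h : ‖y‖ ≤ c * a ^ β) (ha : 0 < a) (hc : 0 ≤ c) :
    ScaledLip a β c (fun _ => y) :=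
  ⟨fun _ _ => h, fun z w _ _ => by rw [sub_self, norm_zero]; positivity⟩

end ScaledLip

end ScaledLip

/-! ### The Euclidean length on the plane with the maximum norm. -/

section AbsPair

/-- `ℝ × ℝ` carries the maximum norm; the complex modulus supplies the triangle inequality for the
Euclidean length. -/
lemma absPair_eq_norm (u v : ℝ) : absPair u v = ‖(u + v * Complex.I : ℂ)‖ := by
  rw [Complex.norm_add_mul_I, absPair]

lemma abs_absPair_sub_le (z w : ℝ × ℝ) :
    |absPair z.1 z.2 - absPair w.1 w.2| ≤ 2 * ‖z - w‖ := by
  rw [absPair_eq_norm, absPair_eq_norm]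
  refine (abs_norm_sub_norm_le _ _).trans ?_
  have e : ((z.1 : ℂ) + z.2 * Complex.I) - (w.1 + w.2 * Complex.I)
      = ((z.1 - w.1 : ℝ) : ℂ) + ((z.2 - w.2 : ℝ) : ℂ) * Complex.I := by
    push_cast; ring
  rw [e]
  refine (norm_add_le _ _).trans ?_
  rw [norm_mul, Complex.norm_I, mul_one, Complex.norm_real, Complex.norm_real, two_mul]
  exact add_le_add (norm_fst_le (z - w)) (norm_snd_le (z - w))

lemma norm_le_absPair (z : ℝ × ℝ) : ‖z‖ ≤ absPair z.1 z.2 := by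
  rw [Prod.norm_def, absPair]
  refine max_le (Real.abs_le_sqrt ?_) (Real.abs_le_sqrt ?_) <;> nlinarith [sq_nonneg z.1, sq_nonneg z.2]


/-- The linear functional `k ↦ z·k`. -/
def dotCLM (z : ℝ × ℝ) : ℝ × ℝ →L[ℝ] ℝ :=
  z.1 • ContinuousLinearMap.fst ℝ ℝ ℝ + z.2 • ContinuousLinearMap.snd ℝ ℝ ℝ

lemma dotCLM_sub (z w : ℝ × ℝ) : dotCLM z - dotCLM w = dotCLM (z - w) := by
  ext <;> simp [dotCLM]

lemma norm_dotCLM_le (z : ℝ × ℝ) : ‖dotCLM z‖ ≤ 2 * ‖z‖ := by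
  refine ContinuousLinearMap.opNorm_le_bound _ (by positivity) fun k => ?_
  simp only [dotCLM, add_apply, smul_apply, ContinuousLinearMap.coe_fst',
    ContinuousLinearMap.coe_snd', smul_eq_mul]
  have h1 := norm_fst_le z
  have h2 := norm_snd_le z
  have h3 := norm_fst_le k
  have h4 := norm_snd_le k
  calc ‖z.1 * k.1 + z.2 * k.2‖ ≤ ‖z.1‖ * ‖k.1‖ + ‖z.2‖ * ‖k.2‖ := by
        simpa using norm_add_le (z.1 * k.1) (z.2 * k.2)
    _ ≤ ‖z‖ * ‖k‖ + ‖z‖ * ‖k‖ := by gcongr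
    _ = _ := by ring

lemma hasFDerivAt_sq_add_sq (z : ℝ × ℝ) :
    HasFDerivAt (fun z : ℝ × ℝ => z.1 ^ 2 + z.2 ^ 2) ((2 : ℝ) • dotCLM z) z := by
  have h := (((hasFDerivAt_fst (𝕜 := ℝ) (p := z)).pow 2).add
    ((hasFDerivAt_snd (𝕜 := ℝ) (p := z)).pow 2))
  refine h.congr_fderiv ?_
  ext <;> simp [dotCLM]

variable {a : ℝ}

lemma scaledLip_dotCLM : ScaledLip a 1 10 dotCLM := by
  refine ⟨fun z hz => ?_, fun z w _ _ => ?_⟩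
  · rw [Real.rpow_one]
    linarith [norm_dotCLM_le z]
  · rw [dotCLM_sub, sub_self, Real.rpow_zero]
    linarith [norm_dotCLM_le (z - w), norm_nonneg (z - w)]

lemma scaledLip_sq_add_sq (ha : 0 < a) :
    ScaledLip a 2 50 (fun z : ℝ × ℝ => z.1 ^ 2 + z.2 ^ 2) := by
  have hb : ∀ z : ℝ × ℝ, ‖z‖ ≤ 5 * a → |z.1| ≤ 5 * a ∧ |z.2| ≤ 5 * a := fun z hz =>
    ⟨(norm_fst_le z).trans hz, (norm_snd_le z).trans hz⟩
  refine ⟨fun z hz => ?_, fun z w hz hw => ?_⟩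
  · obtain ⟨h1, h2⟩ := hb z hz
    rw [Real.norm_of_nonneg (by positivity), Real.rpow_two, ← sq_abs z.1, ← sq_abs z.2]
    nlinarith [abs_nonneg z.1, abs_nonneg z.2]
  · obtain ⟨h1, h2⟩ := hb z hz
    obtain ⟨h3, h4⟩ := hb w hw
    have h5 : |z.1 - w.1| ≤ ‖z - w‖ := norm_fst_le (z - w)
    have h6 : |z.2 - w.2| ≤ ‖z - w‖ := norm_snd_le (z - w)
    have key : ∀ x y : ℝ, |x| ≤ 5 * a → |y| ≤ 5 * a → |x - y| ≤ ‖z - w‖ →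
        |x ^ 2 - y ^ 2| ≤ 10 * a * ‖z - w‖ := by
      intro x y hx hy hxy
      have e : x ^ 2 - y ^ 2 = (x + y) * (x - y) := by ring
      rw [e, abs_mul]
      have := abs_add_le x y
      gcongr
      linarith
    have k1 := key _ _ h1 h3 h5
    have k2 := key _ _ h2 h4 h6
    rw [Real.norm_eq_abs, add_sub_add_comm, show (2 : ℝ) - 1 = 1 by norm_num, Real.rpow_one]
    have := abs_add_le (z.1 ^ 2 - w.1 ^ 2) (z.2 ^ 2 - w.2 ^ 2)
    have : 0 ≤ a * ‖z - w‖ := by positivity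
    linarith

end AbsPair

/-! ### Estimates for the radial cut-off. -/

section Cutoff

variable {C a : ℝ} {η : ℝ → ℝ}

namespace CutoffHyp

lemma le_one (h : CutoffHyp C a η) (t : ℝ) : η t ≤ 1 := by
  rw [← h.eq_one (min t a) (min_le_right _ _)]
  exact h.antitone (min_le_left _ _)

lemma nonneg (h : CutoffHyp C a η) (t : ℝ) : 0 ≤ η t := by
  rw [← h.eq_zero (max t (5 * a)) (le_max_right _ _)]
  exact h.antitone (le_max_left _ _)

lemma differentiable (h : CutoffHyp C a η) : Differentiable ℝ η :=
  h.contDiff.differentiable (by norm_num)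

lemma deriv_eq_zero_of_le (h : CutoffHyp C a η) {t : ℝ} (ht : t ≤ a) : deriv η t = 0 := by
  refine IsLocalMax.deriv_eq_zero (Eventually.of_forall fun x => ?_)
  rw [h.eq_one t ht]
  exact h.le_one x

lemma deriv_eq_zero_of_ge (h : CutoffHyp C a η) {t : ℝ} (ht : 5 * a ≤ t) : deriv η t = 0 := by
  refine IsLocalMin.deriv_eq_zero (Eventually.of_forall fun x => ?_)
  rw [h.eq_zero t ht]
  exact h.nonneg x

lemma abs_sub_le (h : CutoffHyp C a η) (t r : ℝ) : |η t - η r| ≤ C / a * |t - r| :=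
  convex_univ.norm_image_sub_le_of_norm_deriv_le (fun x _ => h.differentiable x)
    (fun x _ => h.deriv_le x) (mem_univ r) (mem_univ t)

lemma abs_deriv_sub_le (h : CutoffHyp C a η) (t r : ℝ) :
    |deriv η t - deriv η r| ≤ C / a ^ 2 * |t - r| := by
  have hd : Differentiable ℝ (deriv η) :=
    (contDiff_succ_iff_deriv (n := 1).1 h.contDiff).2.2.differentiable (by norm_num)
  exact convex_univ.norm_image_sub_le_of_norm_deriv_le (fun x _ => hd x)
    (fun x _ => h.deriv_two_le x) (mem_univ r) (mem_univ t)

/-- `η'` vanishes on `(-∞, a]`, so the denominator may be truncated at `a`. This removes the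
singularity at the origin. -/
lemma deriv_div_eq (h : CutoffHyp C a η) (t : ℝ) :
    deriv η t / t = deriv η (max t a) / max t a := by
  rcases le_total t a with ht | ht
  · rw [max_eq_right ht, h.deriv_eq_zero_of_le ht, h.deriv_eq_zero_of_le le_rfl]
    simp
  · rw [max_eq_left ht]

lemma abs_deriv_div_le (h : CutoffHyp C a η) (ha : 0 < a) (hC : 0 < C) (t : ℝ) :
    |deriv η t / t| ≤ C / a ^ 2 := by
  rw [h.deriv_div_eq, abs_div, abs_of_pos (lt_max_of_lt_right ha)]
  calc _ ≤ C / a / a := by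
        gcongr
        exacts [h.deriv_le _, le_max_right _ _]
    _ = _ := by rw [div_div, sq]

lemma abs_deriv_div_sub_le (h : CutoffHyp C a η) (ha : 0 < a) (hC : 0 < C) (t r : ℝ) :
    |deriv η t / t - deriv η r / r| ≤ 2 * C / a ^ 3 * |t - r| := by
  rw [h.deriv_div_eq t, h.deriv_div_eq r]
  have hmax := abs_max_sub_max_le_abs t r a
  set x := max t a
  set y := max r a
  have hx : a ≤ x := le_max_right _ _
  have hy : a ≤ y := le_max_right _ _
  have hx0 : 0 < x := ha.trans_le hx
  have hy0 : 0 < y := ha.trans_le hy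
  have e : deriv η x / x - deriv η y / y
      = (deriv η x - deriv η y) / x + deriv η y * (y - x) / (x * y) := by
    field_simp; ring
  rw [e]
  calc _ ≤ |deriv η x - deriv η y| / x + |deriv η y| * |x - y| / (x * y) := by
        refine (abs_add_le _ _).trans_eq ?_
        rw [abs_div, abs_div, abs_mul, abs_of_pos hx0, abs_of_pos (mul_pos hx0 hy0),
          abs_sub_comm y x]
    _ ≤ C / a ^ 2 * |x - y| / a + C / a * |x - y| / (a * a) := by
        gcongr
        exacts [h.abs_deriv_sub_le x y, h.deriv_le y]
    _ = 2 * C / a ^ 3 * |x - y| := by field_simp; ring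
    _ ≤ _ := by gcongr

lemma hasFDerivAt_comp_absPair (h : CutoffHyp C a η) (ha : 0 < a) (z : ℝ × ℝ) :
    HasFDerivAt (fun z : ℝ × ℝ => η (absPair z.1 z.2))
      ((deriv η (absPair z.1 z.2) / absPair z.1 z.2) • dotCLM z) z := by
  rcases eq_or_ne z 0 with rfl | hz
  -- The length is not differentiable at `0`, but the cut-off equals `1` nearby, and the claimed
  -- gradient vanishes there.
  · have h1 : (fun z : ℝ × ℝ => η (absPair z.1 z.2)) =ᶠ[𝓝 0] fun _ => 1 := by
      have hc : Continuous fun z : ℝ × ℝ => absPair z.1 z.2 := by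
        unfold absPair; fun_prop
      have h0 : absPair (0 : ℝ × ℝ).1 (0 : ℝ × ℝ).2 < a := by simpa [absPair] using ha
      filter_upwards [hc.continuousAt.eventually (gt_mem_nhds h0)] with y hy
      exact h.eq_one _ hy.le
    refine ((hasFDerivAt_const (1 : ℝ) (0 : ℝ × ℝ)).congr_of_eventuallyEq h1).congr_fderiv ?_
    simp [absPair]
  · have hpos : 0 < absPair z.1 z.2 := (norm_pos_iff.2 hz).trans_le (norm_le_absPair z)
    have h1 : HasFDerivAt (fun z : ℝ × ℝ => absPair z.1 z.2) _ z :=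
      (hasFDerivAt_sq_add_sq z).sqrt (Real.sqrt_pos.1 hpos).ne'
    refine ((h.differentiable _).hasDerivAt.comp_hasFDerivAt z h1).congr_fderiv ?_
    rw [smul_smul, smul_smul]
    congr 1
    rw [absPair] at hpos ⊢
    field_simp

lemma scaledLip_comp_absPair (h : CutoffHyp C a η) (ha : 0 < a) (hC : 0 < C) :
    ScaledLip a 0 (1 + 2 * C) (fun z : ℝ × ℝ => η (absPair z.1 z.2)) := by
  refine ⟨fun z _ => ?_, fun z w _ _ => ?_⟩
  · rw [Real.norm_of_nonneg (h.nonneg _), Real.rpow_zero]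
    linarith [h.le_one (absPair z.1 z.2)]
  · rw [zero_sub, Real.rpow_neg_one]
    calc _ ≤ C / a * |absPair z.1 z.2 - absPair w.1 w.2| := h.abs_sub_le _ _
      _ ≤ C / a * (2 * ‖z - w‖) := by
          gcongr
          exact abs_absPair_sub_le z w
      _ = 2 * C * a⁻¹ * ‖z - w‖ := by rw [div_eq_mul_inv]; ring
      _ ≤ _ := by gcongr; linarith

/-- The factors `η'` and `1/|z|` each count as degree `-1`. -/
lemma scaledLip_deriv_div (h : CutoffHyp C a η) (ha : 0 < a) (hC : 0 < C) :
    ScaledLip a (-2) (4 * C)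
      (fun z : ℝ × ℝ => deriv η (absPair z.1 z.2) / absPair z.1 z.2) := by
  refine ⟨fun z _ => ?_, fun z w _ _ => ?_⟩
  · have h1 := h.abs_deriv_div_le ha hC (absPair z.1 z.2)
    rw [Real.rpow_neg ha.le, Real.rpow_two]
    refine h1.trans ?_
    rw [div_eq_mul_inv]
    gcongr
    linarith
  · rw [show (-2 : ℝ) - 1 = -(3 : ℕ) by norm_num, Real.rpow_neg ha.le, Real.rpow_natCast]
    calc _ ≤ 2 * C / a ^ 3 * |absPair z.1 z.2 - absPair w.1 w.2| :=
          h.abs_deriv_div_sub_le ha hC _ _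
      _ ≤ 2 * C / a ^ 3 * (2 * ‖z - w‖) := by
          gcongr
          exact abs_absPair_sub_le z w
      _ = _ := by rw [div_eq_mul_inv]; ring

end CutoffHyp

end Cutoff

/-! ### Scaling estimates for the homogeneous nonlinearity. -/

section GradLipScaled

variable {r M a : ℝ} {F : ℝ × ℝ → ℝ} {g : ℝ × ℝ → ℝ × ℝ →L[ℝ] ℝ}

lemma GradLip.scaledLip_grad (h : GradLip r M F g) (hr : 2 ≤ r) (hM : 0 ≤ M) (ha : 0 < a) :
    ScaledLip a (r - 1) (M * 5 ^ r) g := by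
  have h5 : ∀ b : ℝ, b ≤ r → M * (5 * a) ^ b ≤ M * 5 ^ r * a ^ b := fun b hb => by
    rw [Real.mul_rpow (by norm_num) ha.le, ← mul_assoc]
    gcongr
    norm_num
  refine ⟨fun z hz => ?_, fun z w hz hw => ?_⟩
  · refine (h.norm_grad_le hr z).trans (le_trans ?_ (h5 (r - 1) (by linarith)))
    gcongr
    linarith
  · rw [show r - 1 - 1 = r - 2 by ring]
    refine (h.lip z w).trans (mul_le_mul_of_nonneg_right ?_ (norm_nonneg _))
    refine le_trans ?_ (h5 (r - 2) (by linarith))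
    gcongr
    exact max_le hz hw

lemma GradLip.scaledLip (h : GradLip r M F g) (hr : 2 ≤ r) (hM : 0 ≤ M) (ha : 0 < a) :
    ScaledLip a r (M * 5 ^ r) F := by
  refine ⟨fun z hz => ?_, fun z w hz hw => ?_⟩
  · refine (h.abs_le hr hM z).trans ?_
    rw [mul_assoc, ← Real.mul_rpow (by norm_num) ha.le]
    gcongr
  · exact (convex_closedBall (0 : ℝ × ℝ) (5 * a)).norm_image_sub_le_of_norm_hasFDerivWithin_le
      (fun x _ => (h.hasFDerivAt x).hasFDerivWithinAt)
      (fun x hx => (h.scaledLip_grad hr hM ha).bound x (by simpa using hx))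
      (by simpa using hw) (by simpa using hz)

end GradLipScaled

/-! ### The penalized nonlinearity has a small Lipschitz gradient. -/

section Penalized

variable {p M C a : ℝ} {Q : ℝ × ℝ → ℝ} {η : ℝ → ℝ} {g : ℝ × ℝ → ℝ × ℝ →L[ℝ] ℝ}

/-- `|Q|/|z|²` is at most `M |z|^(p-2)`, and `|z| ≤ 5a` on the annulus; hence `A` is of order
`a^(p-2)`. -/
lemma abs_penaltyConst_le (h : GradLip p M (fun z => extQ Q z.1 z.2) g) (hp : 2 ≤ p)
    (hM : 0 ≤ M) (ha : 0 < a) : |penaltyConst Q a| ≤ M * 5 ^ p * a ^ (p - 2) := by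
  have hB : 0 ≤ M * 5 ^ p * a ^ (p - 2) := by positivity
  have key : ∀ y ∈ (fun z : ℝ × ℝ => extQ Q z.1 z.2 / (z.1 ^ 2 + z.2 ^ 2)) ''
      {z | a ≤ absPair z.1 z.2 ∧ absPair z.1 z.2 ≤ 5 * a}, |y| ≤ M * 5 ^ p * a ^ (p - 2) := by
    rintro y ⟨z, ⟨hz1, hz2⟩, rfl⟩
    have e : z.1 ^ 2 + z.2 ^ 2 = absPair z.1 z.2 ^ 2 := by
      rw [absPair, Real.sq_sqrt (by positivity)]
    have hpos : 0 < absPair z.1 z.2 := ha.trans_le hz1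
    simp only [e]
    rw [abs_div, abs_of_pos (by positivity : 0 < absPair z.1 z.2 ^ 2),
      div_le_iff₀ (by positivity)]
    calc |extQ Q z.1 z.2| ≤ M * ‖z‖ ^ p := h.abs_le hp hM z
      _ ≤ M * absPair z.1 z.2 ^ p := by
          gcongr
          exact norm_le_absPair z
      _ = M * absPair z.1 z.2 ^ (p - 2) * absPair z.1 z.2 ^ 2 := by
          rw [mul_assoc, ← Real.rpow_natCast _ 2, ← Real.rpow_add hpos]
          norm_num
      _ ≤ M * (5 * a) ^ (p - 2) * absPair z.1 z.2 ^ 2 := by gcongr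
      _ ≤ _ := by
          rw [Real.mul_rpow (by norm_num) ha.le, ← mul_assoc]
          gcongr
          · norm_num
          · linarith
  refine abs_le.2 ⟨?_, Real.sSup_le (fun y hy => (abs_le.1 (key y hy)).2) hB⟩
  -- The lower bound of the supremum needs a point of the annulus; `(a, 0)` is one.
  obtain ⟨y, hy⟩ : ((fun z : ℝ × ℝ => extQ Q z.1 z.2 / (z.1 ^ 2 + z.2 ^ 2)) ''
      {z | a ≤ absPair z.1 z.2 ∧ absPair z.1 z.2 ≤ 5 * a}).Nonempty := by
    refine Set.Nonempty.image _ ⟨(a, 0), ?_⟩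
    have : absPair a 0 = a := by simp [absPair, Real.sqrt_sq ha.le]
    change a ≤ absPair a 0 ∧ absPair a 0 ≤ 5 * a
    rw [this]
    exact ⟨le_rfl, by linarith⟩
  exact (abs_le.1 (key y hy)).1.trans
    (le_csSup ⟨_, fun x hx => (abs_le.1 (key x hx)).2⟩ hy)

/-- The compactly supported part of the gradient of the penalized nonlinearity. -/
def hatGradCore (Q : ℝ × ℝ → ℝ) (g : ℝ × ℝ → ℝ × ℝ →L[ℝ] ℝ) (A : ℝ) (η : ℝ → ℝ) (z : ℝ × ℝ) :
    ℝ × ℝ →L[ℝ] ℝ :=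
  η (absPair z.1 z.2) • (g z - (2 * A) • dotCLM z)
    + ((deriv η (absPair z.1 z.2) / absPair z.1 z.2)
      • (extQ Q z.1 z.2 - A • (z.1 ^ 2 + z.2 ^ 2))) • dotCLM z

/-- The gradient of the penalized nonlinearity. -/
def hatGrad (Q : ℝ × ℝ → ℝ) (g : ℝ × ℝ → ℝ × ℝ →L[ℝ] ℝ) (A : ℝ) (η : ℝ → ℝ) (z : ℝ × ℝ) :
    ℝ × ℝ →L[ℝ] ℝ :=
  (2 * A) • dotCLM z + hatGradCore Q g A η z

lemma hasFDerivAt_hatQ (h : GradLip p M (fun z => extQ Q z.1 z.2) g) (hη : CutoffHyp C a η)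
    (ha : 0 < a) (z : ℝ × ℝ) :
    HasFDerivAt (fun z : ℝ × ℝ => hatQ Q a η z.1 z.2) (hatGrad Q g (penaltyConst Q a) η z) z := by
  have h1 := hη.hasFDerivAt_comp_absPair ha z
  have h2 := (hasFDerivAt_sq_add_sq z).const_mul (penaltyConst Q a)
  have h3 := (h1.mul (h.hasFDerivAt z)).add ((h1.const_sub 1).mul h2)
  refine h3.congr_fderiv ?_
  ext <;> simp [hatGrad, hatGradCore] <;> ring

/-- The componentwise truncation at height `b`. -/
def clampPair (b : ℝ) (z : ℝ × ℝ) : ℝ × ℝ := (max (-b) (min z.1 b), max (-b) (min z.2 b))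

lemma norm_clampPair_sub_le (b : ℝ) (z w : ℝ × ℝ) :
    ‖clampPair b z - clampPair b w‖ ≤ ‖z - w‖ := by
  have key : ∀ x y : ℝ, |max (-b) (min x b) - max (-b) (min y b)| ≤ |x - y| := fun x y => by
    refine (abs_max_sub_max_le_max _ _ _ _).trans ?_
    rw [sub_self, abs_zero, max_eq_right (abs_nonneg _)]
    refine (abs_min_sub_min_le_max _ _ _ _).trans ?_
    rw [sub_self, abs_zero, max_eq_left (abs_nonneg _)]
  rw [Prod.norm_def, Prod.norm_def]
  exact max_le_max (key _ _) (key _ _)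

lemma norm_clampPair_le {b : ℝ} (hb : 0 ≤ b) (z : ℝ × ℝ) : ‖clampPair b z‖ ≤ b := by
  have key : ∀ x : ℝ, |max (-b) (min x b)| ≤ b := fun x =>
    abs_le.2 ⟨le_max_left _ _, max_le (by linarith) (min_le_right _ _)⟩
  rw [Prod.norm_def]
  exact max_le (key _) (key _)

lemma clampPair_of_norm_le {b : ℝ} {z : ℝ × ℝ} (h : ‖z‖ ≤ b) : clampPair b z = z := by
  have key : ∀ x : ℝ, |x| ≤ b → max (-b) (min x b) = x := fun x hx => by
    rw [min_eq_left (abs_le.1 hx).2, max_eq_right (abs_le.1 hx).1]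
  exact Prod.ext (key _ ((norm_fst_le z).trans h)) (key _ ((norm_snd_le z).trans h))

lemma le_norm_clampPair {b : ℝ} (hb : 0 ≤ b) {z : ℝ × ℝ} (h : b ≤ ‖z‖) :
    b ≤ ‖clampPair b z‖ := by
  have key : ∀ x : ℝ, b ≤ |x| → b ≤ |max (-b) (min x b)| := fun x hx => by
    rcases le_abs.1 hx with h | h
    · rw [min_eq_right h, max_eq_right (by linarith)]
      exact le_abs_self b
    · rw [min_eq_left (by linarith), max_eq_left (by linarith), abs_neg]
      exact le_abs_self b
  rw [Prod.norm_def] at h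
  rcases le_max_iff.1 h with h | h
  · exact (key _ h).trans (norm_fst_le (clampPair b z))
  · exact (key _ h).trans (norm_snd_le (clampPair b z))

/-- The core vanishes once the maximum norm reaches `5a`, and truncation keeps such points at norm
at least `5a`. A Lipschitz bound on the square therefore becomes global. -/
lemma hatGradCore_clampPair (hη : CutoffHyp C a η) (ha : 0 < a) (A : ℝ) (z : ℝ × ℝ) :
    hatGradCore Q g A η (clampPair (5 * a) z) = hatGradCore Q g A η z := by
  have h0 : ∀ w : ℝ × ℝ, 5 * a ≤ ‖w‖ → hatGradCore Q g A η w = 0 := fun w hw => by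
    have hw' := hw.trans (norm_le_absPair w)
    simp [hatGradCore, hη.eq_zero _ hw', hη.deriv_eq_zero_of_ge hw']
  rcases le_total ‖z‖ (5 * a) with h | h
  · rw [clampPair_of_norm_le h]
  · rw [h0 z h, h0 _ (le_norm_clampPair (by linarith) h)]

/-- The penalized nonlinearity has a Lipschitz gradient, with a constant which is small with the
cut-off parameter. -/
theorem exists_gradLip_hatQ (h : GradLip p M (fun z => extQ Q z.1 z.2) g) (hp : 2 ≤ p)
    (hM : 0 ≤ M) (hC : 0 < C) :
    ∃ K, 0 ≤ K ∧ ∀ a : ℝ, 0 < a → ∀ η : ℝ → ℝ, CutoffHyp C a η →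
      GradLip 2 (K * a ^ (p - 2)) (fun z => hatQ Q a η z.1 z.2)
        (hatGrad Q g (penaltyConst Q a) η) := by
  set B := M * 5 ^ p with hB
  have hB0 : 0 ≤ B := by positivity
  -- The constants produced by the sum and product rules for `ScaledLip`, in the order of the terms
  -- of `hatGradCore`.
  set c₁ := B + 2 * (2 * B) * 10
  set c₂ := B + 2 * B * 50
  set K₀ := 2 * (1 + 2 * C) * c₁ + 2 * (2 * (4 * C) * c₂) * 10
  refine ⟨4 * B + K₀, by positivity, fun a ha η hη => ⟨hasFDerivAt_hatQ h hη ha, ?_, ?_, ?_⟩⟩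
  · simp [hatQ, extQ]
  · have : dotCLM 0 = 0 := by simp [dotCLM]
    simp [hatGrad, hatGradCore, h.grad_zero, this]
  · set A := penaltyConst Q a
    have hA : |A| ≤ B * a ^ (p - 2) := abs_penaltyConst_le h hp hM ha
    have hA2 : |2 * A| ≤ 2 * B * a ^ (p - 2) := by
      rw [abs_mul, abs_two]; linarith
    have s1 : ScaledLip a (p - 1) c₁ (fun z => g z - (2 * A) • dotCLM z) := by
      have := (ScaledLip.const hA2 ha (by positivity)).smul ha (by positivity) (by norm_num)
        (scaledLip_dotCLM)
      rw [show p - 2 + 1 = p - 1 by ring] at this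
      exact (h.scaledLip_grad hp hM ha).sub this
    have s2 : ScaledLip a p c₂ (fun z => extQ Q z.1 z.2 - A • (z.1 ^ 2 + z.2 ^ 2)) := by
      have := (ScaledLip.const hA ha (by positivity)).smul ha (by positivity) (by norm_num)
        (scaledLip_sq_add_sq ha)
      rw [sub_add_cancel] at this
      exact (h.scaledLip hp hM ha).sub this
    have s3 : ScaledLip a (p - 1) K₀ (hatGradCore Q g A η) := by
      have t1 := (hη.scaledLip_comp_absPair ha hC).smul ha (by positivity) (by positivity) s1
      have t2 := ((hη.scaledLip_deriv_div ha hC).smul ha (by positivity) (by positivity) s2).smul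
        ha (by positivity) (by norm_num) (scaledLip_dotCLM)
      rw [zero_add] at t1
      rw [show -2 + p + 1 = p - 1 by ring] at t2
      exact t1.add t2
    intro z w
    have hT : 0 ≤ 5 * a := by positivity
    have u1 : ‖hatGradCore Q g A η z - hatGradCore Q g A η w‖
        ≤ K₀ * a ^ (p - 2) * ‖z - w‖ := by
      rw [← hatGradCore_clampPair hη ha A z, ← hatGradCore_clampPair hη ha A w]
      refine (s3.lip _ _ (norm_clampPair_le hT z) (norm_clampPair_le hT w)).trans ?_
      rw [show p - 1 - 1 = p - 2 by ring]
      gcongr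
      exact norm_clampPair_sub_le _ z w
    have u2 : ‖(2 * A) • dotCLM z - (2 * A) • dotCLM w‖ ≤ 4 * B * a ^ (p - 2) * ‖z - w‖ := by
      have e : (2 * A) • dotCLM z - (2 * A) • dotCLM w = (2 * A) • dotCLM (z - w) := by
        rw [← dotCLM_sub, smul_sub]
      rw [e, norm_smul, Real.norm_eq_abs]
      calc _ ≤ 2 * B * a ^ (p - 2) * (2 * ‖z - w‖) := by
            gcongr
            exact norm_dotCLM_le _
        _ = _ := by ring
    rw [sub_self, Real.rpow_zero, mul_one, hatGrad, hatGrad, add_sub_add_comm]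
    refine (norm_add_le _ _).trans ((add_le_add u2 u1).trans_eq ?_)
    ring

end Penalized

/-! ### A pointwise lower bound for the energy density. -/

section Pointwise

variable {N : ℕ} {s : ℝ} {u : E N → ℝ}

/-- The square of the pointwise Gagliardo energy density, `∫ |u(x) - u(y)|² / |x - y|^(N + 2s) dy`. -/
def gagDensity (s : ℝ) (u : E N → ℝ) (x : E N) : ENNReal :=
  ∫⁻ y, ENNReal.ofReal (gagliardo s u (x, y) ^ 2)

lemma measurable_gagliardo (hu : Measurable u) : Measurable (gagliardo s u) := by
  unfold gagliardo
  fun_prop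

lemma lintegral_gagDensity (hu : Measurable u) :
    ∫⁻ x, gagDensity s u x = ∫⁻ q, ENNReal.ofReal (gagliardo s u q ^ 2) := by
  have h : Measurable fun q => ENNReal.ofReal (gagliardo s u q ^ 2) :=
    ((measurable_gagliardo hu).pow_const 2).ennreal_ofReal
  rw [Measure.volume_eq_prod, lintegral_prod _ h.aemeasurable]
  rfl

/-- The volume of the unit ball. -/
def unitVol (N : ℕ) : ℝ := (volume (Metric.ball (0 : E N) 1)).toReal

lemma unitVol_pos (N : ℕ) : 0 < unitVol N :=
  ENNReal.toReal_pos (Metric.measure_ball_pos volume 0 one_pos).ne' measure_ball_lt_top.ne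

lemma volume_ball_eq (x : E N) {r : ℝ} (hr : 0 < r) :
    volume (Metric.ball x r) = ENNReal.ofReal (r ^ N * unitVol N) := by
  rw [unitVol, ENNReal.ofReal_mul (by positivity), ENNReal.ofReal_toReal measure_ball_lt_top.ne,
    Measure.addHaar_ball_of_pos volume x hr, finrank_euclideanSpace_fin]

lemma gagliardo_sq (s : ℝ) (u : E N → ℝ) (x y : E N) :
    gagliardo s u (x, y) ^ 2 = (u x - u y) ^ 2 / ‖x - y‖ ^ ((N : ℝ) + 2 * s) := by
  rw [gagliardo, div_pow, ← Real.rpow_natCast (‖(x, y).1 - (x, y).2‖ ^ _) 2,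
    ← Real.rpow_mul (norm_nonneg _)]
  congr 2
  push_cast
  ring

/-- If `u` takes a value of size `t` at `x`, then its energy density at `x` is at least of order
`t^(2 + 2sq/N)`, because `u` is smaller than `t/2` on a large part of a ball around `x`. -/
lemma exists_rpow_le_gagDensity (hN : 0 < N) (hs : 0 ≤ s) {q B : ℝ} (hq : 0 ≤ q) (hB : 0 < B) :
    ∃ c > 0, ∀ u : E N → ℝ, Measurable u →
      ∫⁻ x, ENNReal.ofReal (|u x| ^ q) ≤ ENNReal.ofReal B → ∀ x, u x ≠ 0 →
        ENNReal.ofReal (c * |u x| ^ (2 + 2 * s * q / N)) ≤ gagDensity s u x := by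
  have hω := unitVol_pos N
  set ω := unitVol N with hωdef
  have hN' : (0 : ℝ) < N := Nat.cast_pos.2 hN
  set k := 2 * 2 ^ q * B / ω with hk
  have hk0 : 0 < k := by positivity
  refine ⟨ω / 8 * k ^ (-(2 * s / N)), by positivity, fun u hu huB x hx => ?_⟩
  set t := |u x|
  have ht : 0 < t := abs_pos.2 hx
  -- The radius for which the ball has twice the volume `m` that Chebyshev's inequality allows to
  -- `{|u| ≥ t/2}`.
  set r := (k * t ^ (-q)) ^ ((1 : ℝ) / N) with hr
  have hr0 : 0 < r := by positivity
  have hrN : r ^ (N : ℝ) = k * t ^ (-q) := by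
    rw [hr, ← Real.rpow_mul (by positivity), one_div_mul_cancel hN'.ne', Real.rpow_one]
  have hrN' : r ^ N * ω = 2 * ((t / 2) ^ (-q) * B) := by
    rw [← Real.rpow_natCast r N, hrN, hk, Real.div_rpow ht.le zero_le_two,
      Real.rpow_neg zero_le_two]
    field_simp
  set m := (t / 2) ^ (-q) * B with hm
  have hm0 : 0 < m := by positivity
  have hbad : volume {y | t / 2 ≤ |u y|} ≤ ENNReal.ofReal m := by
    have h1 := mul_meas_ge_le_lintegral (μ := volume) (f := fun y => ENNReal.ofReal (|u y| ^ q))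
      (by fun_prop) (ENNReal.ofReal ((t / 2) ^ q))
    have h2 : volume {y | t / 2 ≤ |u y|}
        ≤ volume {y | ENNReal.ofReal ((t / 2) ^ q) ≤ ENNReal.ofReal (|u y| ^ q)} := by
      refine measure_mono fun y (hy : t / 2 ≤ |u y|) => ?_
      exact ENNReal.ofReal_le_ofReal (Real.rpow_le_rpow (by positivity) hy hq)
    have h3 : 0 < (t / 2) ^ q := by positivity
    rw [hm, Real.rpow_neg (by positivity), inv_mul_eq_div, ENNReal.ofReal_div_of_pos h3,
      ENNReal.le_div_iff_mul_le (Or.inl (ENNReal.ofReal_pos.2 h3).ne')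
        (Or.inl ENNReal.ofReal_ne_top), mul_comm]
    exact (mul_le_mul_right h2 _).trans (h1.trans huB)
  -- The good part of the ball: volume at least `m`, and `|u x - u y| ≥ t/2` on it.
  set G := Metric.ball x r \ {y | t / 2 ≤ |u y|} with hG
  have hGm : MeasurableSet G := by
    refine measurableSet_ball.diff (measurableSet_le measurable_const ?_)
    fun_prop
  have hGv : ENNReal.ofReal m ≤ volume G := by
    refine le_trans ?_ le_measure_sdiff
    rw [volume_ball_eq x hr0, hrN', two_mul, ENNReal.ofReal_add hm0.le hm0.le]
    refine le_trans ?_ (tsub_le_tsub_left hbad _)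
    rw [ENNReal.add_sub_cancel_right ENNReal.ofReal_ne_top]
  have hlow : ∀ y ∈ G, ENNReal.ofReal ((t / 2) ^ 2 / r ^ ((N : ℝ) + 2 * s))
      ≤ ENNReal.ofReal (gagliardo s u (x, y) ^ 2) := by
    intro y hy
    have hy1 : ‖x - y‖ < r := by
      rw [← dist_eq_norm, dist_comm]; exact hy.1
    have hy2 : |u y| < t / 2 := not_le.1 hy.2
    have h1 : t / 2 ≤ |u x - u y| := by
      have := abs_sub_abs_le_abs_sub (u x) (u y)
      linarith
    have hxy : 0 < ‖x - y‖ := by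
      rw [norm_pos_iff, sub_ne_zero]
      rintro rfl
      linarith
    rw [gagliardo_sq, ← sq_abs (u x - u y)]
    refine ENNReal.ofReal_le_ofReal ?_
    gcongr
  calc ENNReal.ofReal (ω / 8 * k ^ (-(2 * s / N)) * t ^ (2 + 2 * s * q / N))
      = ENNReal.ofReal ((t / 2) ^ 2 / r ^ ((N : ℝ) + 2 * s)) * ENNReal.ofReal m := by
        rw [← ENNReal.ofReal_mul (by positivity)]
        congr 1
        -- The bound becomes a multiple of `t² r^(-2s)`, and `r^N` is a multiple of `t^(-q)`.
        have e1 : m = r ^ (N : ℝ) * ω / 2 := by rw [Real.rpow_natCast, hrN']; ring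
        have e2 : r ^ (2 * s) = k ^ (2 * s / N) * t ^ (-(2 * s * q / N)) := by
          rw [hr, ← Real.rpow_mul (by positivity), Real.mul_rpow hk0.le (by positivity),
            ← Real.rpow_mul ht.le]
          congr 2 <;> ring
        rw [e1, Real.rpow_add hr0, e2, Real.rpow_add ht, Real.rpow_two, Real.rpow_neg ht.le,
          Real.rpow_neg hk0.le]
        field_simp
        ring
    _ ≤ ENNReal.ofReal ((t / 2) ^ 2 / r ^ ((N : ℝ) + 2 * s)) * volume G := by gcongr
    _ = ∫⁻ _ in G, ENNReal.ofReal ((t / 2) ^ 2 / r ^ ((N : ℝ) + 2 * s)) := by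
        rw [setLIntegral_const]
    _ ≤ ∫⁻ y in G, ENNReal.ofReal (gagliardo s u (x, y) ^ 2) :=
        setLIntegral_mono' hGm hlow
    _ ≤ gagDensity s u x := setLIntegral_le_lintegral _ _

end Pointwise

/-! ### The subcritical fractional Sobolev inequality. -/

section Sobolev

variable {N : ℕ} {s : Ioo (0 : ℝ) 1} {U : Potential N}

lemma fracConst_pos (N : ℕ) (s : Ioo (0 : ℝ) 1) : 0 < fracConst N s := by
  obtain ⟨s, h0, h1⟩ := s
  have := Real.Gamma_pos_of_pos (s := (N : ℝ) / 2 + s) (by positivity)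
  have := Real.Gamma_pos_of_pos (s := 1 - s) (by linarith)
  unfold fracConst
  positivity

namespace FracSpace

lemma norm_sq_eq (u : FracSpace s U) : ‖u‖ ^ 2 =
    fracConst N s / 2 * (∫ q : E N × E N, gagliardo (s : ℝ) u q ^ 2) + ∫ x, U x * u x ^ 2 := by
  rw [← real_inner_self_eq_norm_sq]
  simp only [pow_two]
  rfl

lemma measurable_coe (u : FracSpace s U) : Measurable (u : E N → ℝ) :=
  (Lp.stronglyMeasurable u.toL2).measurable

lemma memLp_gagliardo (u : FracSpace s U) : MemLp (gagliardo (s : ℝ) u) 2 volume :=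
  (Subtype.property u : u.toL2 ∈ fracSubmodule s U).1

lemma integrable_potential (u : FracSpace s U) : Integrable (fun x => U x * u x ^ 2) :=
  (Subtype.property u : u.toL2 ∈ fracSubmodule s U).2

lemma coe_add (u w : FracSpace s U) : (u + w : FracSpace s U) =ᵐ[volume] (u : E N → ℝ) + w :=
  Lp.coeFn_add u.toL2 w.toL2

lemma coe_sub (u w : FracSpace s U) : (u - w : FracSpace s U) =ᵐ[volume] (u : E N → ℝ) - w :=
  Lp.coeFn_sub u.toL2 w.toL2

lemma coe_smul (c : ℝ) (u : FracSpace s U) :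
    (c • u : FracSpace s U) =ᵐ[volume] c • (u : E N → ℝ) :=
  Lp.coeFn_smul c u.toL2

lemma integrable_sq (u : FracSpace s U) : Integrable (fun x => u x ^ 2) :=
  (Lp.memLp u.toL2).integrable_sq

lemma integral_sq_le {c₀ : ℝ} (hc₀ : 0 < c₀) (hU : ∀ x, c₀ ≤ U x) (u : FracSpace s U) :
    ∫ x, u x ^ 2 ≤ c₀⁻¹ * ‖u‖ ^ 2 := by
  have h1 : c₀ * ∫ x, u x ^ 2 ≤ ∫ x, U x * u x ^ 2 := by
    rw [← integral_const_mul]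
    exact integral_mono (u.integrable_sq.const_mul c₀) u.integrable_potential
      fun x => mul_le_mul_of_nonneg_right (hU x) (sq_nonneg _)
  have h2 : 0 ≤ ∫ q : E N × E N, gagliardo (s : ℝ) u q ^ 2 :=
    integral_nonneg fun q => sq_nonneg _
  have h3 := mul_nonneg (div_nonneg (fracConst_nonneg N s) zero_le_two) h2
  rw [inv_mul_eq_div, le_div_iff₀ hc₀, u.norm_sq_eq]
  linarith

lemma lintegral_gagDensity_le (u : FracSpace s U) :
    ∫⁻ x, gagDensity (s : ℝ) u x ≤ ENNReal.ofReal (2 / fracConst N s * ‖u‖ ^ 2) := by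
  have hc := fracConst_pos N s
  rw [lintegral_gagDensity u.measurable_coe, ← ofReal_integral_eq_lintegral_ofReal
    u.memLp_gagliardo.integrable_sq (Eventually.of_forall fun q => sq_nonneg _)]
  refine ENNReal.ofReal_le_ofReal ?_
  have h2 : 0 ≤ ∫ x, U x * u x ^ 2 :=
    integral_nonneg fun x => mul_nonneg (U.pos x).le (sq_nonneg _)
  rw [div_mul_eq_mul_div, le_div_iff₀ hc, u.norm_sq_eq]
  linarith

/-- One bootstrap step: integrate the pointwise bound and use that the total energy density is
controlled by the norm. -/
lemma gain_integrability (hN : 0 < N) {q B : ℝ} (hq : 0 ≤ q) (hB : 0 < B)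
    (h : ∀ u : FracSpace s U, ‖u‖ ≤ 1 → ∫⁻ x, ENNReal.ofReal (|u x| ^ q) ≤ ENNReal.ofReal B) :
    ∃ B', 0 < B' ∧ ∀ u : FracSpace s U, ‖u‖ ≤ 1 →
      ∫⁻ x, ENNReal.ofReal (|u x| ^ (2 + 2 * (s : ℝ) * q / N)) ≤ ENNReal.ofReal B' := by
  obtain ⟨c, hc, hcx⟩ := exists_rpow_le_gagDensity (N := N) (s := s) hN s.2.1.le hq hB
  have hF := fracConst_pos N s
  refine ⟨c⁻¹ * (2 / fracConst N s), by positivity, fun u hu => ?_⟩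
  have hexp : 0 < 2 + 2 * (s : ℝ) * q / N := by
    have := s.2.1
    positivity
  calc ∫⁻ x, ENNReal.ofReal (|u x| ^ (2 + 2 * (s : ℝ) * q / N))
      ≤ ∫⁻ x, ENNReal.ofReal c⁻¹ * gagDensity (s : ℝ) u x := by
        refine lintegral_mono fun x => ?_
        rcases eq_or_ne (u x) 0 with hx | hx
        · simp [hx, Real.zero_rpow hexp.ne']
        · have h1 := hcx u u.measurable_coe (h u hu) x hx
          calc _ = ENNReal.ofReal c⁻¹
                * ENNReal.ofReal (c * |u x| ^ (2 + 2 * (s : ℝ) * q / N)) := by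
                rw [← ENNReal.ofReal_mul (by positivity), inv_mul_cancel_left₀ hc.ne']
            _ ≤ _ := by gcongr
    _ = ENNReal.ofReal c⁻¹ * ∫⁻ x, gagDensity (s : ℝ) u x :=
        lintegral_const_mul' _ _ ENNReal.ofReal_ne_top
    _ ≤ ENNReal.ofReal c⁻¹ * ENNReal.ofReal (2 / fracConst N s) := by
        gcongr
        refine u.lintegral_gagDensity_le.trans (ENNReal.ofReal_le_ofReal ?_)
        have : ‖u‖ ^ 2 ≤ 1 := pow_le_one₀ (norm_nonneg _) hu
        exact mul_le_of_le_one_right (by positivity) this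
    _ = _ := (ENNReal.ofReal_mul (by positivity)).symm

/-- The subcritical fractional Sobolev inequality on the unit ball. -/
theorem exists_lintegral_rpow_le (hN : 2 * (s : ℝ) < N) {c₀ : ℝ} (hc₀ : 0 < c₀)
    (hU : ∀ x, c₀ ≤ U x) {q : ℝ} (hq2 : 2 ≤ q) (hq : q < 2 * N / (N - 2 * s)) :
    ∃ B, 0 < B ∧ ∀ u : FracSpace s U, ‖u‖ ≤ 1 →
      ∫⁻ x, ENNReal.ofReal (|u x| ^ q) ≤ ENNReal.ofReal B := by
  have hs := s.2.1
  have hN0 : (0 : ℝ) < N := by linarith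
  have hN1 : 0 < N := Nat.cast_pos.1 hN0
  set β := 2 * (s : ℝ) / N with hβ
  have hβ0 : 0 < β := by positivity
  have hβ1 : β < 1 := (div_lt_one hN0).2 hN
  have h2base : ∀ u : FracSpace s U, ‖u‖ ≤ 1 →
      ∫⁻ x, ENNReal.ofReal (|u x| ^ (2 : ℝ)) ≤ ENNReal.ofReal c₀⁻¹ := fun u hu => by
    simp only [Real.rpow_two, sq_abs]
    rw [← ofReal_integral_eq_lintegral_ofReal u.integrable_sq
      (Eventually.of_forall fun q => sq_nonneg _)]
    refine ENNReal.ofReal_le_ofReal ((u.integral_sq_le hc₀ hU).trans ?_)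
    exact mul_le_of_le_one_right (by positivity) (pow_le_one₀ (norm_nonneg _) hu)
  -- The exponents solve `q₀ = 2`, `q_{k+1} = 2 + β q_k`, and increase to the fixed point `2/(1-β) =
  -- 2N/(N-2s)`.
  have hiter : ∀ k : ℕ, ∃ B, 0 < B ∧ ∀ u : FracSpace s U, ‖u‖ ≤ 1 →
      ∫⁻ x, ENNReal.ofReal (|u x| ^ (2 / (1 - β) * (1 - β ^ (k + 1)))) ≤ ENNReal.ofReal B := by
    intro k
    induction k with
    | zero =>
      refine ⟨c₀⁻¹, by positivity, ?_⟩
      rw [zero_add, pow_one, div_mul_cancel₀ _ (by linarith)]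
      exact h2base
    | succ k ih =>
      obtain ⟨B, hB, h⟩ := ih
      have hnn : 0 ≤ 2 / (1 - β) * (1 - β ^ (k + 1)) :=
        mul_nonneg (div_nonneg zero_le_two (by linarith))
          (sub_nonneg.2 (pow_le_one₀ hβ0.le hβ1.le))
      have h1 := gain_integrability hN1 hnn hB h
      have e : 2 + 2 * (s : ℝ) * (2 / (1 - β) * (1 - β ^ (k + 1))) / N
          = 2 / (1 - β) * (1 - β ^ (k + 1 + 1)) := by
        have hne : 1 - β ≠ 0 := by linarith
        have : 2 * (s : ℝ) * (2 / (1 - β) * (1 - β ^ (k + 1))) / N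
            = β * (2 / (1 - β) * (1 - β ^ (k + 1))) := by rw [hβ]; ring
        rw [this]
        field_simp
        ring
      rwa [e] at h1
  have hlim : Tendsto (fun k : ℕ => 2 / (1 - β) * (1 - β ^ (k + 1))) atTop
      (𝓝 (2 / (1 - β) * (1 - 0))) :=
    ((tendsto_pow_atTop_nhds_zero_of_lt_one hβ0.le hβ1).comp
      (tendsto_add_atTop_nat 1)).const_sub 1 |>.const_mul _
  have hq' : q < 2 / (1 - β) * (1 - 0) := by
    have : 2 / (1 - β) * (1 - 0) = 2 * N / (N - 2 * s) := by
      have : (N : ℝ) - 2 * s ≠ 0 := by linarith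
      have h1 : 1 - β = (N - 2 * s) / N := by rw [hβ]; field_simp
      rw [h1, sub_zero, mul_one, div_div_eq_mul_div]
    rwa [this]
  obtain ⟨k, hk⟩ := (hlim.eventually (lt_mem_nhds hq')).exists
  obtain ⟨B, hB, h⟩ := hiter k
  refine ⟨c₀⁻¹ + B, by positivity, fun u hu => ?_⟩
  -- Interpolation: `t^q` is at most `t²` for `t ≤ 1` and at most the larger power for `t ≥ 1`.
  calc ∫⁻ x, ENNReal.ofReal (|u x| ^ q)
      ≤ ∫⁻ x, (ENNReal.ofReal (|u x| ^ (2 : ℝ))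
        + ENNReal.ofReal (|u x| ^ (2 / (1 - β) * (1 - β ^ (k + 1))))) := by
        refine lintegral_mono fun x => ?_
        rw [← ENNReal.ofReal_add (by positivity) (by positivity)]
        refine ENNReal.ofReal_le_ofReal ?_
        rcases le_total |u x| 1 with h1 | h1
        · have := Real.rpow_le_rpow_of_exponent_ge_of_imp (abs_nonneg (u x)) h1 hq2
            (fun _ h0 => absurd h0 (by linarith))
          have := Real.rpow_nonneg (abs_nonneg (u x)) (2 / (1 - β) * (1 - β ^ (k + 1)))
          linarith
        · have := Real.rpow_le_rpow_of_exponent_le h1 hk.le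
          have := Real.rpow_nonneg (abs_nonneg (u x)) 2
          linarith
    _ = (∫⁻ x, ENNReal.ofReal (|u x| ^ (2 : ℝ)))
        + ∫⁻ x, ENNReal.ofReal (|u x| ^ (2 / (1 - β) * (1 - β ^ (k + 1)))) := by
        refine lintegral_add_left ?_ _
        have := u.measurable_coe
        fun_prop
    _ ≤ ENNReal.ofReal c₀⁻¹ + ENNReal.ofReal B := add_le_add (h2base u hu) (h u hu)
    _ = _ := (ENNReal.ofReal_add (by positivity) hB.le).symm

/-- The subcritical fractional Sobolev inequality. -/
theorem exists_integral_rpow_le (hN : 2 * (s : ℝ) < N) {c₀ : ℝ} (hc₀ : 0 < c₀)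
    (hU : ∀ x, c₀ ≤ U x) {q : ℝ} (hq2 : 2 ≤ q) (hq : q < 2 * N / (N - 2 * s)) :
    ∃ B, 0 < B ∧ ∀ u : FracSpace s U, Integrable (fun x => |u x| ^ q) ∧
      ∫ x, |u x| ^ q ≤ B * ‖u‖ ^ q := by
  obtain ⟨B, hB, h⟩ := exists_lintegral_rpow_le hN hc₀ hU hq2 hq
  refine ⟨B, hB, fun u => ?_⟩
  have hq0 : q ≠ 0 := by linarith
  have hmeas : AEStronglyMeasurable (fun x => |u x| ^ q) volume := by
    have := u.measurable_coe
    exact (by fun_prop : Measurable fun x => |u x| ^ q).aestronglyMeasurable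
  have key : ∫⁻ x, ENNReal.ofReal (|u x| ^ q) ≤ ENNReal.ofReal (B * ‖u‖ ^ q) := by
    rcases eq_or_ne u 0 with rfl | hu
    · have h0 : ((0 : FracSpace s U) : E N → ℝ) =ᵐ[volume] 0 := Lp.coeFn_zero ℝ 2 volume
      have : (fun x => ENNReal.ofReal (|(0 : FracSpace s U) x| ^ q)) =ᵐ[volume] 0 := by
        filter_upwards [h0] with x hx
        simp [hx, Real.zero_rpow hq0]
      rw [lintegral_congr_ae this]
      simp
    · have hu' : 0 < ‖u‖ := norm_pos_iff.2 hu
      have h1 := h (‖u‖⁻¹ • u) (by rw [norm_smul, norm_inv, norm_norm, inv_mul_cancel₀ hu'.ne'])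
      have h2 : ∫⁻ x, ENNReal.ofReal (|u x| ^ q)
          = ENNReal.ofReal (‖u‖ ^ q) * ∫⁻ x, ENNReal.ofReal (|(‖u‖⁻¹ • u) x| ^ q) := by
        rw [← lintegral_const_mul' _ _ ENNReal.ofReal_ne_top]
        refine lintegral_congr_ae ?_
        filter_upwards [coe_smul ‖u‖⁻¹ u] with x hx
        rw [hx, ← ENNReal.ofReal_mul (by positivity), Pi.smul_apply, smul_eq_mul, abs_mul,
          abs_of_pos (by positivity : 0 < ‖u‖⁻¹), ← Real.mul_rpow hu'.le (by positivity),
          mul_inv_cancel_left₀ hu'.ne']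
      rw [h2, mul_comm B, ENNReal.ofReal_mul (by positivity)]
      gcongr
  have hint : Integrable (fun x => |u x| ^ q) :=
    ⟨hmeas, (hasFiniteIntegral_iff_ofReal
      (Eventually.of_forall fun x => by positivity)).2 (key.trans_lt ENNReal.ofReal_lt_top)⟩
  refine ⟨hint, ?_⟩
  rw [← ofReal_integral_eq_lintegral_ofReal hint (Eventually.of_forall fun x => by positivity)]
    at key
  exact (ENNReal.ofReal_le_ofReal_iff (by positivity)).1 key

end FracSpace

end Sobolev

/-! ### Weak sequential compactness. -/

section WeakCompactness

/-- A bounded sequence in a separable Hilbert space has a subsequence along which all inner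
products converge. -/
lemma exists_subseq_tendsto_inner {H : Type*} [NormedAddCommGroup H] [InnerProductSpace ℝ H]
    [CompleteSpace H] [TopologicalSpace.SeparableSpace H] (u : ℕ → H) {R : ℝ}
    (hu : ∀ n, ‖u n‖ ≤ R) :
    ∃ k : ℕ → ℕ, StrictMono k ∧
      ∀ g : H, ∃ l : ℝ, Tendsto (fun n => inner ℝ g (u (k n))) atTop (𝓝 l) := by
  -- Sequential Banach-Alaoglu in the dual, transported by the Riesz isomorphism.
  have hc := WeakDual.isSeqCompact_closedBall ℝ H (0 : StrongDual ℝ H) R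
  obtain ⟨a, -, k, hk, hlim⟩ := hc
    (x := fun n => StrongDual.toWeakDual (InnerProductSpace.toDual ℝ H (u n))) (fun n => by
      simpa using hu n)
  refine ⟨k, hk, fun g => ⟨a g, ?_⟩⟩
  have h1 := ((WeakDual.eval_continuous (𝕜 := ℝ) g).tendsto a).comp hlim
  refine h1.congr fun n => ?_
  change inner ℝ (u (k n)) g = _
  exact real_inner_comm _ _

end WeakCompactness

/-! ### Means over small balls. -/

section Averages

variable {N : ℕ}

/-- The integral of `u` over the ball of radius `r` around `x`. -/
def ballInt (r : ℝ) (u : E N → ℝ) (x : E N) : ℝ := ∫ y in Metric.ball x r, u y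

lemma stronglyMeasurable_ballInt (r : ℝ) {u : E N → ℝ} (hu : Measurable u) :
    StronglyMeasurable (ballInt r u) := by
  have hset : MeasurableSet {q : E N × E N | dist q.2 q.1 < r} :=
    measurableSet_lt (by fun_prop) measurable_const
  have h : StronglyMeasurable fun q : E N × E N =>
      {q : E N × E N | dist q.2 q.1 < r}.indicator (fun q => u q.2) q :=
    (hu.comp measurable_snd).stronglyMeasurable.indicator hset
  have h2 := h.integral_prod_right' (ν := (volume : Measure (E N)))
  have e : ballInt r u = fun x => ∫ y, {q : E N × E N | dist q.2 q.1 < r}.indicator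
      (fun q => u q.2) (x, y) := by
    funext x
    rw [ballInt, ← integral_indicator measurableSet_ball]
    rfl
  rwa [e]

/-- The deviation of a function from its mean over a ball is controlled by the energy density. -/
lemma ofReal_sub_ballInt_sq_le {s : ℝ} (hs : 0 ≤ s) {r : ℝ} (hr : 0 < r) {u : E N → ℝ}
    (hu : MemLp u 2 volume) (x : E N) :
    ENNReal.ofReal ((u x - (r ^ N * unitVol N)⁻¹ * ballInt r u x) ^ 2)
      ≤ ENNReal.ofReal (r ^ (2 * s) / unitVol N) * gagDensity s u x := by
  have hω := unitVol_pos N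
  set v := r ^ N * unitVol N with hv
  have hv0 : 0 < v := by positivity
  set A := v⁻¹ * ballInt r u x with hA
  set B := Metric.ball x r
  have hvol : (volume : Measure (E N)).real B = v := by
    rw [Measure.real, volume_ball_eq x hr, ENNReal.toReal_ofReal hv0.le]
  have : IsFiniteMeasure (volume.restrict B) := ⟨by
    rw [Measure.restrict_apply_univ]; exact measure_ball_lt_top⟩
  have huB : MemLp u 2 (volume.restrict B) := hu.restrict B
  have hi1 : Integrable u (volume.restrict B) := huB.integrable (by norm_num)
  have hi2 : Integrable (fun y => (u x - u y) ^ 2) (volume.restrict B) :=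
    ((memLp_const (u x)).sub huB).integrable_sq
  have hmean : ∫ y in B, (u y - A) = 0 := by
    rw [integral_sub hi1 (integrable_const A), setIntegral_const, hvol, smul_eq_mul, hA,
      mul_inv_cancel_left₀ hv0.ne', sub_eq_zero]
    rfl
  -- Expand `(u x - u y)²` around the mean `A`: the cross term integrates to zero and `(u y - A)²`
  -- is dropped.
  have hvar : v * (u x - A) ^ 2 ≤ ∫ y in B, (u x - u y) ^ 2 := by
    have hi3 : Integrable (fun y => 2 * (u x - A) * (u y - A)) (volume.restrict B) :=
      (hi1.sub (integrable_const A)).const_mul _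
    have h1 : ∫ y in B, ((u x - A) ^ 2 - 2 * (u x - A) * (u y - A))
        ≤ ∫ y in B, (u x - u y) ^ 2 := by
      refine integral_mono ((integrable_const _).sub hi3) hi2 fun y => ?_
      nlinarith [sq_nonneg (u y - A)]
    rw [integral_sub (integrable_const _) hi3,
      integral_const_mul, hmean, setIntegral_const, hvol, smul_eq_mul] at h1
    linarith
  have hpt : ∀ y ∈ B, ENNReal.ofReal ((u x - u y) ^ 2)
      ≤ ENNReal.ofReal (r ^ ((N : ℝ) + 2 * s)) * ENNReal.ofReal (gagliardo s u (x, y) ^ 2) := by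
    intro y hy
    rw [← ENNReal.ofReal_mul (by positivity)]
    refine ENNReal.ofReal_le_ofReal ?_
    rcases eq_or_ne x y with rfl | hxy
    · simp [gagliardo]
    · have h1 : ‖x - y‖ < r := by
        rw [← dist_eq_norm, dist_comm]; exact hy
      have h2 : 0 < ‖x - y‖ := norm_pos_iff.2 (sub_ne_zero.2 hxy)
      rw [gagliardo_sq, mul_div_assoc', le_div_iff₀ (by positivity), mul_comm]
      gcongr
  have hE : ENNReal.ofReal (v * (u x - A) ^ 2)
      ≤ ENNReal.ofReal (r ^ ((N : ℝ) + 2 * s)) * gagDensity s u x := by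
    calc _ ≤ ENNReal.ofReal (∫ y in B, (u x - u y) ^ 2) := ENNReal.ofReal_le_ofReal hvar
      _ = ∫⁻ y in B, ENNReal.ofReal ((u x - u y) ^ 2) :=
          ofReal_integral_eq_lintegral_ofReal hi2 (Eventually.of_forall fun y => sq_nonneg _)
      _ ≤ ∫⁻ y in B, ENNReal.ofReal (r ^ ((N : ℝ) + 2 * s))
            * ENNReal.ofReal (gagliardo s u (x, y) ^ 2) :=
          setLIntegral_mono' measurableSet_ball hpt
      _ = ENNReal.ofReal (r ^ ((N : ℝ) + 2 * s))
            * ∫⁻ y in B, ENNReal.ofReal (gagliardo s u (x, y) ^ 2) :=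
          lintegral_const_mul' _ _ ENNReal.ofReal_ne_top
      _ ≤ _ := by
          gcongr
          exact setLIntegral_le_lintegral _ _
  calc ENNReal.ofReal ((u x - A) ^ 2)
      = ENNReal.ofReal v⁻¹ * ENNReal.ofReal (v * (u x - A) ^ 2) := by
        rw [← ENNReal.ofReal_mul (by positivity), inv_mul_cancel_left₀ hv0.ne']
    _ ≤ ENNReal.ofReal v⁻¹ * (ENNReal.ofReal (r ^ ((N : ℝ) + 2 * s)) * gagDensity s u x) := by
        gcongr
    _ = _ := by
        rw [← mul_assoc, ← ENNReal.ofReal_mul (by positivity)]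
        congr 2
        rw [hv, Real.rpow_add hr, Real.rpow_natCast]
        field_simp

end Averages

/-! ### The local Rellich theorem. -/

namespace FracSpace

variable {N : ℕ} {s : Ioo (0 : ℝ) 1} {U : Potential N}

lemma norm_toL2_sq (u : FracSpace s U) : ‖u.toL2‖ ^ 2 = ∫ x, u x ^ 2 := by
  rw [← real_inner_self_eq_norm_sq, L2.inner_def]
  simp [pow_two]

lemma norm_toL2_le {c₀ : ℝ} (hc₀ : 0 < c₀) (hU : ∀ x, c₀ ≤ U x) (u : FracSpace s U) :
    ‖u.toL2‖ ≤ √c₀⁻¹ * ‖u‖ := by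
  refine le_of_sq_le_sq ?_ (by positivity)
  rw [mul_pow, Real.sq_sqrt (by positivity), u.norm_toL2_sq]
  exact u.integral_sq_le hc₀ hU

/-- As a pairing with a fixed `L²` function, the ball integral at each point converges along weakly
convergent sequences. -/
lemma ballInt_eq_inner (r : ℝ) (u : FracSpace s U) (x : E N) :
    ballInt r u x = inner ℝ (indicatorConstLp 2 (μ := volume) (measurableSet_ball (x := x) (ε := r))
      measure_ball_lt_top.ne (1 : ℝ)) u.toL2 :=
  (L2.inner_indicatorConstLp_one _ _ _).symm

lemma abs_ballInt_le {r : ℝ} (hr : 0 < r) (u : FracSpace s U) (x : E N) :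
    |ballInt r u x| ≤ √(r ^ N * unitVol N) * ‖u.toL2‖ := by
  have hω := unitVol_pos N
  rw [ballInt_eq_inner]
  refine (abs_real_inner_le_norm _ _).trans_eq ?_
  congr 1
  rw [norm_indicatorConstLp (by norm_num) (by norm_num), Measure.real, volume_ball_eq x hr,
    ENNReal.toReal_ofReal (by positivity), norm_one, one_mul, Real.sqrt_eq_rpow]
  norm_num

lemma ballInt_sub (r : ℝ) (u w : FracSpace s U) (x : E N) :
    ballInt r (u - w : FracSpace s U) x = ballInt r u x - ballInt r w x := by
  rw [ballInt_eq_inner, ballInt_eq_inner, ballInt_eq_inner, ← inner_sub_right]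
  rfl

/-- Write `u` as its deviation from the mean plus the mean. The first part is small with `r`,
uniformly on bounded sets; the second is compact for fixed `r`. -/
lemma integral_sq_le_ballInt {r : ℝ} (hr : 0 < r) (u : FracSpace s U) {K : Set (E N)}
    (hK : volume K ≠ ⊤) :
    ∫ x in K, u x ^ 2 ≤ 2 * (r ^ (2 * (s : ℝ)) / unitVol N * (2 / fracConst N s * ‖u‖ ^ 2))
      + 2 * ((r ^ N * unitVol N)⁻¹ ^ 2 * ∫ x in K, ballInt r u x ^ 2) := by
  have hω := unitVol_pos N
  have hF := fracConst_pos N s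
  set v := (r ^ N * unitVol N)⁻¹ with hv
  have : IsFiniteMeasure (volume.restrict K) := ⟨by
    rw [Measure.restrict_apply_univ]; exact lt_top_iff_ne_top.2 hK⟩
  have hbi : Integrable (fun x => ballInt r u x ^ 2) (volume.restrict K) := by
    refine Integrable.of_bound
      ((stronglyMeasurable_ballInt r u.measurable_coe).pow 2).aestronglyMeasurable
      ((√(r ^ N * unitVol N) * ‖u.toL2‖) ^ 2) (Eventually.of_forall fun x => ?_)
    rw [norm_pow, Real.norm_eq_abs]
    gcongr
    exact u.abs_ballInt_le hr x
  have hbi' : Integrable (fun x => (v * ballInt r u x) ^ 2) (volume.restrict K) := by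
    simpa only [mul_pow] using hbi.const_mul (v ^ 2)
  have hmeas : Measurable fun x => ENNReal.ofReal ((v * ballInt r u x) ^ 2) := by
    have := (stronglyMeasurable_ballInt r u.measurable_coe).measurable
    fun_prop
  have key : ENNReal.ofReal (∫ x in K, u x ^ 2)
      ≤ ENNReal.ofReal (2 * (r ^ (2 * (s : ℝ)) / unitVol N * (2 / fracConst N s * ‖u‖ ^ 2))
        + 2 * (v ^ 2 * ∫ x in K, ballInt r u x ^ 2)) := by
    calc _ = ∫⁻ x in K, ENNReal.ofReal (u x ^ 2) :=
          ofReal_integral_eq_lintegral_ofReal u.integrable_sq.restrict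
            (Eventually.of_forall fun x => sq_nonneg _)
      _ ≤ ∫⁻ x in K, (2 * (ENNReal.ofReal (r ^ (2 * (s : ℝ)) / unitVol N)
            * gagDensity (s : ℝ) u x) + 2 * ENNReal.ofReal ((v * ballInt r u x) ^ 2)) := by
          refine lintegral_mono fun x => ?_
          have h1 := ofReal_sub_ballInt_sq_le s.2.1.le hr (Lp.memLp u.toL2) x
          calc ENNReal.ofReal (u x ^ 2)
              ≤ ENNReal.ofReal (2 * (u x - v * ballInt r u x) ^ 2
                + 2 * (v * ballInt r u x) ^ 2) := by
                refine ENNReal.ofReal_le_ofReal ?_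
                nlinarith [sq_nonneg (u x - 2 * (v * ballInt r u x))]
            _ = 2 * ENNReal.ofReal ((u x - v * ballInt r u x) ^ 2)
                + 2 * ENNReal.ofReal ((v * ballInt r u x) ^ 2) := by
                rw [ENNReal.ofReal_add (by positivity) (by positivity),
                  ENNReal.ofReal_mul zero_le_two, ENNReal.ofReal_mul zero_le_two]
                norm_num
            _ ≤ _ := by gcongr
      _ = (∫⁻ x in K, 2 * (ENNReal.ofReal (r ^ (2 * (s : ℝ)) / unitVol N)
            * gagDensity (s : ℝ) u x))
          + ∫⁻ x in K, 2 * ENNReal.ofReal ((v * ballInt r u x) ^ 2) :=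
          lintegral_add_right _ (hmeas.const_mul 2)
      _ = 2 * (ENNReal.ofReal (r ^ (2 * (s : ℝ)) / unitVol N)
            * ∫⁻ x in K, gagDensity (s : ℝ) u x)
          + 2 * ∫⁻ x in K, ENNReal.ofReal ((v * ballInt r u x) ^ 2) := by
          rw [lintegral_const_mul' _ _ (by norm_num),
            lintegral_const_mul' _ _ ENNReal.ofReal_ne_top,
            lintegral_const_mul' _ _ (by norm_num)]
      _ ≤ 2 * (ENNReal.ofReal (r ^ (2 * (s : ℝ)) / unitVol N)
            * ENNReal.ofReal (2 / fracConst N s * ‖u‖ ^ 2))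
          + 2 * ENNReal.ofReal (v ^ 2 * ∫ x in K, ballInt r u x ^ 2) := by
          gcongr
          · exact (setLIntegral_le_lintegral _ _).trans u.lintegral_gagDensity_le
          · rw [← ofReal_integral_eq_lintegral_ofReal hbi'
              (Eventually.of_forall fun x => sq_nonneg _)]
            simp only [mul_pow, integral_const_mul, le_refl]
      _ = _ := by
          have h0 : 0 ≤ ∫ x in K, ballInt r u x ^ 2 := integral_nonneg fun x => sq_nonneg _
          rw [ENNReal.ofReal_add (by positivity) (by positivity),
            ENNReal.ofReal_mul zero_le_two, ENNReal.ofReal_mul zero_le_two,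
            ← ENNReal.ofReal_mul (by positivity)]
          norm_num
  have h0 : 0 ≤ ∫ x in K, ballInt r u x ^ 2 := integral_nonneg fun x => sq_nonneg _
  exact (ENNReal.ofReal_le_ofReal_iff (by positivity)).1 key

/-- The local Rellich theorem: bounded sequences have subsequences which are Cauchy in `L²` on
sets of finite measure. -/
theorem exists_subseq_cauchy_sq {c₀ : ℝ} (hc₀ : 0 < c₀) (hU : ∀ x, c₀ ≤ U x) {K : Set (E N)}
    (hK : volume K ≠ ⊤) (u : ℕ → FracSpace s U) {R : ℝ} (hR : ∀ n, ‖u n‖ ≤ R) :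
    ∃ k : ℕ → ℕ, StrictMono k ∧ Tendsto (fun i : ℕ × ℕ =>
      ∫ x in K, (u (k i.1) - u (k i.2) : FracSpace s U) x ^ 2) (atTop ×ˢ atTop) (𝓝 0) := by
  have hω := unitVol_pos N
  have hF := fracConst_pos N s
  have hs := s.2.1
  have hR0 : 0 ≤ R := (norm_nonneg _).trans (hR 0)
  set R' := √c₀⁻¹ * R
  have hL2 : ∀ n, ‖(u n).toL2‖ ≤ R' := fun n =>
    ((u n).norm_toL2_le hc₀ hU).trans (mul_le_mul_of_nonneg_left (hR n) (Real.sqrt_nonneg _))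
  have : Fact ((2 : ENNReal) ≠ ⊤) := ⟨by norm_num⟩
  obtain ⟨k, hk, hlim⟩ := exists_subseq_tendsto_inner (fun n => (u n).toL2) hL2
  refine ⟨k, hk, ?_⟩
  have : IsFiniteMeasure (volume.restrict K) := ⟨by
    rw [Measure.restrict_apply_univ]; exact lt_top_iff_ne_top.2 hK⟩
  -- For fixed `r` the ball integrals are uniformly bounded and converge pointwise, so dominated
  -- convergence applies on a set of finite measure.
  have hball : ∀ r > 0, Tendsto (fun i : ℕ × ℕ =>
      ∫ x in K, ballInt r (u (k i.1) - u (k i.2) : FracSpace s U) x ^ 2)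
      (atTop ×ˢ atTop) (𝓝 0) := by
    intro r hr
    have h0 : ∫ x in K, (0 : ℝ) = 0 := by simp
    rw [← h0]
    refine tendsto_integral_filter_of_dominated_convergence
      (fun _ => (√(r ^ N * unitVol N) * R' + √(r ^ N * unitVol N) * R') ^ 2)
      (Eventually.of_forall fun i => ((stronglyMeasurable_ballInt r
        (FracSpace.measurable_coe _)).pow 2).aestronglyMeasurable)
      (Eventually.of_forall fun i => Eventually.of_forall fun x => ?_) (integrable_const _)
      (Eventually.of_forall fun x => ?_)
    · rw [norm_pow, Real.norm_eq_abs, ballInt_sub]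
      gcongr
      refine (abs_sub _ _).trans (add_le_add ?_ ?_)
      · exact (abs_ballInt_le hr _ x).trans (by gcongr; exact hL2 _)
      · exact (abs_ballInt_le hr _ x).trans (by gcongr; exact hL2 _)
    · obtain ⟨l, hl⟩ := hlim (indicatorConstLp 2 (μ := volume)
        (measurableSet_ball (x := x) (ε := r)) measure_ball_lt_top.ne (1 : ℝ))
      have h1 : Tendsto (fun n => ballInt r (u (k n)) x) atTop (𝓝 l) :=
        hl.congr fun n => (ballInt_eq_inner r (u (k n)) x).symm
      have h2 := ((h1.comp tendsto_fst).sub (h1.comp tendsto_snd) :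
        Tendsto _ (atTop ×ˢ atTop : Filter (ℕ × ℕ)) _).pow 2
      rw [sub_self, zero_pow two_ne_zero] at h2
      refine h2.congr fun i => ?_
      rw [ballInt_sub]
      rfl
  refine tendsto_order.2 ⟨fun e he => Eventually.of_forall fun i =>
    he.trans_le (integral_nonneg fun x => sq_nonneg _), fun e he => ?_⟩
  set C := 2 * ((unitVol N)⁻¹ * (2 / fracConst N s * (R + R) ^ 2)) with hC
  have hC0 : 0 ≤ C := by positivity
  -- Chosen so that the deviation term `r^(2s) C` is at most `e/2`.
  set r := (e / (2 * (C + 1))) ^ (1 / (2 * (s : ℝ))) with hr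
  have hr0 : 0 < r := by positivity
  have hrs : r ^ (2 * (s : ℝ)) = e / (2 * (C + 1)) := by
    rw [hr, ← Real.rpow_mul (by positivity), one_div_mul_cancel (by positivity), Real.rpow_one]
  have h1 := ((hball r hr0).const_mul ((r ^ N * unitVol N)⁻¹ ^ 2)).const_mul 2
  rw [mul_zero, mul_zero] at h1
  filter_upwards [h1.eventually (gt_mem_nhds (half_pos he))] with i hi
  refine ((u (k i.1) - u (k i.2)).integral_sq_le_ballInt hr0 hK).trans_lt ?_
  have h2 : 2 * (r ^ (2 * (s : ℝ)) / unitVol N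
      * (2 / fracConst N s * ‖u (k i.1) - u (k i.2)‖ ^ 2)) ≤ e / 2 := by
    have h3 : ‖u (k i.1) - u (k i.2)‖ ≤ R + R :=
      (norm_sub_le _ _).trans (add_le_add (hR _) (hR _))
    calc _ ≤ 2 * (r ^ (2 * (s : ℝ)) / unitVol N * (2 / fracConst N s * (R + R) ^ 2)) := by
          gcongr
      _ = r ^ (2 * (s : ℝ)) * C := by rw [hC]; ring
      _ ≤ e / 2 := by
          rw [hrs, div_mul_eq_mul_div, div_le_div_iff₀ (by positivity) two_pos]
          nlinarith
  linarith

end FracSpace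

/-! ### Completeness of the function space. -/

section Completeness

lemma lintegral_ofReal_le_of_tendsto_ae {α : Type*} [MeasurableSpace α] {μ : Measure α}
    {g : ℕ → α → ℝ} {G : α → ℝ} {b : ENNReal} (hm : ∀ i, AEMeasurable (g i) μ)
    (hlim : ∀ᵐ x ∂μ, Tendsto (fun i => g i x) atTop (𝓝 (G x)))
    (hb : ∀ᶠ i in atTop, ∫⁻ x, ENNReal.ofReal (g i x) ∂μ ≤ b) :
    ∫⁻ x, ENNReal.ofReal (G x) ∂μ ≤ b := by
  calc ∫⁻ x, ENNReal.ofReal (G x) ∂μ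
      = ∫⁻ x, liminf (fun i => ENNReal.ofReal (g i x)) atTop ∂μ := by
        refine lintegral_congr_ae ?_
        filter_upwards [hlim] with x hx
        exact (ENNReal.tendsto_ofReal hx).liminf_eq.symm
    _ ≤ liminf (fun i => ∫⁻ x, ENNReal.ofReal (g i x) ∂μ) atTop :=
        lintegral_liminf_le' fun i => (hm i).ennreal_ofReal
    _ ≤ b := liminf_le_of_frequently_le' hb.frequently

namespace FracSpace

variable {N : ℕ} {s : Ioo (0 : ℝ) 1} {U : Potential N}

lemma lintegral_potential_le (u : FracSpace s U) :
    ∫⁻ x, ENNReal.ofReal (U x * u x ^ 2) ≤ ENNReal.ofReal (‖u‖ ^ 2) := by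
  rw [← ofReal_integral_eq_lintegral_ofReal u.integrable_potential
    (Eventually.of_forall fun x => mul_nonneg (U.pos x).le (sq_nonneg _))]
  refine ENNReal.ofReal_le_ofReal ?_
  have h1 : 0 ≤ ∫ q : E N × E N, gagliardo (s : ℝ) u q ^ 2 := integral_nonneg fun q => sq_nonneg _
  have h2 := mul_nonneg (div_nonneg (fracConst_nonneg N s) zero_le_two) h1
  rw [u.norm_sq_eq]
  linarith

lemma lintegral_gagliardo_le (u : FracSpace s U) :
    ∫⁻ q, ENNReal.ofReal (gagliardo (s : ℝ) u q ^ 2)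
      ≤ ENNReal.ofReal (2 / fracConst N s * ‖u‖ ^ 2) := by
  rw [← lintegral_gagDensity u.measurable_coe]
  exact u.lintegral_gagDensity_le

/-- The element of the space given by a function in the underlying subspace of `L²`. -/
def ofMem {f : Lp ℝ 2 (volume : Measure (E N))} (h : f ∈ fracSubmodule s U) : FracSpace s U :=
  (⟨f, h⟩ : ↥(fracSubmodule s U))

lemma toL2_injective : Function.Injective (toL2 : FracSpace s U → _) :=
  fun _ _ h => Subtype.ext h

/-- A function in `L²` with finite energies is an element of the space, with the expected bound
for its norm. -/
lemma exists_of_lintegral_le (f : Lp ℝ 2 (volume : Measure (E N))) {b₁ b₂ : ℝ} (hb₁ : 0 ≤ b₁)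
    (hb₂ : 0 ≤ b₂) (h1 : ∫⁻ q, ENNReal.ofReal (gagliardo (s : ℝ) f q ^ 2) ≤ ENNReal.ofReal b₁)
    (h2 : ∫⁻ x, ENNReal.ofReal (U x * f x ^ 2) ≤ ENNReal.ofReal b₂) :
    ∃ w : FracSpace s U, w.toL2 = f ∧ ‖w‖ ^ 2 ≤ fracConst N s / 2 * b₁ + b₂ := by
  have hf : Measurable (f : E N → ℝ) := (Lp.stronglyMeasurable f).measurable
  have hU : Measurable (U : E N → ℝ) := U.continuous_toFun.measurable
  have hg : Measurable (gagliardo (s : ℝ) f) := measurable_gagliardo hf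
  have i1 : Integrable (fun q => gagliardo (s : ℝ) f q ^ 2) :=
    ⟨(hg.pow_const 2).aestronglyMeasurable, (hasFiniteIntegral_iff_ofReal
      (Eventually.of_forall fun q => sq_nonneg _)).2 (h1.trans_lt ENNReal.ofReal_lt_top)⟩
  have i2 : Integrable (fun x => U x * f x ^ 2) :=
    ⟨(by fun_prop : Measurable fun x => U x * f x ^ 2).aestronglyMeasurable,
      (hasFiniteIntegral_iff_ofReal (Eventually.of_forall fun x =>
        mul_nonneg (U.pos x).le (sq_nonneg _))).2 (h2.trans_lt ENNReal.ofReal_lt_top)⟩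
  have hmem : f ∈ fracSubmodule s U :=
    ⟨(memLp_two_iff_integrable_sq hg.aestronglyMeasurable).2 i1, i2⟩
  have hw : (ofMem hmem).toL2 = f := rfl
  refine ⟨ofMem hmem, hw, ?_⟩
  rw [norm_sq_eq, hw]
  rw [← ofReal_integral_eq_lintegral_ofReal i1 (Eventually.of_forall fun q => sq_nonneg _),
    ENNReal.ofReal_le_ofReal_iff hb₁] at h1
  rw [← ofReal_integral_eq_lintegral_ofReal i2 (Eventually.of_forall fun x =>
    mul_nonneg (U.pos x).le (sq_nonneg _)), ENNReal.ofReal_le_ofReal_iff hb₂] at h2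
  exact add_le_add (mul_le_mul_of_nonneg_left h1
    (div_nonneg (fracConst_nonneg N s) zero_le_two)) h2

/-- A Cauchy sequence converges in `L²`. Fatou's lemma along an almost everywhere convergent
subsequence bounds both energies of `u n - f`, so the convergence also holds in the energy norm. -/
theorem completeSpace {c₀ : ℝ} (hc₀ : 0 < c₀) (hU : ∀ x, c₀ ≤ U x) :
    CompleteSpace (FracSpace s U) := by
  have hF := fracConst_pos N s
  refine Metric.complete_of_cauchySeq_tendsto fun u hu => ?_
  have hL : CauchySeq fun n => (u n).toL2 := by
    rw [Metric.cauchySeq_iff] at hu ⊢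
    intro e he
    obtain ⟨n₀, h⟩ := hu (e / (√c₀⁻¹ + 1)) (by positivity)
    refine ⟨n₀, fun m hm n hn => ?_⟩
    have h1 := h m hm n hn
    rw [dist_eq_norm] at h1 ⊢
    have h2 : ‖(u m).toL2 - (u n).toL2‖ ≤ √c₀⁻¹ * ‖u m - u n‖ := norm_toL2_le hc₀ hU (u m - u n)
    rw [lt_div_iff₀ (by positivity)] at h1
    nlinarith [norm_nonneg (u m - u n)]
  obtain ⟨f, hf⟩ := cauchySeq_tendsto_of_complete hL
  obtain ⟨ns, hmono, hns⟩ := (tendstoInMeasure_of_tendsto_Lp hf).exists_seq_tendsto_ae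
  have hU' : Measurable (U : E N → ℝ) := U.continuous_toFun.measurable
  have key : ∀ e > 0, ∃ n₀, ∀ n ≥ n₀, ∃ w : FracSpace s U,
      w.toL2 = (u n).toL2 - f ∧ ‖w‖ ^ 2 ≤ 2 * e ^ 2 := by
    intro e he
    obtain ⟨n₀, h⟩ := Metric.cauchySeq_iff.1 hu e he
    refine ⟨n₀, fun n hn => ?_⟩
    have hae : ∀ᵐ x, Tendsto (fun i => (u n - u (ns i) : FracSpace s U) x) atTop
        (𝓝 (((u n).toL2 - f : Lp ℝ 2 (volume : Measure (E N))) x)) := by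
      have h1 : ∀ᵐ x, ∀ i, (u n - u (ns i) : FracSpace s U) x = u n x - u (ns i) x :=
        ae_all_iff.2 fun i => coe_sub (u n) (u (ns i))
      filter_upwards [h1, Lp.coeFn_sub (u n).toL2 f, hns] with x h1 h2 h3
      rw [h2, Pi.sub_apply]
      simp only [h1]
      exact h3.const_sub _
    have hev : ∀ᶠ i in atTop, ‖u n - u (ns i)‖ ^ 2 ≤ e ^ 2 := by
      filter_upwards [hmono.tendsto_atTop.eventually (eventually_ge_atTop n₀)] with i hi
      have := h n hn (ns i) hi
      rw [dist_eq_norm] at this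
      gcongr
    have hgag := lintegral_ofReal_le_of_tendsto_ae (μ := volume)
      (g := fun i q => gagliardo (s : ℝ) (u n - u (ns i) : FracSpace s U) q ^ 2)
      (G := fun q => gagliardo (s : ℝ) ((u n).toL2 - f : Lp ℝ 2 (volume : Measure (E N))) q ^ 2)
      (b := ENNReal.ofReal (2 / fracConst N s * e ^ 2))
      (fun i => ((measurable_gagliardo (measurable_coe _)).pow_const 2).aemeasurable)
      (by
        have h1 := (Measure.quasiMeasurePreserving_fst (μ := (volume : Measure (E N)))
          (ν := (volume : Measure (E N)))).ae hae
        have h2 := (Measure.quasiMeasurePreserving_snd (μ := (volume : Measure (E N)))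
          (ν := (volume : Measure (E N)))).ae hae
        rw [Measure.volume_eq_prod]
        filter_upwards [h1, h2] with q h1 h2
        exact ((h1.sub h2).div_const _).pow 2)
      (by
        filter_upwards [hev] with i hi
        refine (lintegral_gagliardo_le _).trans (ENNReal.ofReal_le_ofReal ?_)
        gcongr)
    have hpot := lintegral_ofReal_le_of_tendsto_ae (μ := volume)
      (g := fun i x => U x * (u n - u (ns i) : FracSpace s U) x ^ 2)
      (G := fun x => U x * ((u n).toL2 - f : Lp ℝ 2 (volume : Measure (E N))) x ^ 2)
      (b := ENNReal.ofReal (e ^ 2))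
      (fun i => (hU'.mul ((measurable_coe _).pow_const 2)).aemeasurable)
      (by
        filter_upwards [hae] with x hx
        exact (hx.pow 2).const_mul _)
      (by
        filter_upwards [hev] with i hi
        exact (lintegral_potential_le _).trans (ENNReal.ofReal_le_ofReal hi))
    obtain ⟨w, hw, hwn⟩ := exists_of_lintegral_le ((u n).toL2 - f) (by positivity)
      (by positivity) hgag hpot
    refine ⟨w, hw, hwn.trans_eq ?_⟩
    field_simp
    ring
  -- The limit enters the space as `u n₁ - w₁`, since only the differences `u n - f` have been
  -- estimated.
  obtain ⟨n₁, hn₁⟩ := key 1 one_pos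
  obtain ⟨w₁, hw₁, -⟩ := hn₁ n₁ le_rfl
  refine ⟨u n₁ - w₁, ?_⟩
  have hlim : (u n₁ - w₁).toL2 = f := by
    change (u n₁).toL2 - w₁.toL2 = f
    rw [hw₁, sub_sub_cancel]
  rw [Metric.tendsto_atTop]
  intro e he
  obtain ⟨n₀, h⟩ := key (e / 2) (by positivity)
  refine ⟨n₀, fun n hn => ?_⟩
  obtain ⟨w, hw, hwn⟩ := h n hn
  have e1 : u n - (u n₁ - w₁) = w := by
    refine toL2_injective ?_
    change (u n).toL2 - (u n₁ - w₁).toL2 = w.toL2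
    rw [hw, hlim]
  rw [dist_eq_norm, e1]
  refine lt_of_pow_lt_pow_left₀ 2 he.le (hwn.trans_lt ?_)
  nlinarith [sq_pos_of_pos he]

end FracSpace

end Completeness

/-! ### Embeddings of the product space. -/

section Embedding

/-- Split at the height `T` with `T^(q-p) = δ⁻¹`: above it the `q`-th power wins, below it the
square. -/
lemma exists_rpow_le_mul_rpow_add_mul_sq {p q δ : ℝ} (hp : 2 ≤ p) (hq : p < q) (hδ : 0 < δ) :
    ∃ C, 0 ≤ C ∧ ∀ t : ℝ, 0 ≤ t → t ^ p ≤ δ * t ^ q + C * t ^ 2 := by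
  set T := δ⁻¹ ^ (1 / (q - p)) with hT
  have hT0 : 0 < T := by positivity
  have hqp : q - p ≠ 0 := by linarith
  have hTq : T ^ (q - p) = δ⁻¹ := by
    rw [hT, ← Real.rpow_mul (by positivity), one_div_mul_cancel hqp, Real.rpow_one]
  refine ⟨T ^ (p - 2), by positivity, fun t ht => ?_⟩
  rcases le_total t T with h | h
  · have h1 : t ^ p = t ^ (p - 2) * t ^ 2 := by
      rw [← Real.rpow_natCast t 2, ← Real.rpow_add_of_nonneg ht (by linarith) (by norm_num)]
      norm_num
    have h2 : t ^ p ≤ T ^ (p - 2) * t ^ 2 := by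
      rw [h1]
      gcongr
    have h3 : 0 ≤ δ * t ^ q := by positivity
    linarith
  · have h1 : t ^ q = t ^ (q - p) * t ^ p := by
      rw [← Real.rpow_add (hT0.trans_le h), sub_add_cancel]
    have h2 : δ⁻¹ ≤ t ^ (q - p) := by
      rw [← hTq]
      gcongr
    have h3 : t ^ p ≤ δ * t ^ q := by
      calc t ^ p = δ * (δ⁻¹ * t ^ p) := by rw [mul_inv_cancel_left₀ hδ.ne']
        _ ≤ δ * (t ^ (q - p) * t ^ p) := by gcongr
        _ = δ * t ^ q := by rw [h1]
    have h4 : 0 ≤ T ^ (p - 2) * t ^ 2 := by positivity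
    linarith

variable {N : ℕ} {s : Ioo (0 : ℝ) 1}

/-- On bounded subsets of the space, convergence to zero in `L²(K)` implies convergence to zero
in `L^p(K)`, for subcritical `p`. -/
lemma FracSpace.tendsto_integral_rpow {U : Potential N} (hN : 2 * (s : ℝ) < N) {c₀ : ℝ}
    (hc₀ : 0 < c₀) (hU : ∀ x, c₀ ≤ U x) {p : ℝ} (hp2 : 2 ≤ p) (hp : p < 2 * N / (N - 2 * s))
    {K : Set (E N)} {ι : Type*} {l : Filter ι} {f : ι → FracSpace s U} {R : ℝ} (hR0 : 0 ≤ R)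
    (hR : ∀ i, ‖f i‖ ≤ R) (h : Tendsto (fun i => ∫ x in K, f i x ^ 2) l (𝓝 0)) :
    Tendsto (fun i => ∫ x in K, |f i x| ^ p) l (𝓝 0) := by
  obtain ⟨q, hpq, hq⟩ := exists_between hp
  obtain ⟨B, hB, hBu⟩ := FracSpace.exists_integral_rpow_le hN hc₀ hU (hp2.trans hpq.le) hq
  obtain ⟨B', -, hBu'⟩ := FracSpace.exists_integral_rpow_le hN hc₀ hU hp2 hp
  refine tendsto_order.2 ⟨fun e he => Eventually.of_forall fun i =>
    he.trans_le (integral_nonneg fun x => by positivity), fun e he => ?_⟩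
  set D := B * R ^ q with hD
  have hD0 : 0 ≤ D := by positivity
  obtain ⟨C, hC, hCt⟩ := exists_rpow_le_mul_rpow_add_mul_sq (δ := e / (2 * (D + 1))) hp2 hpq
    (by positivity)
  have h1 := h.const_mul C
  rw [mul_zero] at h1
  filter_upwards [h1.eventually (gt_mem_nhds (half_pos he))] with i hi
  have hiq := (hBu (f i)).1
  calc ∫ x in K, |f i x| ^ p
      ≤ ∫ x in K, (e / (2 * (D + 1)) * |f i x| ^ q + C * f i x ^ 2) := by
        refine integral_mono (hBu' (f i)).1.restrict
          ((hiq.restrict.const_mul _).add ((f i).integrable_sq.restrict.const_mul C)) fun x => ?_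
        simpa using hCt |f i x| (abs_nonneg _)
    _ = e / (2 * (D + 1)) * (∫ x in K, |f i x| ^ q) + C * ∫ x in K, f i x ^ 2 := by
        rw [integral_add (hiq.restrict.const_mul _) ((f i).integrable_sq.restrict.const_mul C),
          integral_const_mul, integral_const_mul]
    _ ≤ e / (2 * (D + 1)) * D + C * ∫ x in K, f i x ^ 2 := by
        gcongr
        calc ∫ x in K, |f i x| ^ q ≤ ∫ x, |f i x| ^ q :=
              setIntegral_le_integral hiq (Eventually.of_forall fun x => by positivity)
          _ ≤ B * ‖f i‖ ^ q := (hBu (f i)).2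
          _ ≤ D := by
              rw [hD]
              gcongr
              · linarith
              · exact hR i
    _ < e / 2 + e / 2 := by
        refine add_lt_add_of_le_of_lt ?_ hi
        rw [div_mul_eq_mul_div, div_le_div_iff₀ (by positivity) two_pos]
        nlinarith
    _ = e := add_halves e

/-- The pair of functions underlying an element of `X_ε`. -/
def evalPair {V W : Potential N} {ε : ℝ} (z : XSpace s V W ε) (x : E N) : ℝ × ℝ :=
  (z.fst x, z.snd x)

variable {V W : Potential N} {ε : ℝ}

lemma norm_evalPair_rpow_le (z : XSpace s V W ε) (x : E N) (q : ℝ) :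
    ‖evalPair z x‖ ^ q ≤ |z.fst x| ^ q + |z.snd x| ^ q := by
  have h : ‖evalPair z x‖ = max |z.fst x| |z.snd x| := rfl
  have h1 := Real.rpow_nonneg (abs_nonneg (z.fst x)) q
  have h2 := Real.rpow_nonneg (abs_nonneg (z.snd x)) q
  rw [h]
  rcases max_choice |z.fst x| |z.snd x| with h | h <;> rw [h] <;> linarith

lemma measurable_evalPair (z : XSpace s V W ε) : Measurable (evalPair z) :=
  z.fst.measurable_coe.prodMk z.snd.measurable_coe

lemma evalBound_of_integral_le (K : Set (E N)) {q S : ℝ}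
    (h : ∀ z : XSpace s V W ε, Integrable (fun x => |z.fst x| ^ q) ∧
      Integrable (fun x => |z.snd x| ^ q) ∧
      (∫ x, |z.fst x| ^ q) + (∫ x, |z.snd x| ^ q) ≤ S * ‖z‖ ^ q) :
    EvalBound (volume.restrict K) q S (evalPair : XSpace s V W ε → E N → ℝ × ℝ) := by
  have hint : ∀ z : XSpace s V W ε, Integrable (fun x => ‖evalPair z x‖ ^ q) := fun z => by
    have hm : Measurable fun x => ‖evalPair z x‖ ^ q := (measurable_evalPair z).norm.pow_const q
    refine ((h z).1.add (h z).2.1).mono' hm.aestronglyMeasurable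
      (Eventually.of_forall fun x => ?_)
    rw [Real.norm_of_nonneg (by positivity)]
    exact norm_evalPair_rpow_le z x q
  refine ⟨fun z => (measurable_evalPair z).aestronglyMeasurable, fun z w => ?_, fun c z => ?_,
    fun z => (hint z).restrict, fun z => ?_⟩
  · filter_upwards [ae_restrict_of_ae (FracSpace.coe_add z.fst w.fst),
      ae_restrict_of_ae (FracSpace.coe_add z.snd w.snd)] with x h1 h2
    exact Prod.ext h1 h2
  · filter_upwards [ae_restrict_of_ae (FracSpace.coe_smul c z.fst),
      ae_restrict_of_ae (FracSpace.coe_smul c z.snd)] with x h1 h2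
    exact Prod.ext h1 h2
  · calc ∫ x in K, ‖evalPair z x‖ ^ q ≤ ∫ x, ‖evalPair z x‖ ^ q :=
          setIntegral_le_integral (hint z) (Eventually.of_forall fun x => by positivity)
      _ ≤ ∫ x, (|z.fst x| ^ q + |z.snd x| ^ q) :=
          integral_mono (hint z) ((h z).1.add (h z).2.1) fun x => norm_evalPair_rpow_le z x q
      _ ≤ S * ‖z‖ ^ q := by
          rw [integral_add (h z).1 (h z).2.1]
          exact (h z).2.2

variable {c₀ : ℝ}

/-- The explicit constant `c₀⁻¹`, independent of `ε`, enters `κ` and makes the choice of `a` uniform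
in `ε`. -/
lemma evalBound_two (hc₀ : 0 < c₀) (hV : ∀ x, c₀ ≤ V.scale ε x) (hW : ∀ x, c₀ ≤ W.scale ε x)
    (K : Set (E N)) :
    EvalBound (volume.restrict K) 2 c₀⁻¹ (evalPair : XSpace s V W ε → E N → ℝ × ℝ) := by
  refine evalBound_of_integral_le K fun z => ?_
  simp only [Real.rpow_two, sq_abs]
  refine ⟨z.fst.integrable_sq, z.snd.integrable_sq, ?_⟩
  rw [WithLp.prod_norm_sq_eq_of_L2, mul_add]
  exact add_le_add (z.fst.integral_sq_le hc₀ hV) (z.snd.integral_sq_le hc₀ hW)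

lemma norm_fst_le_norm (z : XSpace s V W ε) : ‖z.fst‖ ≤ ‖z‖ := by
  have := WithLp.prod_norm_sq_eq_of_L2 z
  exact le_of_sq_le_sq (by nlinarith [sq_nonneg ‖z.snd‖]) (norm_nonneg z)

lemma norm_snd_le_norm (z : XSpace s V W ε) : ‖z.snd‖ ≤ ‖z‖ := by
  have := WithLp.prod_norm_sq_eq_of_L2 z
  exact le_of_sq_le_sq (by nlinarith [sq_nonneg ‖z.fst‖]) (norm_nonneg z)

/-- The size of `S` is immaterial: it enters the growth and compactness estimates but not `κ`. -/
lemma exists_evalBound (hN : 2 * (s : ℝ) < N) (hc₀ : 0 < c₀) (hV : ∀ x, c₀ ≤ V.scale ε x)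
    (hW : ∀ x, c₀ ≤ W.scale ε x) {p : ℝ} (hp2 : 2 ≤ p) (hp : p < 2 * N / (N - 2 * s))
    (K : Set (E N)) :
    ∃ S, 0 < S ∧
      EvalBound (volume.restrict K) p S (evalPair : XSpace s V W ε → E N → ℝ × ℝ) := by
  obtain ⟨B, hB, h⟩ := FracSpace.exists_integral_rpow_le hN hc₀ hV hp2 hp
  obtain ⟨B', hB', h'⟩ := FracSpace.exists_integral_rpow_le hN hc₀ hW hp2 hp
  have hp0 : 0 ≤ p := by linarith
  refine ⟨B + B', by positivity, evalBound_of_integral_le K fun z =>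
    ⟨(h z.fst).1, (h' z.snd).1, ?_⟩⟩
  rw [add_mul]
  refine add_le_add ((h z.fst).2.trans ?_) ((h' z.snd).2.trans ?_)
  · have := norm_fst_le_norm z
    gcongr
  · have := norm_snd_le_norm z
    gcongr

/-- Two successive extractions, one for each component; the local Rellich theorem is then raised
from `L²` to `L^p` by interpolation. -/
lemma exists_subseq_integral_le (hN : 2 * (s : ℝ) < N) (hc₀ : 0 < c₀)
    (hV : ∀ x, c₀ ≤ V.scale ε x) (hW : ∀ x, c₀ ≤ W.scale ε x) {p : ℝ} (hp2 : 2 ≤ p)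
    (hp : p < 2 * N / (N - 2 * s)) {K : Set (E N)} (hK : volume K ≠ ⊤) (z : ℕ → XSpace s V W ε)
    (R : ℝ) (hR : ∀ n, ‖z n‖ ≤ R) :
    ∃ k : ℕ → ℕ, StrictMono k ∧ ∀ e > 0, ∃ n₀, ∀ n ≥ n₀, ∀ m ≥ n₀,
      ∫ x in K, ‖evalPair (z (k n) - z (k m)) x‖ ^ p ≤ e := by
  have hR0 : 0 ≤ R := (norm_nonneg _).trans (hR 0)
  have hp0 : 0 ≤ p := by linarith
  obtain ⟨k₁, hk₁, h₁⟩ := FracSpace.exists_subseq_cauchy_sq hc₀ hV hK (fun n => (z n).fst)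
    fun n => (norm_fst_le_norm _).trans (hR n)
  obtain ⟨k₂, hk₂, h₂⟩ := FracSpace.exists_subseq_cauchy_sq hc₀ hW hK (fun n => (z (k₁ n)).snd)
    fun n => (norm_snd_le_norm _).trans (hR _)
  refine ⟨k₁ ∘ k₂, hk₁.comp hk₂, fun e he => ?_⟩
  have h₁' := h₁.comp (hk₂.tendsto_atTop.prodMap hk₂.tendsto_atTop)
  have hb₁ : ∀ i : ℕ × ℕ, ‖(z (k₁ (k₂ i.1))).fst - (z (k₁ (k₂ i.2))).fst‖ ≤ R + R := fun i =>
    (norm_sub_le _ _).trans (add_le_add ((norm_fst_le_norm _).trans (hR _))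
      ((norm_fst_le_norm _).trans (hR _)))
  have hb₂ : ∀ i : ℕ × ℕ, ‖(z (k₁ (k₂ i.1))).snd - (z (k₁ (k₂ i.2))).snd‖ ≤ R + R := fun i =>
    (norm_sub_le _ _).trans (add_le_add ((norm_snd_le_norm _).trans (hR _))
      ((norm_snd_le_norm _).trans (hR _)))
  have t₁ := FracSpace.tendsto_integral_rpow hN hc₀ hV hp2 hp (by positivity) hb₁ h₁'
  have t₂ := FracSpace.tendsto_integral_rpow hN hc₀ hW hp2 hp (by positivity) hb₂ h₂
  have t := t₁.add t₂
  rw [add_zero, prod_atTop_atTop_eq] at t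
  obtain ⟨i₀, hi₀⟩ := eventually_atTop.1 (t.eventually (gt_mem_nhds he))
  refine ⟨max i₀.1 i₀.2, fun n hn m hm => ?_⟩
  refine le_trans ?_ (hi₀ (n, m)
    ⟨(le_max_left _ _).trans hn, (le_max_right _ _).trans hm⟩).le
  obtain ⟨B, -, h⟩ := FracSpace.exists_integral_rpow_le hN hc₀ hV hp2 hp
  obtain ⟨B', -, h'⟩ := FracSpace.exists_integral_rpow_le hN hc₀ hW hp2 hp
  obtain ⟨S, -, hS⟩ := exists_evalBound hN hc₀ hV hW hp2 hp K
  set w := z (k₁ (k₂ n)) - z (k₁ (k₂ m)) with hw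
  calc ∫ x in K, ‖evalPair w x‖ ^ p ≤ ∫ x in K, (|w.fst x| ^ p + |w.snd x| ^ p) :=
        integral_mono (hS.integrable w) ((h w.fst).1.restrict.add (h' w.snd).1.restrict)
          fun x => norm_evalPair_rpow_le w x p
    _ = _ := integral_add (h w.fst).1.restrict (h' w.snd).1.restrict

end Embedding

/-! ### The penalized functional in abstract form. -/

section PenalizedFunctional

variable {N : ℕ} {s : Ioo (0 : ℝ) 1} {V W : Potential N} {Λ : Set (E N)} {Q : ℝ × ℝ → ℝ}
  {a ε r M : ℝ} {η : ℝ → ℝ} {F : ℝ × ℝ → ℝ} {g : ℝ × ℝ → ℝ × ℝ →L[ℝ] ℝ}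

lemma GradLip.partial_sum_eq (h : GradLip r M F g) (u v : ℝ) :
    u * deriv (fun t => F (t, v)) u + v * deriv (fun t => F (u, t)) v = g (u, v) (u, v) := by
  have h1 : HasDerivAt (fun t : ℝ => (t, v)) ((1 : ℝ), (0 : ℝ)) u :=
    (hasDerivAt_id u).prodMk (hasDerivAt_const u v)
  have h2 : HasDerivAt (fun t : ℝ => (u, t)) ((0 : ℝ), (1 : ℝ)) v :=
    (hasDerivAt_const v u).prodMk (hasDerivAt_id v)
  have h3 : HasDerivAt (fun t => F (t, v)) (g (u, v) (1, 0)) u :=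
    (h.hasFDerivAt (u, v)).comp_hasDerivAt u h1
  have h4 : HasDerivAt (fun t => F (u, t)) (g (u, v) (0, 1)) v :=
    (h.hasFDerivAt (u, v)).comp_hasDerivAt v h2
  rw [h3.deriv, h4.deriv, ← smul_eq_mul, ← smul_eq_mul, ← map_smul, ← map_smul, ← map_add]
  simp

lemma integral_eq_add_of_eqOn {α : Type*} [MeasurableSpace α] {μ : Measure α} {f f₁ f₂ : α → ℝ}
    {B : Set α} (hB : MeasurableSet B) (h1 : ∀ x ∈ B, f x = f₁ x) (h2 : ∀ x ∈ Bᶜ, f x = f₂ x)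
    (hi1 : IntegrableOn f₁ B μ) (hi2 : IntegrableOn f₂ Bᶜ μ) :
    ∫ x, f x ∂μ = (∫ x in B, f₁ x ∂μ) + ∫ x in Bᶜ, f₂ x ∂μ := by
  classical
  rw [← integral_piecewise hB hi1 hi2]
  refine integral_congr_ae (Eventually.of_forall fun x => ?_)
  by_cases hx : x ∈ B
  · simp [hx, h1 x hx]
  · simp [hx, h2 x hx]

variable {p S S' M' : ℝ} {g' : ℝ × ℝ → ℝ × ℝ →L[ℝ] ℝ}

lemma JFun_eq (hΛ : MeasurableSet ((ε • · : E N → E N) ⁻¹' Λ))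
    (he : EvalBound (volume.restrict ((ε • · : E N → E N) ⁻¹' Λ)) p S
      (evalPair : XSpace s V W ε → E N → ℝ × ℝ))
    (hg : GradLip p M (fun z => extQ Q z.1 z.2) g) (hp : 2 ≤ p) (hM : 0 ≤ M)
    (he' : EvalBound (volume.restrict ((ε • · : E N → E N) ⁻¹' Λ)ᶜ) 2 S'
      (evalPair : XSpace s V W ε → E N → ℝ × ℝ))
    (hg' : GradLip 2 M' (fun z => hatQ Q a η z.1 z.2) g') (hM' : 0 ≤ M') (z : XSpace s V W ε) :
    JFun s V W Λ Q a η ε z = 1 / 2 * ‖z‖ ^ 2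
      - ((∫ x in (ε • · : E N → E N) ⁻¹' Λ, extQ Q (evalPair z x).1 (evalPair z x).2)
        + ∫ x in ((ε • · : E N → E N) ⁻¹' Λ)ᶜ, hatQ Q a η (evalPair z x).1 (evalPair z x).2) := by
  rw [JFun]
  congr 1
  refine integral_eq_add_of_eqOn hΛ (fun x hx => if_pos hx) (fun x hx => if_neg hx) ?_ ?_
  · exact he.integrable_comp hg hp hM z
  · exact he'.integrable_comp hg' le_rfl hM' z

/-- For fixed `x` the membership `εx ∈ Λ` does not depend on `(u, v)`, so the partial derivatives
are those of `Q` or of `Q̂`, and by the chain rule `u H_u + v H_v` is the gradient applied to the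
point itself. -/
lemma phiFun_eq (hΛ : MeasurableSet ((ε • · : E N → E N) ⁻¹' Λ))
    (he : EvalBound (volume.restrict ((ε • · : E N → E N) ⁻¹' Λ)) p S
      (evalPair : XSpace s V W ε → E N → ℝ × ℝ))
    (hg : GradLip p M (fun z => extQ Q z.1 z.2) g) (hp : 2 ≤ p)
    (he' : EvalBound (volume.restrict ((ε • · : E N → E N) ⁻¹' Λ)ᶜ) 2 S'
      (evalPair : XSpace s V W ε → E N → ℝ × ℝ))
    (hg' : GradLip 2 M' (fun z => hatQ Q a η z.1 z.2) g') (z : XSpace s V W ε) :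
    phiFun s V W Λ Q a η ε z = ‖z‖ ^ 2
      - ((∫ x in (ε • · : E N → E N) ⁻¹' Λ, g (evalPair z x) (evalPair z x))
        + ∫ x in ((ε • · : E N → E N) ⁻¹' Λ)ᶜ, g' (evalPair z x) (evalPair z x)) := by
  rw [phiFun]
  congr 1
  refine integral_eq_add_of_eqOn hΛ (fun x hx => ?_) (fun x hx => ?_)
    (he.integrable_grad hg hp z z) (he'.integrable_grad hg' le_rfl z z)
  · have e : ∀ u v : ℝ, penH Λ Q a η (ε • x) u v = extQ Q u v := fun u v => if_pos hx
    simp only [penHu, penHv, e]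
    exact hg.partial_sum_eq _ _
  · have e : ∀ u v : ℝ, penH Λ Q a η (ε • x) u v = hatQ Q a η u v := fun u v => if_neg hx
    simp only [penHu, penHv, e]
    exact hg'.partial_sum_eq _ _

lemma volume_preimage_smul_ne_top (hε : 0 < ε) (hΛ : Bornology.IsBounded Λ) :
    volume ((ε • · : E N → E N) ⁻¹' Λ) ≠ ⊤ := by
  obtain ⟨R, hR⟩ := hΛ.exists_norm_le
  refine ((Metric.isBounded_closedBall (x := (0 : E N)) (r := R / ε)).subset fun x hx => ?_)
    |>.measure_lt_top.ne
  have h : ‖ε • x‖ ≤ R := hR _ hx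
  rw [norm_smul, Real.norm_of_nonneg hε.le] at h
  rw [mem_closedBall_zero_iff, le_div_iff₀ hε]
  linarith

/-- If the gradient of the penalized nonlinearity has a small Lipschitz constant, then the
penalized functional satisfies the Palais-Smale condition on its Nehari manifold. -/
theorem palaisSmaleOn_of_gradLip (hN : 2 * (s : ℝ) < N) {c₀ : ℝ} (hc₀ : 0 < c₀)
    (hV : ∀ x, c₀ ≤ V x) (hW : ∀ x, c₀ ≤ W x) (hΛo : IsOpen Λ) (hΛb : Bornology.IsBounded Λ)
    (hQ : NonlinearityHyp N s p Q) (hM : 0 ≤ M)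
    (hg : GradLip p M (fun z => extQ Q z.1 z.2) (fun z => quadGrad Q (clip z))) (hM' : 0 ≤ M')
    (hg' : GradLip 2 M' (fun z => hatQ Q a η z.1 z.2) g')
    (hsmall : (2 ^ p + p + 5) * (M' * c₀⁻¹) < min 1 ((p - 2) / 2)) (hε : 0 < ε) (c : ℝ) :
    PalaisSmaleOn (JFun s V W Λ Q a η ε) (phiFun s V W Λ Q a η ε)
      (nehari (JFun s V W Λ Q a η ε)) c := by
  have hp := hQ.two_lt
  have hV' : ∀ x, c₀ ≤ V.scale ε x := fun x => hV _
  have hW' : ∀ x, c₀ ≤ W.scale ε x := fun x => hW _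
  have hB : MeasurableSet ((ε • · : E N → E N) ⁻¹' Λ) :=
    (hΛo.preimage (continuous_const_smul ε)).measurableSet
  have hBv := volume_preimage_smul_ne_top hε hΛb
  obtain ⟨S, hS, he⟩ := exists_evalBound hN hc₀ hV' hW' hp.le hQ.subcritical
    ((ε • · : E N → E N) ⁻¹' Λ)
  have he' := evalBound_two (s := s) hc₀ hV' hW' ((ε • · : E N → E N) ⁻¹' Λ)ᶜ
  have := FracSpace.completeSpace (s := s) hc₀ hV'
  have := FracSpace.completeSpace (s := s) hc₀ hW'
  have hc₀' : 0 ≤ c₀⁻¹ := by positivity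
  have hph := perturbedHomogeneous_add he hg hp hM hS he' hg' hM' hc₀'
    (fun z => hQ.quadGrad_clip_self z) (fun t ht z => hQ.extQ_smul ht z)
    (exists_subseq_integral_le hN hc₀ hV' hW' hp.le hQ.subcritical hBv)
  exact hph.palaisSmaleOn (fun z => JFun_eq hB he hg hp.le hM he' hg' hM' z)
    (fun z => phiFun_eq hB he hg hp.le he' hg' z) (hsmall.trans_le (min_le_left _ _)) hp
    (hsmall.trans_le (min_le_right _ _)) c

end PenalizedFunctional

end FracSchrodinger

end

/-! ### The choice of the cut-off parameter. -/

theorem mainTheorem3 (N : ℕ) (s : Set.Ioo (0 : ℝ) 1) (hN : 2 * (s : ℝ) < N)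
    (V W : FracSchrodinger.Potential N) (Λ : Set (FracSchrodinger.E N))
    (x₀ : FracSchrodinger.E N) (ρ₀ : ℝ) (hVW : FracSchrodinger.PotentialHyp V W Λ x₀ ρ₀)
    (p : ℝ) (Q : ℝ × ℝ → ℝ) (hQ : FracSchrodinger.NonlinearityHyp N s p Q)
    (C : ℝ) (hC : 0 < C) :
    ∃ a₀ : ℝ, 0 < a₀ ∧ ∀ a : ℝ, 0 < a → a < a₀ → ∀ η : ℝ → ℝ, FracSchrodinger.CutoffHyp C a η →
      ∀ ε : ℝ, 0 < ε → ∀ c : ℝ,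
        FracSchrodinger.PalaisSmaleOn
          (FracSchrodinger.JFun s V W Λ Q a η ε)
          (FracSchrodinger.phiFun s V W Λ Q a η ε)
          (FracSchrodinger.nehari (FracSchrodinger.JFun s V W Λ Q a η ε)) c := by
  have hp := hQ.two_lt
  obtain ⟨M, hM, hg⟩ := hQ.exists_gradLip
  obtain ⟨K, hK, hhat⟩ := FracSchrodinger.exists_gradLip_hatQ hg hp.le hM hC
  set c₀ := min (V x₀) (W x₀)
  have hc₀ : 0 < c₀ := lt_min (V.pos x₀) (W.pos x₀)
  -- `κ = L a^(p-2)`, with `L` independent of `a`, `η` and `ε`.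
  set L := (2 ^ p + p + 5) * (K * c₀⁻¹) with hL
  have hL0 : 0 ≤ L := by positivity
  set m := min 1 ((p - 2) / 2)
  have hm : 0 < m := lt_min one_pos (by linarith)
  have hp2 : 0 < p - 2 := by linarith
  -- For smaller `a` one has `a^(p-2) (L + 1) < m`, hence `κ < m`. The summand `1` covers `L = 0`.
  refine ⟨(m / (L + 1)) ^ (1 / (p - 2)), by positivity, fun a ha haa η hη ε hε c => ?_⟩
  have h1 : a ^ (p - 2) < m / (L + 1) := by
    calc a ^ (p - 2) < ((m / (L + 1)) ^ (1 / (p - 2))) ^ (p - 2) :=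
          Real.rpow_lt_rpow ha.le haa hp2
      _ = m / (L + 1) := by
          rw [← Real.rpow_mul (by positivity), one_div_mul_cancel hp2.ne', Real.rpow_one]
  rw [lt_div_iff₀ (by positivity)] at h1
  have h2 : 0 < a ^ (p - 2) := by positivity
  refine FracSchrodinger.palaisSmaleOn_of_gradLip hN hc₀
    (fun x => (min_le_left _ _).trans (hVW.h3 x).1) (fun x => (min_le_right _ _).trans (hVW.h3 x).2)
    hVW.isOpen hVW.isBounded hQ hM hg (by positivity) (hhat a ha η hη) ?_ hε c
  calc (2 ^ p + p + 5) * (K * a ^ (p - 2) * c₀⁻¹) = a ^ (p - 2) * L := by rw [hL]; ring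
    _ < m := by linarith
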